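/- **Setting.** Let $\mathbb{D}=\{t\in\mathbb{C}:|t|<1\}$, and let $\mathbb{L}$ be the completion of an algebraic closure of $\mathbb{C}((t))$, with the absolute value extending the $t$-adic one normalized by $|t|=e^{-1}$; its residue field is $\mathbb{C}$, and $a\mapsto\tilde a$ is the reduction $\mathbb{P}^1(\mathbb{L})\to\mathbb{P}^1(\mathbb{C})$. A meromorphic family of rational functions of degree $d$ is an $h\in(\mathcal{O}(\mathbb{D})[t^{-1}])(z)\subset\mathbb{L}(z)$ whose specialization $h_t$ has degree $d$ for each $t\in\mathbb{D}\setminus\{0\}$. Each non-constant $h\in\mathbb{L}(z)$ acts on the Berkovich line $\mathsf{P}^1=\mathsf{P}^1(\mathbb{L})$; let $\mathcal{S}_G$ be the Gauss point. For $\mathcal{S}\neq\mathcal{S}'$ let $U_{\overrightarrow{\mathcal{S}\mathcal{S}'}}$ be the component of $\mathsf{P}^1\setminus\{\mathcal{S}\}$ containing $\mathcal{S}'$ (the direction $\overrightarrow{\mathcal{S}\mathcal{S}'}$ at $\mathcal{S}$), and let $h_*$ be the tangent map of $h$ on directions. *Reduction.* Write $h=P/Q$ with $P,Q$ coprime and the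 maximum of the absolute values of all coefficients equal to $1$. Let $H_{\tilde h}$ be the greatest common divisor of the reductions $\tilde P,\tilde Q$ homogenized in degree $\deg h$, $[H_{\tilde h}=0]$ its divisor of zeros on $\mathbb{P}^1(\mathbb{C})$, and $\phi_{\tilde h}=\tilde P/\tilde Q$ (after cancellation). For a probability measure $\mu$ on $\mathbb{P}^1(\mathbb{C})$ put $\tilde h^*\mu=(\phi_{\tilde h})^*\mu+[H_{\tilde h}=0]$, where $\phi^*\mu=\int\bigl(\sum_{\phi(z)=w}(\deg_z\phi)\,\delta_z\bigr)\mu(dw)$, and $\phi^*\mu=0$ if $\phi$ is constant. *Quantization.* For a finite set $\Gamma$ of type II points let $S(\Gamma)$ be the partition of $\mathsf{P}^1$ into the singletons $\{\mathcal{S}\}$, $\mathcal{S}\in\Gamma$, and the components of $\mathsf{P}^1\setminus\Gamma$; let $M^1(\Gamma)$ be the set of probability measures on $S(\Gamma)$ (all subsets being measurable). Put $\Gamma_G=\{\mathcal{S}_G\}$, $\Gamma_h=\{\mathcal{S}_G,h(\mathcal{S}_G)\}$, and let $(\pi_{\Gamma_h,\Gamma_G})_*$ be the push-forward under the map sending $V\in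 S(\Gamma_h)$ to the element of $S(\Gamma_G)$ containing it. For a direction $\vec v=\overrightarrow{\mathcal{S}_Gz}$ let $m_{\vec v}(h)=\deg_{\tilde z}\phi_{\widetilde{B\circ h}}$, where $B$ is a Möbius transformation with $B(h(\mathcal{S}_G))=\mathcal{S}_G$, and let $s_{\vec v}(h)$ be the number such that each $w\in\mathbb{P}^1(\mathbb{L})$ has, with multiplicities, $m_{\vec v}(h)+s_{\vec v}(h)$ preimages in $U_{\vec v}$ if $w\in U_{h_*\vec v}$, and $s_{\vec v}(h)$ otherwise. For $V\in S(\Gamma_h)$ put $m_{V,U_{\vec v}}(h)=m_{\vec v}(h)+s_{\vec v}(h)$ if $V\subset U_{h_*\vec v}$ and $m_{V,U_{\vec v}}(h)=s_{\vec v}(h)$ otherwise; and $m_{V,\{\mathcal{S}_G\}}(h)=\deg_{\mathcal{S}_G}(h)$ (the local degree of $h$ on $\mathsf{P}^1$ at $\mathcal{S}_G$) if $V=\{h(\mathcal{S}_G)\}$ and $0$ otherwise. The quantized pullback of a measure $\omega$ on $S(\Gamma_h)$ is the measure on $S(\Gamma_G)$ with $$\bigl((h_{\Gamma_G,\Gamma_h})^*\omega\bigr)(U)=\sum_{V\in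 S(\Gamma_h)}m_{V,U}(h)\,\omega(V)\qquad(U\in S(\Gamma_G)).$$ **Statement.** Let $f$ be a meromorphic family of rational functions of degree $d>1$ with $f^{-1}(\mathcal{S}_G)\neq\{\mathcal{S}_G\}$, and let $A$ be a meromorphic family of Möbius transformations with $(A\circ f)(\mathcal{S}_G)=\mathcal{S}_G$. When $\Gamma_f\neq\Gamma_G$, let $h_A$ be the unique point of the support of $[H_{\tilde A}=0]$ and $a_A$ the constant value of $\phi_{\tilde A}$. Let $\mu_C,\mu_E$ be Borel probability measures on $\mathbb{P}^1(\mathbb{C})$ satisfying the admissibility condition: $\tilde A^*\mu_E=\mu_C$ if $\Gamma_f=\Gamma_G$, and $\mu_C(\{h_A\})+\mu_E(\{a_A\})\ge 1$ if $\Gamma_f\ne\Gamma_G$. Let $\nu_C,\nu_E$ be the atomless parts of $\mu_C,\mu_E$. Then there is a unique $\omega_\mu\in M^1(\Gamma_f)$ such that * if $\Gamma_f=\Gamma_G$: $\omega_\mu(\{\mathcal{S}_G\})=\nu_E(\mathbb{P}^1(\mathbb{C}))$ and $\omega_\mu(U_{(A^{-1})_*\overrightarrow{\mathcal{S}_Gy}})=\mu_E(\{\tilde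 y\})$ for all $y\in\mathbb{P}^1(\mathbb{L})$; * if $\Gamma_f\neq\Gamma_G$: $\omega_\mu(\{\mathcal{S}_G\})=\nu_C(\mathbb{P}^1(\mathbb{C}))$; $\omega_\mu(U_{\overrightarrow{\mathcal{S}_Gx}})=\mu_C(\{\tilde x\})$ for all $x\in\mathbb{P}^1(\mathbb{L})$ with $\tilde x\neq h_A$; $\omega_\mu(\{f(\mathcal{S}_G)\})=\nu_E(\mathbb{P}^1(\mathbb{C}))$; $\omega_\mu(U_{(A^{-1})_*\overrightarrow{\mathcal{S}_Gy}})=\mu_E(\{\tilde y\})$ for all $y\in\mathbb{P}^1(\mathbb{L})$ with $\tilde y\neq a_A$; and $\omega_\mu\bigl(U_{\overrightarrow{\mathcal{S}_Gf(\mathcal{S}_G)}}\cap U_{\overrightarrow{f(\mathcal{S}_G)\mathcal{S}_G}}\bigr)=\mu_C(\{h_A\})+\mu_E(\{a_A\})-1$. Moreover, if $(\widetilde{A\circ f})^*\mu_E=d\cdot\mu_C$ on $\mathbb{P}^1(\mathbb{C})$, then $$(f_{\Gamma_G,\Gamma_f})^*\omega_\mu=d\cdot(\pi_{\Gamma_f,\Gamma_G})_*\omega_\mu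 .$$ -/

import Mathlib

namespace DegBerk

noncomputable section

open scoped LaurentSeries NNReal ENNReal
open Polynomial MeasureTheory

/-! ### The field `𝕃` of formal Puiseux series -/

/-- The field `ℂ((t))` of formal Laurent series. -/
abbrev CLaurent := ℂ⸨X⸩

/-- The `t`-adic absolute value on `ℂ((t))` is normalized by `|t| = e⁻¹`. -/
instance CLaurent.rankOne :
    (Valued.v : Valuation CLaurent (WithZero (Multiplicative ℤ))).RankOne where
  hom' := (WithZeroMulInt.toNNReal (e := (Real.exp 1).toNNReal)
    (by simp [Real.exp_pos])).comp MonoidWithZeroHom.ValueGroup₀.embedding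
  strictMono' := (WithZeroMulInt.toNNReal_strictMono (by simp)).comp
    MonoidWithZeroHom.ValueGroup₀.embedding_strictMono
  exists_val_nontrivial := by
    refine ⟨(HahnSeries.ofPowerSeries ℤ ℂ) PowerSeries.X ^ 1, ?_, ?_⟩
    · rw [LaurentSeries.valuation_X_pow]; simp
    · rw [LaurentSeries.valuation_X_pow, ← WithZero.exp_zero, Ne, WithZero.exp_inj]; simp

instance CLaurent.normed : NontriviallyNormedField CLaurent :=
  Valued.toNontriviallyNormedField (L := CLaurent) (Γ₀ := WithZero (Multiplicative ℤ))

/-- The algebraic closure of `ℂ((t))`, with the unique extension of the absolute value. -/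
abbrev PuiseuxAlg := AlgebraicClosure CLaurent

instance PuiseuxAlg.isAlgebraic : Algebra.IsAlgebraic CLaurent PuiseuxAlg :=
  AlgebraicClosure.isAlgebraic _

instance PuiseuxAlg.normed : NormedField PuiseuxAlg :=
  spectralNorm.normedField CLaurent PuiseuxAlg

instance PuiseuxAlg.normedAlgebra : NormedAlgebra CLaurent PuiseuxAlg :=
  spectralNorm.normedAlgebra _ _

instance PuiseuxAlg.uniformContinuousConstSMul :
    UniformContinuousConstSMul CLaurent PuiseuxAlg :=
  uniformContinuousConstSMul_of_continuousConstSMul _ _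

/-- The completion `𝕃` of the algebraic closure of `ℂ((t))`. -/
abbrev 𝕃 := UniformSpace.Completion PuiseuxAlg

instance Puiseux.ultrametric : IsUltrametricDist 𝕃 := IsUltrametricDist.of_normedAlgebra CLaurent

/-- The inclusion of `ℂ((t))` in `𝕃`. -/
def ofLaurent : CLaurent →+* 𝕃 := algebraMap CLaurent 𝕃

/-- The inclusion of the constants `ℂ` in `𝕃`. -/
def constEmb : ℂ →+* 𝕃 := ofLaurent.comp HahnSeries.C

/-! ### Rational maps of the projective line `F ∪ {∞}` over a field -/

section RationalMaps

variable {F : Type*} [Field F]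

/-- The action on `ℙ¹(F)` of the quotient `p / q` of two coprime polynomials. -/
def evalP1 (p q : F[X]) : OnePoint F → OnePoint F
  | OnePoint.some z => open Classical in
      if q.eval z = 0 then OnePoint.infty else OnePoint.some (p.eval z / q.eval z)
  | OnePoint.infty => open Classical in
      if q.coeff (max p.natDegree q.natDegree) = 0 then OnePoint.infty
      else OnePoint.some (p.coeff (max p.natDegree q.natDegree) /
        q.coeff (max p.natDegree q.natDegree))

/-- For coprime `p, q`, the polynomial whose zeros are the solutions of `p / q = w`. -/
def fiberPoly (p q : F[X]) : OnePoint F → F[X]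
  | OnePoint.some w => p - C w * q
  | OnePoint.infty => q

/-- The local degree at a point of `ℙ¹(F)` of the quotient `p / q` of two coprime polynomials:
the multiplicity of the point as a solution of `p / q = w`, where `w` is its image.
It is `0` everywhere if `p / q` is constant. -/
def localDegP1 (p q : F[X]) : OnePoint F → ℕ
  | OnePoint.some z => (fiberPoly p q (evalP1 p q (OnePoint.some z))).rootMultiplicity z
  | OnePoint.infty => max p.natDegree q.natDegree -
      (fiberPoly p q (evalP1 p q OnePoint.infty)).natDegree

/-- The degree of a rational function. -/
def ratDeg (h : RatFunc F) : ℕ := max h.num.natDegree h.denom.natDegree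

/-- The composition `A ∘ f`, for `f` not a constant. -/
def ratComp (A f : RatFunc F) : RatFunc F := RatFunc.eval RatFunc.C f A

/-- The inverse `(d z - b) / (- c z + a)` of the Möbius transformation
`A = (a z + b) / (c z + d)`. -/
def mobiusInv (A : RatFunc F) : RatFunc F :=
  (RatFunc.C (A.denom.coeff 0) * RatFunc.X - RatFunc.C (A.num.coeff 0)) /
    (-(RatFunc.C (A.denom.coeff 1) * RatFunc.X) + RatFunc.C (A.num.coeff 1))

end RationalMaps

/-! ### The Berkovich projective line -/

section Berkovich

variable (K : Type*) [NormedField K]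

/-- A point of the Berkovich affine line: a multiplicative seminorm on `K[z]` that extends the
absolute value of `K`. -/
structure AffPoint where
  sn : MulRingSeminorm K[X]
  map_C : ∀ a : K, sn (C a) = ‖a‖

/-- The Berkovich projective line `𝖯¹(K)`. -/
inductive Berk where
  | infty : Berk
  | aff : AffPoint K → Berk

variable {K}

/-- The classical point `a` of the affine line, i.e. the seminorm `P ↦ |P(a)|`. -/
def AffPoint.classical (a : K) : AffPoint K where
  sn :=
    { toFun := fun P => ‖P.eval a‖
      map_zero' := by simp
      add_le' := fun P Q => by simpa using norm_add_le _ _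
      neg' := by simp
      map_one' := by simp
      map_mul' := by simp }
  map_C := fun b => by
    change ‖(C b).eval a‖ = ‖b‖
    simp

/-- The inclusion of `ℙ¹(K)` in `𝖯¹(K)`. -/
def classicalPt : OnePoint K → Berk K
  | OnePoint.some a => Berk.aff (AffPoint.classical a)
  | OnePoint.infty => Berk.infty

/-- The Gauss point, i.e. the seminorm `∑ aᵢ zⁱ ↦ max |aᵢ|`. -/
def AffPoint.gauss [IsUltrametricDist K] : AffPoint K where
  sn :=
    { toFun := fun P => P.gaussNorm (NormedField.toAbsoluteValue K) 1
      map_zero' := by simp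
      add_le' := fun P Q => by
        have h := Polynomial.isNonarchimedean_gaussNorm (NormedField.toAbsoluteValue K)
          IsUltrametricDist.norm_add_le_max zero_le_one P Q
        have h1 := P.gaussNorm_nonneg (NormedField.toAbsoluteValue K) zero_le_one
        have h2 := Q.gaussNorm_nonneg (NormedField.toAbsoluteValue K) zero_le_one
        exact h.trans (max_le_add_of_nonneg h1 h2)
      neg' := fun P => by
        have h := Polynomial.gaussNorm_mul (v := NormedField.toAbsoluteValue K)
          (fun a b => IsUltrametricDist.norm_add_le_max a b) zero_lt_one (C (-1)) P
        rw [Polynomial.gaussNorm_C] at h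
        simpa using h
      map_one' := by
        rw [← Polynomial.C_1, Polynomial.gaussNorm_C, map_one]
      map_mul' := fun P Q => Polynomial.gaussNorm_mul (v := NormedField.toAbsoluteValue K)
        (fun a b => IsUltrametricDist.norm_add_le_max a b) zero_lt_one P Q }
  map_C := fun b => by
    change (C b).gaussNorm (NormedField.toAbsoluteValue K) 1 = ‖b‖
    rw [Polynomial.gaussNorm_C]; rfl

/-- The Gauss point `𝒮_G`. -/
def gaussPt [IsUltrametricDist K] : Berk K := Berk.aff AffPoint.gauss

/-- `|g|_x` for a rational function `g` without pole at `x`. -/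
def AffPoint.ratVal (x : AffPoint K) (g : RatFunc K) : ℝ := x.sn g.num / x.sn g.denom

theorem AffPoint.ratVal_div (x : AffPoint K) (a b : K[X]) (hb : x.sn b ≠ 0) :
    x.ratVal (algebraMap K[X] (RatFunc K) a / algebraMap K[X] (RatFunc K) b) =
      x.sn a / x.sn b := by
  have hb0 : b ≠ 0 := fun h => hb (by rw [h, map_zero])
  have hd : x.sn (RatFunc.denom (algebraMap K[X] (RatFunc K) a / algebraMap K[X] (RatFunc K) b))
      ≠ 0 := by
    intro h
    obtain ⟨c, hc⟩ := RatFunc.denom_div_dvd a b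
    apply hb
    rw [hc, map_mul, h, zero_mul]
  rw [AffPoint.ratVal, div_eq_div_iff hd hb, ← map_mul, ← map_mul,
    (RatFunc.num_mul_eq_mul_denom_iff hb0).2 rfl]

theorem AffPoint.exists_aeval_eq_div (x : AffPoint K) (h : RatFunc K) (hq : x.sn h.denom ≠ 0)
    (P : K[X]) : ∃ a b : K[X], x.sn b ≠ 0 ∧
      aeval h P = algebraMap K[X] (RatFunc K) a / algebraMap K[X] (RatFunc K) b := by
  have key : ∀ b : K[X], x.sn b ≠ 0 → algebraMap K[X] (RatFunc K) b ≠ 0 := fun b hb h0 =>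
    hb (by rw [(map_eq_zero_iff _ (RatFunc.algebraMap_injective K)).1 h0, map_zero])
  induction P using Polynomial.induction_on with
  | C c => exact ⟨C c, 1, by simp, by simp [RatFunc.algebraMap_eq_C]⟩
  | add P Q hP hQ =>
    obtain ⟨a, b, hb, e⟩ := hP
    obtain ⟨a', b', hb', e'⟩ := hQ
    refine ⟨a * b' + b * a', b * b', by simp [hb, hb'], ?_⟩
    rw [map_add, e, e', div_add_div _ _ (key b hb) (key b' hb')]
    simp
  | monomial n c hn =>
    obtain ⟨a, b, hb, e⟩ := hn
    refine ⟨a * h.num, b * h.denom, by simp [hb, hq], ?_⟩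
    rw [pow_succ, ← mul_assoc, map_mul, e, aeval_X]
    conv_lhs => rw [← RatFunc.num_div_denom h]
    rw [div_mul_div_comm]
    simp

/-- The image of `x` under a rational function `h` without pole at `x`:
the seminorm `P ↦ |P ∘ h|_x`. -/
def AffPoint.push (x : AffPoint K) (h : RatFunc K) (hq : x.sn h.denom ≠ 0) : AffPoint K where
  sn :=
    { toFun := fun P => x.ratVal (aeval h P)
      map_zero' := by simp [AffPoint.ratVal]
      add_le' := fun P Q => by
        obtain ⟨a, b, hb, e⟩ := x.exists_aeval_eq_div h hq P
        obtain ⟨a', b', hb', e'⟩ := x.exists_aeval_eq_div h hq Q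
        have hb0 : algebraMap K[X] (RatFunc K) b ≠ 0 := fun h0 =>
          hb (by rw [(map_eq_zero_iff _ (RatFunc.algebraMap_injective K)).1 h0, map_zero])
        have hb0' : algebraMap K[X] (RatFunc K) b' ≠ 0 := fun h0 =>
          hb' (by rw [(map_eq_zero_iff _ (RatFunc.algebraMap_injective K)).1 h0, map_zero])
        have hbb : x.sn (b * b') ≠ 0 := by simp [hb, hb']
        have hs : aeval h (P + Q) = algebraMap K[X] (RatFunc K) (a * b' + b * a') /
            algebraMap K[X] (RatFunc K) (b * b') := by
          rw [map_add, e, e', div_add_div _ _ hb0 hb0']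
          simp
        rw [hs, e, e', x.ratVal_div _ _ hbb, x.ratVal_div _ _ hb, x.ratVal_div _ _ hb',
          div_add_div _ _ hb hb', map_mul]
        have hle : x.sn (a * b' + b * a') ≤ x.sn a * x.sn b' + x.sn b * x.sn a' := by
          rw [← map_mul, ← map_mul]
          exact map_add_le_add _ _ _
        exact div_le_div_of_nonneg_right hle (mul_nonneg (apply_nonneg _ _) (apply_nonneg _ _))
      neg' := fun P => by
        obtain ⟨a, b, hb, e⟩ := x.exists_aeval_eq_div h hq P
        have hs : aeval h (-P) = algebraMap K[X] (RatFunc K) (-a) /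
            algebraMap K[X] (RatFunc K) b := by
          rw [map_neg, e, map_neg, neg_div]
        rw [hs, e, x.ratVal_div _ _ hb, x.ratVal_div _ _ hb, map_neg_eq_map]
      map_one' := by simp [AffPoint.ratVal]
      map_mul' := fun P Q => by
        obtain ⟨a, b, hb, e⟩ := x.exists_aeval_eq_div h hq P
        obtain ⟨a', b', hb', e'⟩ := x.exists_aeval_eq_div h hq Q
        have hbb : x.sn (b * b') ≠ 0 := by simp [hb, hb']
        have hs : aeval h (P * Q) = algebraMap K[X] (RatFunc K) (a * a') /
            algebraMap K[X] (RatFunc K) (b * b') := by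
          rw [map_mul, e, e', div_mul_div_comm]
          simp
        rw [hs, e, e', x.ratVal_div _ _ hbb, x.ratVal_div _ _ hb, x.ratVal_div _ _ hb',
          map_mul, map_mul, div_mul_div_comm] }
  map_C := fun c => by
    change x.ratVal (aeval h (C c)) = ‖c‖
    have hs : aeval h (C c) = algebraMap K[X] (RatFunc K) (C c) /
        algebraMap K[X] (RatFunc K) 1 := by
      simp [RatFunc.algebraMap_eq_C]
    rw [hs, x.ratVal_div _ _ (by simp), x.map_C]
    simp

/-- The action on `𝖯¹(K)` of a rational function. -/
def berkMap (h : RatFunc K) : Berk K → Berk K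
  | Berk.infty => classicalPt (evalP1 h.num h.denom OnePoint.infty)
  | Berk.aff x => open Classical in
      if hq : x.sn h.denom = 0 then Berk.infty else Berk.aff (x.push h hq)

/-- The partial order of `𝖯¹(K)`, which extends the inclusion of closed disks;
`∞` is the largest element. -/
def Berk.Le : Berk K → Berk K → Prop
  | _, Berk.infty => True
  | Berk.infty, Berk.aff _ => False
  | Berk.aff x, Berk.aff y => ∀ P : K[X], x.sn P ≤ y.sn P

/-- The closed interval `[S, S']`: the union of the order intervals from `S` and from `S'` to the
least upper bound of `S` and `S'`. -/
def interval (S S' : Berk K) : Set (Berk K) :=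
  {R | (S.Le R ∨ S'.Le R) ∧ ∀ T : Berk K, S.Le T → S'.Le T → R.Le T}

/-- The direction at `S` of the intervals `(S, S']`, as the subset `U` of `𝖯¹(K) \ {S}` of all `T`
such that `(S, T]` and `(S, S']` have the same germ at `S`. It is empty if `S' = S`. -/
def dir (S S' : Berk K) : Set (Berk K) :=
  {T | T ≠ S ∧ ∃ R, R ≠ S ∧ R ∈ interval S S' ∧ R ∈ interval S T}

/-- The topology of `𝖯¹(K)`, generated by the directions at all points. -/
instance Berk.topology : TopologicalSpace (Berk K) :=
  TopologicalSpace.generateFrom {U | ∃ S S' : Berk K, S' ≠ S ∧ U = dir S S'}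

/-- The tangent map of `h` at `S`, from the directions at `S` to those at `h(S)`: it maps `U` to
the common direction at `h(S)` of all `h(S')`, for `S' ≠ S` in `U` close to `S` on an interval
issued from `S`. -/
def dirMap (h : RatFunc K) (S : Berk K) (U : Set (Berk K)) : Set (Berk K) :=
  {T | ∃ S₀ ∈ U, ∀ S' ∈ interval S S₀, S' ≠ S → T ∈ dir (berkMap h S) (berkMap h S')}

/-- `(h^* δ_w)(N)` for a classical point `w`: the number of solutions of `h = w` in `N`, counted
with multiplicities. -/
def solCount (h : RatFunc K) (w : OnePoint K) (N : Set (Berk K)) : ℕ :=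
  ∑ᶠ z ∈ {z : OnePoint K | evalP1 h.num h.denom z = w ∧ classicalPt z ∈ N},
    localDegP1 h.num h.denom z

/-- The local degree of `h` at a point `S` of `𝖯¹(K)`: the largest number of solutions of an
equation `h = w` in a sufficiently small neighborhood of `S`, counted with multiplicities. -/
def berkLocalDeg (h : RatFunc K) (S : Berk K) : ℕ :=
  sInf {n | ∃ N : Set (Berk K), IsOpen N ∧ S ∈ N ∧ ∀ w : OnePoint K, solCount h w N ≤ n}

/-- The element of `S(Γ)` that contains `x`. -/
def pieceSet (Γ : Set (Berk K)) (x : Berk K) : Set (Berk K) := open Classical in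
  if x ∈ Γ then {x} else connectedComponentIn Γᶜ x

/-- The partition `S(Γ)` of `𝖯¹(K)` in the singletons `{x}`, `x ∈ Γ`, and the connected components
of `𝖯¹(K) \ Γ`. -/
def Pieces (Γ : Set (Berk K)) : Type _ := {U : Set (Berk K) // ∃ x, U = pieceSet Γ x}

/-- The underlying subset of `𝖯¹(K)`. -/
def Pieces.set {Γ : Set (Berk K)} (U : Pieces Γ) : Set (Berk K) := U.1

/-- The elements of `M(Γ)` are the measures on `S(Γ)`, all of whose subsets are measurable. -/
instance Pieces.measurableSpace (Γ : Set (Berk K)) : MeasurableSpace (Pieces Γ) := ⊤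

/-- The value `ω(U)` at a union `U` of elements of `S(Γ)`. -/
def mass {Γ : Set (Berk K)} (ω : Measure (Pieces Γ)) (U : Set (Berk K)) : ℝ≥0∞ :=
  ω {V | V.set ⊆ U}

/-- The projection `S(Γ') → S(Γ)` for `Γ ⊆ Γ'`: the element of `S(Γ)` that contains `V`. -/
def projPieces (Γ' Γ : Set (Berk K)) (V : Pieces Γ') : Pieces Γ :=
  ⟨pieceSet Γ V.2.choose, V.2.choose, rfl⟩

variable [IsUltrametricDist K]

/-- `Γ_G = {𝒮_G}`. -/
def gammaG : Set (Berk K) := {gaussPt}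

/-- `Γ_h = {𝒮_G, h(𝒮_G)}`. -/
def gamma (h : RatFunc K) : Set (Berk K) := {gaussPt, berkMap h gaussPt}

end Berkovich

/-! ### Reduction from `𝕃` to its residue field `ℂ` -/

/-- The residue class of an integer `a` of `𝕃`, in the residue field `ℂ`: the unique constant `c`
with `|a - c| < 1`. -/
def redC (a : 𝕃) : ℂ := Classical.epsilon fun c : ℂ => ‖a - constEmb c‖ < 1

/-- The reduction `ℙ¹(𝕃) → ℙ¹(ℂ)`. -/
def redPt : OnePoint 𝕃 → OnePoint ℂ
  | OnePoint.some a => open Classical in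
      if ‖a‖ ≤ 1 then OnePoint.some (redC a) else OnePoint.infty
  | OnePoint.infty => OnePoint.infty

/-- A coefficient of `h = P / Q` of maximal absolute value, by which `P` and `Q` are divided
in order to normalize `h`. -/
def normConst (h : RatFunc 𝕃) : 𝕃 := Classical.epsilon fun c : 𝕃 =>
  (∃ i, h.num.coeff i = c ∨ h.denom.coeff i = c) ∧
    ∀ i, ‖h.num.coeff i‖ ≤ ‖c‖ ∧ ‖h.denom.coeff i‖ ≤ ‖c‖

/-- The reduction of the normalized numerator of `h`. -/
def redNum (h : RatFunc 𝕃) : ℂ[X] :=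
  ∑ i ∈ Finset.range (ratDeg h + 1), monomial i (redC (h.num.coeff i / normConst h))

/-- The reduction of the normalized denominator of `h`. -/
def redDen (h : RatFunc 𝕃) : ℂ[X] :=
  ∑ i ∈ Finset.range (ratDeg h + 1), monomial i (redC (h.denom.coeff i / normConst h))

/-- The greatest common divisor `H(1, ζ)`, in the affine coordinate, of the reductions of numerator
and denominator. -/
def redGcd (h : RatFunc 𝕃) : ℂ[X] := EuclideanDomain.gcd (redNum h) (redDen h)

/-- The multiplicity of a point in the divisor `[H = 0]` on `ℙ¹(ℂ)`, where `H` is the greatest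
common divisor of the reductions of numerator and denominator, homogenized in degree `deg h`. -/
def ordH (h : RatFunc 𝕃) : OnePoint ℂ → ℕ
  | OnePoint.some ζ => (redGcd h).rootMultiplicity ζ
  | OnePoint.infty => ratDeg h - max (redNum h).natDegree (redDen h).natDegree

/-- Numerator of the reduction `φ` of `h`. -/
def phiNum (h : RatFunc 𝕃) : ℂ[X] := redNum h / redGcd h

/-- Denominator of the reduction `φ` of `h`; it is `0` if `φ` is the constant `∞`. -/
def phiDen (h : RatFunc 𝕃) : ℂ[X] := redDen h / redGcd h

/-- The action on `ℙ¹(ℂ)` of the reduction `φ` of `h`. -/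
def phi (h : RatFunc 𝕃) : OnePoint ℂ → OnePoint ℂ := evalP1 (phiNum h) (phiDen h)

/-- The local degrees of the reduction `φ` of `h`. -/
def phiDeg (h : RatFunc 𝕃) : OnePoint ℂ → ℕ := localDegP1 (phiNum h) (phiDen h)

instance sphereMeasurableSpace : MeasurableSpace (OnePoint ℂ) := borel _

instance sphereBorelSpace : BorelSpace (OnePoint ℂ) := ⟨rfl⟩

/-- The value at a Borel set `E` of the pullback `φ^* μ + [H = 0]` of `μ` under the reduction of
`h`, where `(φ^* μ)(E)` is the integral with respect to `μ(dw)` of the number of solutions of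
`φ = w` in `E`, counted with multiplicities. -/
def redPullback (h : RatFunc 𝕃) (μ : Measure (OnePoint ℂ)) (E : Set (OnePoint ℂ)) : ℝ≥0∞ :=
  (∫⁻ w, ((∑ᶠ z ∈ {z : OnePoint ℂ | phi h z = w ∧ z ∈ E}, phiDeg h z : ℕ) : ℝ≥0∞) ∂μ) +
    ((∑ᶠ z ∈ E, ordH h z : ℕ) : ℝ≥0∞)

/-! ### Directional, surplus and quantized local degrees at the Gauss point -/

/-- A Möbius transformation `B` with `B(h(𝒮_G)) = 𝒮_G`. -/
def rescaling (h : RatFunc 𝕃) : RatFunc 𝕃 :=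
  Classical.epsilon fun B : RatFunc 𝕃 => ratDeg B = 1 ∧ berkMap B (berkMap h gaussPt) = gaussPt

/-- The directional local degree of `h` on a direction `U` at `𝒮_G`: the local degree of the
reduction of `B ∘ h` at `z̃`, where `U` is the direction of `z`. -/
def dirDeg (h : RatFunc 𝕃) (U : Set (Berk 𝕃)) : ℕ :=
  phiDeg (ratComp (rescaling h) h)
    (redPt (Classical.epsilon fun z : OnePoint 𝕃 => classicalPt z ∈ U))

/-- The surplus local degree of `h` on a direction `U` at `𝒮_G`: the number `s` such that each
`w` has `m + s` preimages in `U`, counted with multiplicities, if `w` lies in the image of the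
direction `U` under the tangent map, and `s` otherwise; here `m` is the directional local degree. -/
def surplus (h : RatFunc 𝕃) (U : Set (Berk 𝕃)) : ℕ := open Classical in
  Classical.epsilon fun s : ℕ => ∀ w : OnePoint 𝕃,
    solCount h w U = if classicalPt w ∈ dirMap h gaussPt U then dirDeg h U + s else s

/-- The quantized local degree `m_{V,U}(h)` for `V ∈ S(Γ_h)` and `U ∈ S(Γ_G)`. -/
def quantDeg (h : RatFunc 𝕃) (V : Pieces (gamma h)) (U : Pieces (gammaG (K := 𝕃))) : ℕ :=
  open Classical in
  if U.set = {gaussPt} then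
    if V.set = {berkMap h gaussPt} then berkLocalDeg h gaussPt else 0
  else
    if V.set ⊆ dirMap h gaussPt U.set then dirDeg h U.set + surplus h U.set
    else surplus h U.set

/-- The quantized pullback `M(Γ_h) → M(Γ_G)`. -/
def quantPullback (h : RatFunc 𝕃) (ω : Measure (Pieces (gamma h))) :
    Measure (Pieces (gammaG (K := 𝕃))) :=
  Measure.sum fun U => (∑' V, (quantDeg h V U : ℝ≥0∞) * ω {V}) • Measure.dirac U

/-- The projection `M(Γ_h) → M(Γ_G)`. -/
def quantProj (h : RatFunc 𝕃) (ω : Measure (Pieces (gamma h))) :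
    Measure (Pieces (gammaG (K := 𝕃))) :=
  ω.map (projPieces (gamma h) gammaG)

/-! ### Meromorphic families, admissible pairs, and the measure `ω_μ` -/

/-- The Taylor series at `0` of a function, as an element of `𝕃`. -/
def taylorAtZero (g : ℂ → ℂ) : 𝕃 :=
  ofLaurent (HahnSeries.ofPowerSeries ℤ ℂ
    (PowerSeries.mk fun n => iteratedDeriv n g 0 / (n.factorial : ℂ)))

/-- `h` is a meromorphic family of rational functions of degree `d` on `ℙ¹(ℂ)`, parametrized by the
unit disk: it is a quotient of polynomials in `z`, with coefficients in the ring `𝒪(𝔻)[1/t]`, whose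
specialization at each `t ≠ 0` in the disk has degree `d`. After multiplication of numerator and
denominator by a meromorphic function of `t`, the coefficients are in `𝒪(𝔻)` and have no common
zero `t ≠ 0`. -/
def IsMeromorphicFamily (d : ℕ) (h : RatFunc 𝕃) : Prop :=
  ∃ a b : ℕ → ℂ → ℂ,
    (∀ j, DifferentiableOn ℂ (a j) (Metric.ball 0 1) ∧
      DifferentiableOn ℂ (b j) (Metric.ball 0 1)) ∧
    h = algebraMap 𝕃[X] (RatFunc 𝕃)
          (∑ j ∈ Finset.range (d + 1), monomial j (taylorAtZero (a j))) /
        algebraMap 𝕃[X] (RatFunc 𝕃)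
          (∑ j ∈ Finset.range (d + 1), monomial j (taylorAtZero (b j))) ∧
    ∀ t : ℂ, t ≠ 0 → ‖t‖ < 1 →
      IsCoprime (∑ j ∈ Finset.range (d + 1), monomial j (a j t))
        (∑ j ∈ Finset.range (d + 1), monomial j (b j t)) ∧
      (a d t ≠ 0 ∨ b d t ≠ 0)

/-- The point `h_A`, the support of the divisor `[H = 0]` of the reduction of `A`,
for a Möbius transformation `A` with constant reduction. -/
def holePt (A : RatFunc 𝕃) : OnePoint ℂ := Classical.epsilon fun ζ => ordH A ζ ≠ 0

/-- The point `a_A`, the value of the reduction of `A`, if it is constant. -/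
def constPt (A : RatFunc 𝕃) : OnePoint ℂ := Classical.epsilon fun a => ∀ ζ, phi A ζ = a

/-- The admissibility of the pair `(μ_C, μ_E)`. -/
def Admissible (f A : RatFunc 𝕃) (μC μE : Measure (OnePoint ℂ)) : Prop :=
  (gamma f = gammaG → ∀ E, MeasurableSet E → redPullback A μE E = μC E) ∧
  (gamma f ≠ gammaG → 1 ≤ μC {holePt A} + μE {constPt A})

/-- The total mass of the atomless part of `μ`. -/
def diffuseMass (μ : Measure (OnePoint ℂ)) : ℝ≥0∞ := μ {x | μ {x} = 0}

/-- The direction `(A⁻¹)_*` of the direction of `y` at `𝒮_G`. -/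
def invDir (A : RatFunc 𝕃) (y : OnePoint 𝕃) : Set (Berk 𝕃) :=
  dirMap (mobiusInv A) gaussPt (dir gaussPt (classicalPt y))

/-- `ω` is the probability measure `ω_μ ∈ M¹(Γ_f)` attached to `μ = (μ_C, μ_E)`. -/
structure IsOmega (f A : RatFunc 𝕃) (μC μE : Measure (OnePoint ℂ))
    (ω : Measure (Pieces (gamma f))) : Prop where
  prob : ω Set.univ = 1
  of_eq : gamma f = gammaG →
    mass ω {gaussPt} = diffuseMass μE ∧
    ∀ y : OnePoint 𝕃, mass ω (invDir A y) = μE {redPt y}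
  of_ne : gamma f ≠ gammaG →
    mass ω {gaussPt} = diffuseMass μC ∧
    (∀ x : OnePoint 𝕃, redPt x ≠ holePt A →
      mass ω (dir gaussPt (classicalPt x)) = μC {redPt x}) ∧
    mass ω {berkMap f gaussPt} = diffuseMass μE ∧
    (∀ y : OnePoint 𝕃, redPt y ≠ constPt A → mass ω (invDir A y) = μE {redPt y}) ∧
    mass ω (dir gaussPt (berkMap f gaussPt) ∩ dir (berkMap f gaussPt) gaussPt) =
      μC {holePt A} + μE {constPt A} - 1

end

end DegBerk

open DegBerk MeasureTheory
open scoped ENNReal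

namespace DegBerk

noncomputable section

open scoped LaurentSeries NNReal ENNReal
open Polynomial MeasureTheory

set_option linter.unusedSectionVars false

/-! ### The residue field of `𝕃` -/

/-! Since `𝕃` is algebraically closed, a point of the affine Berkovich line is determined by its
distances to the elements of `𝕃` (`AffPoint.ext_rad`). Comparing distance functions turns the line
into a tree: joins exist, and the points above a given one form a chain. Intervals, directions and
components of complements become statements about this order. The directions at the Gauss point, and
at its image under `z ↦ c z + b`, are indexed by `ℙ¹(ℂ)`.

By the Iwasawa decomposition, `A⁻¹` is a matrix in `GL₂` of the valuation ring followed by some `z ↦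
c z + b`. Hence `f = c g + b`, where `g` fixes the Gauss point and its reduction differs from that
of `A ∘ f` by a complex Möbius transformation (`IsFrame`). Write `g = P / Q` with integral
coefficients. The behaviour of `f` at the Gauss point is encoded in the orders of vanishing, at
points `ζ` of `ℙ¹(ℂ)`, of the members of the pencil spanned by the reductions of `P` and `Q`. The
least order at `ζ` is the multiplicity of the hole; exactly one member, that of the value at `ζ`,
has a larger order, and the excess is the local degree of the reduction. The roots of an integral
polynomial specialize to the roots of its reduction, so these orders count preimages in directions
(`IsFrame.solCount_eq`), which gives directional and surplus degrees. They are also the rates at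
which seminorms change near the Gauss point, which gives the tangent map (`IsRep.dirMap_gauss`). The
local degree of `f` at the Gauss point is the degree of the reduction (`IsFrame.berkLocalDeg_eq`): a
small neighbourhood excludes, uniformly in the target, as many solutions near each hole as its
multiplicity.

If `f` moves the Gauss point, the partition consists of the two points, the directions at each that
do not face the other point, and the annulus between them. `IsIwasawa.hole_mem` identifies the
facing directions with `h_A` and `a_A`. The prescribed masses add up to one, and admissibility is
what makes the mass of the annulus nonnegative. Although the partition is uncountable and all its
subsets are measurable, these masses determine the measure, because they exhaust the total mass
(`IsAtomic.eq_of_univ`).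

The pullback identity is checked on single pieces. At a direction it is the identity of pullbacks
evaluated at one point of `ℙ¹(ℂ)`, the surplus being multiplied by the total mass one. At the Gauss
point it compares atomless parts (`phiDegree_mul_diffuseMass`). If `f` fixes the Gauss point, the
reduction of `A` is a Möbius transformation and carries the masses of `μ_E` over to those of `μ_C`
(`IsFrame.masses_of_fixed`). -/

theorem norm_sum_lt_of_forall_lt {K ι : Type*} [SeminormedAddCommGroup K] [IsUltrametricDist K]
    {g : ι → K} {r : ℝ} (s : Finset ι) (hr : 0 < r) (h : ∀ i ∈ s, ‖g i‖ < r) :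
    ‖∑ i ∈ s, g i‖ < r := by
  classical
  induction s using Finset.induction_on with
  | empty => simpa using hr
  | insert i s hi ih =>
    rw [Finset.sum_insert hi]
    exact (IsUltrametricDist.norm_add_le_max _ _).trans_lt
      (max_lt (h i (by simp)) (ih fun j hj => h j (by simp [hj])))

theorem norm_ofLaurent (a : CLaurent) : ‖ofLaurent a‖ = ‖a‖ := by
  rw [ofLaurent, norm_algebraMap']

theorem norm_C_laurent (c : ℂ) (hc : c ≠ 0) : ‖(HahnSeries.C c : CLaurent)‖ = 1 := by
  have key : ∀ c : ℂ, ‖(HahnSeries.C c : CLaurent)‖ ≤ 1 := fun c => by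
    rw [Valued.toNormedField.norm_le_one_iff, LaurentSeries.val_le_one_iff_eq_coe]
    exact ⟨PowerSeries.C c, by simp⟩
  have h1 := key c
  have h2 := key c⁻¹
  have h3 : ‖(HahnSeries.C c : CLaurent)‖ * ‖(HahnSeries.C c⁻¹ : CLaurent)‖ = 1 := by
    rw [← norm_mul, ← map_mul, mul_inv_cancel₀ hc, map_one, norm_one]
  nlinarith [norm_nonneg (HahnSeries.C c : CLaurent), norm_nonneg (HahnSeries.C c⁻¹ : CLaurent)]

theorem norm_constEmb {c : ℂ} (hc : c ≠ 0) : ‖constEmb c‖ = 1 := by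
  rw [constEmb, RingHom.comp_apply, norm_ofLaurent, norm_C_laurent c hc]

theorem norm_constEmb_le (c : ℂ) : ‖constEmb c‖ ≤ 1 := by
  by_cases hc : c = 0
  · simp [hc]
  · exact (norm_constEmb hc).le

theorem constEmb_eq_of_norm_sub_lt {c e : ℂ} (h : ‖constEmb c - constEmb e‖ < 1) : c = e := by
  by_contra hne
  rw [← map_sub, norm_constEmb (sub_ne_zero.2 hne)] at h
  exact lt_irrefl _ h

/-- Algebraic closedness passes from the dense subfield `PuiseuxAlg` to its completion. The
nontrivial norm and characteristic zero come from `ℂ((t))` and `ℂ`. All later root counts rest on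
this. -/
instance 𝕃.isAlgClosed : IsAlgClosed 𝕃 := by
  have hx : ∃ x : CLaurent, 1 < ‖x‖ := NontriviallyNormedField.non_trivial
  let _ : NontriviallyNormedField 𝕃 :=
    { (inferInstance : NormedField 𝕃) with
      non_trivial := by
        obtain ⟨x, hx⟩ := hx
        exact ⟨ofLaurent x, by rw [norm_ofLaurent]; exact hx⟩ }
  have _ : CharZero 𝕃 := charZero_of_injective_ringHom constEmb.injective
  exact IsAlgClosed.of_denseRange (K := PuiseuxAlg) UniformSpace.Completion.denseRange_coe

theorem exists_norm_sub_C_laurent_lt (a : CLaurent) (ha : ‖a‖ ≤ 1) :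
    ∃ c : ℂ, ‖a - HahnSeries.C c‖ < 1 := by
  rw [Valued.toNormedField.norm_le_one_iff, LaurentSeries.val_le_one_iff_eq_coe] at ha
  obtain ⟨F, rfl⟩ := ha
  refine ⟨F.coeff 0, ?_⟩
  rw [Valued.toNormedField.norm_lt_one_iff]
  have h : Valued.v ((F : CLaurent) - HahnSeries.C (F.coeff 0)) ≤ WithZero.exp (-(1 : ℤ)) := by
    rw [LaurentSeries.valuation_le_iff_coeff_lt_eq_zero]
    intro n hn
    rw [HahnSeries.coeff_sub]
    rcases lt_or_eq_of_le (Int.le_of_lt_add_one (b := 0) (by simpa using hn)) with h | h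
    · rw [PowerSeries.coeff_coe, if_pos h, HahnSeries.C_apply, HahnSeries.coeff_single_of_ne h.ne,
        sub_zero]
    · subst h
      rw [PowerSeries.coeff_coe]
      simp [HahnSeries.C_apply]
  refine lt_of_le_of_lt h ?_
  rw [← WithZero.exp_zero, WithZero.exp_lt_exp]
  simp

/-- By the definition of the spectral norm, the minimal polynomial of an integral element has
integral coefficients. Its residue `q` is monic, splits over `ℂ` and takes a value of norm less than
one at `a`, so some factor `a - r` has norm less than one. -/
theorem exists_norm_sub_constEmb_lt_of_alg (a : PuiseuxAlg) (ha : ‖a‖ ≤ 1) :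
    ∃ c : ℂ, ‖(a : 𝕃) - constEmb c‖ < 1 := by
  have hint : IsIntegral CLaurent a := Algebra.IsIntegral.isIntegral a
  have hcoeff : ∀ n, ‖(minpoly CLaurent a).coeff n‖ ≤ 1 :=
    (spectralValue_le_one_iff (minpoly.monic hint)).1 ha
  choose c hc using fun n => exists_norm_sub_C_laurent_lt _ (hcoeff n)
  set N := (minpoly CLaurent a).natDegree with hN
  -- the reduction of the minimal polynomial
  let q : ℂ[X] := X ^ N + ∑ n ∈ Finset.range N, monomial n (c n)
  have hqm : q.Monic := by
    refine monic_X_pow_add ?_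
    refine lt_of_le_of_lt (degree_sum_le _ _) ?_
    rw [Finset.sup_lt_iff (by simp)]
    intro n hn
    exact lt_of_le_of_lt (degree_monomial_le _ _) (by exact_mod_cast Finset.mem_range.1 hn)
  have haL : ‖(a : 𝕃)‖ ≤ 1 := by rw [UniformSpace.Completion.norm_coe]; exact ha
  have hmin : (a : 𝕃) ^ N + ∑ n ∈ Finset.range N, ofLaurent ((minpoly CLaurent a).coeff n) *
      (a : 𝕃) ^ n = 0 := by
    have h1 : aeval (a : 𝕃) (minpoly CLaurent a) = 0 := by
      have := Polynomial.aeval_algebraMap_apply 𝕃 a (minpoly CLaurent a)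
      rw [minpoly.aeval, map_zero] at this
      exact this
    rw [aeval_eq_sum_range, Finset.sum_range_succ, ← hN] at h1
    have hlead : (minpoly CLaurent a).coeff N = 1 := (minpoly.monic hint).coeff_natDegree
    rw [hlead, one_smul, add_comm] at h1
    simp only [Algebra.smul_def] at h1
    exact h1
  have hval : ‖(q.map constEmb).eval (a : 𝕃)‖ < 1 := by
    have h2 : (q.map constEmb).eval (a : 𝕃) = ∑ n ∈ Finset.range N,
        (constEmb (c n) - ofLaurent ((minpoly CLaurent a).coeff n)) * (a : 𝕃) ^ n := by
      have : (q.map constEmb).eval (a : 𝕃) =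
          (a : 𝕃) ^ N + ∑ n ∈ Finset.range N, constEmb (c n) * (a : 𝕃) ^ n := by
        simp [q, Polynomial.map_sum, eval_finsetSum]
      rw [this, ← sub_zero (_ + _), ← hmin]
      simp only [sub_mul, Finset.sum_sub_distrib]
      ring
    rw [h2]
    refine norm_sum_lt_of_forall_lt _ one_pos fun n _ => ?_
    rw [norm_mul, norm_pow, norm_sub_rev, constEmb, RingHom.comp_apply, ← map_sub, norm_ofLaurent]
    exact mul_lt_one_of_nonneg_of_lt_one_left (norm_nonneg _) (hc n)
      (pow_le_one₀ (norm_nonneg _) haL)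
  by_contra! hcon
  have hsplit : q = (q.roots.map fun r => X - C r).prod :=
    (IsAlgClosed.splits q).eq_prod_roots_of_monic hqm
  rw [hsplit, Polynomial.map_multiset_prod, eval_multiset_prod, Multiset.map_map,
    Multiset.map_map] at hval
  refine absurd hval (not_lt.2 ?_)
  generalize q.roots = m
  induction m using Multiset.induction_on with
  | empty => simp
  | cons r m ih =>
    rw [Multiset.map_cons, Multiset.prod_cons, norm_mul]
    refine one_le_mul_of_one_le_of_one_le ?_ ih
    simpa using hcon r

/-- The residue field of `𝕃` is `ℂ`. -/
theorem exists_norm_sub_constEmb_lt (a : 𝕃) (ha : ‖a‖ ≤ 1) :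
    ∃ c : ℂ, ‖a - constEmb c‖ < 1 := by
  obtain ⟨b, hb⟩ := (UniformSpace.Completion.denseRange_coe (α := PuiseuxAlg)).exists_dist_lt a
    one_pos
  rw [dist_eq_norm] at hb
  have hb1 : ‖(b : 𝕃)‖ ≤ 1 := by
    rw [show (b : 𝕃) = a + -(a - b) by ring]
    exact (IsUltrametricDist.norm_add_le_max _ _).trans (max_le ha (by rw [norm_neg]; exact hb.le))
  obtain ⟨c, hc⟩ := exists_norm_sub_constEmb_lt_of_alg b
    (by rwa [UniformSpace.Completion.norm_coe] at hb1)
  refine ⟨c, ?_⟩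
  rw [← sub_add_sub_cancel a (b : 𝕃)]
  exact (IsUltrametricDist.norm_add_le_max _ _).trans_lt (max_lt hb hc)

theorem norm_sub_redC_lt {a : 𝕃} (ha : ‖a‖ ≤ 1) : ‖a - constEmb (redC a)‖ < 1 :=
  Classical.epsilon_spec (exists_norm_sub_constEmb_lt a ha)

theorem redC_eq_of_norm_sub_lt {a : 𝕃} {c : ℂ} (h : ‖a - constEmb c‖ < 1) : redC a = c := by
  have ha : ‖a‖ ≤ 1 := by
    rw [← sub_add_cancel a (constEmb c)]
    exact (IsUltrametricDist.norm_add_le_max _ _).trans (max_le h.le (norm_constEmb_le c))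
  apply constEmb_eq_of_norm_sub_lt
  rw [← sub_add_sub_cancel _ a]
  refine (IsUltrametricDist.norm_add_le_max _ _).trans_lt (max_lt ?_ h)
  rw [norm_sub_rev]
  exact norm_sub_redC_lt ha

theorem redC_constEmb (c : ℂ) : redC (constEmb c) = c := redC_eq_of_norm_sub_lt (by simp)

/-- The valuation ring of `𝕃`. -/
def intRing : Subring 𝕃 where
  carrier := {a | ‖a‖ ≤ 1}
  mul_mem' := fun {a b} ha hb => by
    simpa using mul_le_one₀ ha (norm_nonneg b) hb
  one_mem' := by simp
  add_mem' := fun {a b} ha hb => (IsUltrametricDist.norm_add_le_max a b).trans (max_le ha hb)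
  zero_mem' := by simp
  neg_mem' := fun {a} ha => by simpa using ha

theorem mem_intRing {a : 𝕃} : a ∈ intRing ↔ ‖a‖ ≤ 1 := Iff.rfl

/-- The reduction homomorphism. -/
def redHom : intRing →+* ℂ where
  toFun a := redC a
  map_one' := redC_eq_of_norm_sub_lt (by simp)
  map_zero' := redC_eq_of_norm_sub_lt (by simp)
  map_mul' a b := by
    apply redC_eq_of_norm_sub_lt
    have h : ((a * b : intRing) : 𝕃) - constEmb (redC a * redC b) =
        a * (b - constEmb (redC b)) + (a - constEmb (redC a)) * constEmb (redC b) := by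
      push_cast [map_mul]
      ring
    rw [h]
    refine (IsUltrametricDist.norm_add_le_max _ _).trans_lt (max_lt ?_ ?_)
    · rw [norm_mul]
      exact mul_lt_one_of_nonneg_of_lt_one_right a.2 (norm_nonneg _) (norm_sub_redC_lt b.2)
    · rw [norm_mul]
      exact mul_lt_one_of_nonneg_of_lt_one_left (norm_nonneg _) (norm_sub_redC_lt a.2)
        (norm_constEmb_le _)
  map_add' a b := by
    apply redC_eq_of_norm_sub_lt
    have h : ((a + b : intRing) : 𝕃) - constEmb (redC a + redC b) =
        (a - constEmb (redC a)) + (b - constEmb (redC b)) := by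
      push_cast [map_add]
      ring
    rw [h]
    exact (IsUltrametricDist.norm_add_le_max _ _).trans_lt
      (max_lt (norm_sub_redC_lt a.2) (norm_sub_redC_lt b.2))

theorem redHom_apply (a : intRing) : redHom a = redC a := rfl

theorem redHom_eq_zero_iff (a : intRing) : redHom a = 0 ↔ ‖(a : 𝕃)‖ < 1 := by
  constructor
  · intro h
    have := norm_sub_redC_lt a.2
    rw [← redHom_apply, h] at this
    simpa using this
  · intro h
    exact redC_eq_of_norm_sub_lt (by simpa using h)

theorem redHom_ne_zero_iff (a : intRing) : redHom a ≠ 0 ↔ ‖(a : 𝕃)‖ = 1 := by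
  rw [Ne, redHom_eq_zero_iff, not_lt]
  exact ⟨fun h => le_antisymm a.2 h, fun h => h.ge⟩

/-- The constants are integral. -/
def liftC (c : ℂ) : intRing := ⟨constEmb c, norm_constEmb_le c⟩

theorem redHom_liftC (c : ℂ) : redHom (liftC c) = c := redC_constEmb c

theorem redPt_of_norm_le {a : 𝕃} (ha : ‖a‖ ≤ 1) :
    redPt (OnePoint.some a) = OnePoint.some (redC a) := if_pos ha

theorem redPt_of_one_lt {a : 𝕃} (ha : 1 < ‖a‖) : redPt (OnePoint.some a) = OnePoint.infty :=
  if_neg (not_le.2 ha)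

theorem redPt_infty : redPt OnePoint.infty = OnePoint.infty := rfl

theorem redPt_coe_int (a : intRing) : redPt (OnePoint.some (a : 𝕃)) = OnePoint.some (redHom a) :=
  redPt_of_norm_le a.2

theorem redPt_constEmb (c : ℂ) : redPt (OnePoint.some (constEmb c)) = OnePoint.some c := by
  rw [redPt_of_norm_le (norm_constEmb_le c), redC_constEmb]

theorem redPt_eq_some_iff {a : 𝕃} {c : ℂ} :
    redPt (OnePoint.some a) = OnePoint.some c ↔ ‖a - constEmb c‖ < 1 := by
  constructor
  · intro h
    rcases le_or_gt ‖a‖ 1 with ha | ha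
    · rw [redPt_of_norm_le ha] at h
      rw [← OnePoint.coe_injective h]
      exact norm_sub_redC_lt ha
    · rw [redPt_of_one_lt ha] at h
      exact absurd h (OnePoint.infty_ne_coe _)
  · intro h
    have ha : ‖a‖ ≤ 1 := by
      rw [← sub_add_cancel a (constEmb c)]
      exact (IsUltrametricDist.norm_add_le_max _ _).trans (max_le h.le (norm_constEmb_le c))
    rw [redPt_of_norm_le ha, redC_eq_of_norm_sub_lt h]

theorem redPt_eq_infty_iff {a : 𝕃} : redPt (OnePoint.some a) = OnePoint.infty ↔ 1 < ‖a‖ := by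
  refine ⟨fun h => ?_, redPt_of_one_lt⟩
  by_contra! ha
  rw [redPt_of_norm_le ha] at h
  exact OnePoint.coe_ne_infty _ h

/-! ### The tree structure of the Berkovich line -/

section Tree

variable {K : Type*} [NormedField K]

/-- The distance from `a` to a point of the affine line: the value of the seminorm at `z - a`. -/
def AffPoint.rad (x : AffPoint K) (a : K) : ℝ := x.sn (X - C a)

theorem AffPoint.rad_nonneg (x : AffPoint K) (a : K) : 0 ≤ x.rad a := apply_nonneg _ _

theorem AffPoint.ext_sn {x y : AffPoint K} (h : ∀ P, x.sn P = y.sn P) : x = y := by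
  cases x; cases y
  congr
  exact DFunLike.ext _ _ h

/-- The factor `n + 1` loses against exponential growth. This turns a bound from the binomial
theorem into an ultrametric inequality. -/
theorem le_of_forall_pow_le_succ_mul_pow {a M : ℝ} (hM : 0 ≤ M)
    (h : ∀ n : ℕ, a ^ n ≤ (n + 1) * M ^ n) : a ≤ M := by
  by_contra! hlt
  rcases hM.eq_or_lt with rfl | hM
  · have := h 1
    simp at this
    linarith
  have hq : 1 < a / M := (one_lt_div hM).2 hlt
  have ht := tendsto_pow_const_div_const_pow_of_one_lt 1 hq
  have ht0 := tendsto_pow_const_div_const_pow_of_one_lt 0 hq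
  have hs := ht.add ht0
  rw [add_zero] at hs
  obtain ⟨n, hn⟩ := (hs.eventually (gt_mem_nhds (zero_lt_one' ℝ))).exists
  have hp : 0 < (a / M) ^ n := by positivity
  rw [pow_one, pow_zero, ← add_div, div_lt_one hp, div_pow, lt_div_iff₀ (by positivity)] at hn
  exact absurd (h n) (not_le.2 hn)

variable [IsUltrametricDist K]

/-- A seminorm in `AffPoint` is only assumed subadditive. Binomial coefficients have norm at most
one, so the expansion of `(P + Q) ^ n` is bounded by `n + 1` times the `n`-th power of the maximum.
-/
theorem AffPoint.sn_add_le_max (x : AffPoint K) (P Q : K[X]) :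
    x.sn (P + Q) ≤ max (x.sn P) (x.sn Q) := by
  have hP : 0 ≤ x.sn P := apply_nonneg _ _
  have hQ : 0 ≤ x.sn Q := apply_nonneg _ _
  refine le_of_forall_pow_le_succ_mul_pow (le_max_of_le_left hP) fun n => ?_
  have hsum : ∀ (s : Finset ℕ) (g : ℕ → K[X]), x.sn (∑ i ∈ s, g i) ≤ ∑ i ∈ s, x.sn (g i) := by
    intro s g
    induction s using Finset.induction_on with
    | empty => simp
    | insert i s hi ih =>
      rw [Finset.sum_insert hi, Finset.sum_insert hi]
      exact (map_add_le_add _ _ _).trans (by gcongr)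
  rw [← map_pow, add_pow]
  refine (hsum _ _).trans ?_
  refine (Finset.sum_le_card_nsmul (Finset.range (n + 1)) _
    ((max (x.sn P) (x.sn Q)) ^ n) fun i hi => ?_).trans (by simp)
  rw [map_mul, map_mul, map_pow, map_pow]
  have h1 : x.sn ((n.choose i : ℕ) : K[X]) ≤ 1 := by
    rw [← Polynomial.C_eq_natCast, x.map_C]
    exact IsUltrametricDist.norm_natCast_le_one K _
  have hi' : i ≤ n := Nat.lt_succ_iff.1 (Finset.mem_range.1 hi)
  calc x.sn P ^ i * x.sn Q ^ (n - i) * x.sn ((n.choose i : ℕ) : K[X])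
      ≤ (max (x.sn P) (x.sn Q)) ^ i * (max (x.sn P) (x.sn Q)) ^ (n - i) * 1 := by
        gcongr
        · exact le_max_left _ _
        · exact le_max_right _ _
    _ = _ := by rw [mul_one, ← pow_add, Nat.add_sub_cancel' hi']

theorem AffPoint.rad_le_max (x : AffPoint K) (a b : K) : x.rad a ≤ max (x.rad b) ‖a - b‖ := by
  have h := x.sn_add_le_max (X - C b) (C (b - a))
  rw [x.map_C, norm_sub_rev] at h
  have e : (X - C b + C (b - a) : K[X]) = X - C a := by simp
  rwa [e] at h

theorem AffPoint.norm_sub_le_max (x : AffPoint K) (a b : K) :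
    ‖a - b‖ ≤ max (x.rad a) (x.rad b) := by
  have h := x.sn_add_le_max (X - C b) (-(X - C a))
  rw [map_neg_eq_map] at h
  have e : (X - C b + -(X - C a) : K[X]) = C (a - b) := by simp
  rw [e, x.map_C, max_comm] at h
  exact h

theorem gaussNorm_X_add_C {r : ℝ} (hr : 0 ≤ r) (a : K) :
    (X + C a : K[X]).gaussNorm (NormedField.toAbsoluteValue K) r = max r ‖a‖ := by
  apply le_antisymm
  · obtain ⟨i, hi⟩ := (X + C a : K[X]).exists_eq_gaussNorm (NormedField.toAbsoluteValue K) r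
    rw [hi]
    match i with
    | 0 =>
      refine le_max_of_le_right ?_
      simp [NormedField.toAbsoluteValue]
    | 1 =>
      refine le_max_of_le_left ?_
      simp [NormedField.toAbsoluteValue]
    | i + 2 => simp [coeff_X, hr]
  · refine max_le ?_ ?_
    · have := (X + C a : K[X]).le_gaussNorm (NormedField.toAbsoluteValue K) hr 1
      simpa [NormedField.toAbsoluteValue, coeff_C] using this
    · have := (X + C a : K[X]).le_gaussNorm (NormedField.toAbsoluteValue K) hr 0
      simpa [NormedField.toAbsoluteValue, coeff_C] using this

/-- The point that corresponds to the closed disk of center `a` and radius `r > 0`. -/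
def AffPoint.disk (a : K) (r : ℝ) (hr : 0 < r) : AffPoint K where
  sn :=
    { toFun := fun P => (taylor a P).gaussNorm (NormedField.toAbsoluteValue K) r
      map_zero' := by simp
      add_le' := fun P Q => by
        rw [map_add]
        have h := Polynomial.isNonarchimedean_gaussNorm (NormedField.toAbsoluteValue K)
          IsUltrametricDist.norm_add_le_max hr.le (taylor a P) (taylor a Q)
        exact h.trans (max_le_add_of_nonneg
          ((taylor a P).gaussNorm_nonneg (NormedField.toAbsoluteValue K) hr.le)
          ((taylor a Q).gaussNorm_nonneg (NormedField.toAbsoluteValue K) hr.le))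
      neg' := fun P => by
        have h := Polynomial.gaussNorm_mul (v := NormedField.toAbsoluteValue K)
          (fun a b => IsUltrametricDist.norm_add_le_max a b) hr (C (-1)) (taylor a P)
        rw [Polynomial.gaussNorm_C] at h
        simpa using h
      map_one' := by
        rw [taylor_one, Polynomial.gaussNorm_C, map_one]
      map_mul' := fun P Q => by
        rw [taylor_mul]
        exact Polynomial.gaussNorm_mul (v := NormedField.toAbsoluteValue K)
          (fun a b => IsUltrametricDist.norm_add_le_max a b) hr _ _ }
  map_C := fun b => by
    change (taylor a (C b)).gaussNorm (NormedField.toAbsoluteValue K) r = ‖b‖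
    rw [taylor_C, Polynomial.gaussNorm_C]; rfl

theorem AffPoint.disk_rad (a : K) (r : ℝ) (hr : 0 < r) (b : K) :
    (AffPoint.disk a r hr).rad b = max r ‖b - a‖ := by
  change (taylor a (X - C b)).gaussNorm (NormedField.toAbsoluteValue K) r = _
  have e : taylor a (X - C b) = X + C (a - b) := by
    rw [map_sub, taylor_X, taylor_C, C_sub]
    ring
  rw [e, gaussNorm_X_add_C hr.le, norm_sub_rev]

theorem AffPoint.gauss_rad (b : K) : (AffPoint.gauss : AffPoint K).rad b = max 1 ‖b‖ := by
  change (X - C b).gaussNorm (NormedField.toAbsoluteValue K) 1 = _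
  rw [sub_eq_add_neg, ← C_neg, gaussNorm_X_add_C zero_le_one, norm_neg]

theorem AffPoint.classical_rad (a b : K) : (AffPoint.classical a).rad b = ‖a - b‖ := by
  change ‖(X - C b).eval a‖ = _
  simp

variable [IsAlgClosed K]

/-- Every polynomial splits, so a point is nothing but its distance function `rad`; equality and
order of points need only be tested on linear factors. -/
theorem AffPoint.sn_eq_prod (x : AffPoint K) (P : K[X]) :
    x.sn P = ‖P.leadingCoeff‖ * (P.roots.map x.rad).prod := by
  conv_lhs => rw [(IsAlgClosed.splits P).eq_prod_roots]
  rw [map_mul, x.map_C, map_multiset_prod, Multiset.map_map]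
  rfl

theorem AffPoint.ext_rad {x y : AffPoint K} (h : ∀ a, x.rad a = y.rad a) : x = y :=
  AffPoint.ext_sn fun P => by rw [x.sn_eq_prod, y.sn_eq_prod, funext h]

theorem AffPoint.sn_le_iff {x y : AffPoint K} :
    (∀ P, x.sn P ≤ y.sn P) ↔ ∀ a, x.rad a ≤ y.rad a := by
  refine ⟨fun h a => h _, fun h P => ?_⟩
  rw [x.sn_eq_prod, y.sn_eq_prod]
  refine mul_le_mul_of_nonneg_left ?_ (norm_nonneg _)
  refine Multiset.prod_map_le_prod_map₀ _ _ (fun a _ => x.rad_nonneg a) fun a _ => h a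

theorem AffPoint.gauss_eq_disk : (AffPoint.gauss : AffPoint K) = AffPoint.disk 0 1 one_pos :=
  AffPoint.ext_rad fun a => by rw [gauss_rad, disk_rad, sub_zero]

/-- If `y` is not below `x`, the maximum of the two distance functions is that of a disk. -/
theorem AffPoint.max_rad_of_lt {x y : AffPoint K} {a : K} (h : x.rad a < y.rad a) (b : K) :
    max (x.rad b) (y.rad b) = max (y.rad a) ‖b - a‖ := by
  apply le_antisymm
  · refine max_le ((x.rad_le_max b a).trans (max_le_max h.le le_rfl)) (y.rad_le_max b a)
  · have h1 := x.norm_sub_le_max b a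
    have h2 := y.rad_le_max a b
    rw [norm_sub_rev] at h2
    rcases le_max_iff.1 h1 with h1 | h1
    · exact max_le (h2.trans (max_le (le_max_right _ _) (le_max_of_le_left h1)))
        (le_max_of_le_left h1)
    · have h3 : y.rad a ≤ y.rad b := by
        rcases le_max_iff.1 h2 with h2 | h2
        · exact h2
        · linarith
      exact max_le (le_max_of_le_right h3) (le_max_of_le_right (by linarith))

/-- The join is `x` if `y` lies below it. Otherwise some centre `a` separates the two, and the join
is the disk around `a` of radius `y.rad a`. -/
theorem AffPoint.exists_rad_eq_max (x y : AffPoint K) :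
    ∃ z : AffPoint K, ∀ a, z.rad a = max (x.rad a) (y.rad a) := by
  by_cases h : ∀ a, y.rad a ≤ x.rad a
  · exact ⟨x, fun a => (max_eq_left (h a)).symm⟩
  · push Not at h
    obtain ⟨a, ha⟩ := h
    refine ⟨AffPoint.disk a (y.rad a) ((x.rad_nonneg a).trans_lt ha), fun b => ?_⟩
    rw [disk_rad, AffPoint.max_rad_of_lt ha]

/-- The point above `x` at height `r`. -/
theorem AffPoint.exists_rad_eq_max_const (x : AffPoint K) (r : ℝ) :
    ∃ z : AffPoint K, ∀ a, z.rad a = max (x.rad a) r := by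
  by_cases h : ∀ a, r ≤ x.rad a
  · exact ⟨x, fun a => (max_eq_left (h a)).symm⟩
  · push Not at h
    obtain ⟨a, ha⟩ := h
    refine ⟨AffPoint.disk a r ((x.rad_nonneg a).trans_lt ha), fun b => ?_⟩
    rw [disk_rad]
    have h1 := x.norm_sub_le_max b a
    have h2 := x.rad_le_max b a
    grind

/-- A point above `x` is determined by its height. -/
theorem AffPoint.rad_eq_max_of_lt {x y : AffPoint K} (h : ∀ a, x.rad a ≤ y.rad a) {b : K}
    (hb : x.rad b < y.rad b) (a : K) : y.rad a = max (x.rad a) (y.rad b) := by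
  have h1 := y.rad_le_max a b
  have h2 := y.rad_le_max b a
  have h3 := x.norm_sub_le_max a b
  have h4 := h a
  rw [norm_sub_rev] at h2
  grind

theorem Berk.le_antisymm' {S T : Berk K} (h1 : S.Le T) (h2 : T.Le S) : S = T := by
  match S, T with
  | .infty, .infty => rfl
  | .infty, .aff _ => exact h1.elim
  | .aff _, .infty => exact h2.elim
  | .aff x, .aff y => rw [AffPoint.ext_sn fun P => _root_.le_antisymm (h1 P) (h2 P)]

instance Berk.partialOrder : PartialOrder (Berk K) where
  le := Berk.Le
  le_refl S := by
    match S with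
    | .infty => trivial
    | .aff _ => exact fun _ => le_rfl
  le_trans S T R h1 h2 := by
    match S, T, R with
    | _, _, .infty => trivial
    | _, .infty, .aff _ => exact h2.elim
    | .infty, .aff _, .aff _ => exact h1.elim
    | .aff x, .aff y, .aff z => exact fun P => (h1 P).trans (h2 P)
  le_antisymm _ _ := Berk.le_antisymm'

theorem Berk.le_infty (S : Berk K) : S ≤ Berk.infty := by
  cases S <;> trivial

theorem Berk.not_infty_le (x : AffPoint K) : ¬ (Berk.infty : Berk K) ≤ Berk.aff x := fun h => h

theorem Berk.aff_le_aff {x y : AffPoint K} :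
    Berk.aff x ≤ Berk.aff y ↔ ∀ a, x.rad a ≤ y.rad a := AffPoint.sn_le_iff

/-- The least upper bound of two points. -/
def Berk.join : Berk K → Berk K → Berk K
  | .infty, _ => .infty
  | .aff _, .infty => .infty
  | .aff x, .aff y => .aff (x.exists_rad_eq_max y).choose

instance Berk.semilatticeSup : SemilatticeSup (Berk K) where
  sup := Berk.join
  le_sup_left S T := by
    match S, T with
    | .infty, _ => exact Berk.le_infty _
    | .aff _, .infty => exact Berk.le_infty _
    | .aff x, .aff y =>
      refine Berk.aff_le_aff.2 fun a => ?_
      rw [(x.exists_rad_eq_max y).choose_spec]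
      exact le_max_left _ _
  le_sup_right S T := by
    match S, T with
    | .infty, _ => exact Berk.le_infty _
    | .aff _, .infty => exact Berk.le_infty _
    | .aff x, .aff y =>
      refine Berk.aff_le_aff.2 fun a => ?_
      rw [(x.exists_rad_eq_max y).choose_spec]
      exact le_max_right _ _
  sup_le S T R h1 h2 := by
    match S, T, R with
    | _, _, .infty => exact Berk.le_infty _
    | .infty, _, .aff _ => exact h1.elim
    | .aff _, .infty, .aff _ => exact h2.elim
    | .aff x, .aff y, .aff z =>
      refine Berk.aff_le_aff.2 fun a => ?_
      rw [(x.exists_rad_eq_max y).choose_spec]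
      exact max_le (Berk.aff_le_aff.1 h1 a) (Berk.aff_le_aff.1 h2 a)

theorem Berk.exists_aff_sup (x y : AffPoint K) : ∃ z : AffPoint K,
    Berk.aff x ⊔ Berk.aff y = Berk.aff z ∧ ∀ a, z.rad a = max (x.rad a) (y.rad a) :=
  ⟨_, rfl, (x.exists_rad_eq_max y).choose_spec⟩

/-- A point above `x` and different from it has the distance function `max (x.rad a) r`, where `r`
is its height. Heights therefore order the points above `x` linearly; this chain property makes the
order a tree. -/
theorem Berk.le_total_of_le {S T R : Berk K} (h1 : S ≤ T) (h2 : S ≤ R) : T ≤ R ∨ R ≤ T := by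
  match S, T, R with
  | _, _, .infty => exact Or.inl (Berk.le_infty _)
  | _, .infty, _ => exact Or.inr (Berk.le_infty _)
  | .infty, .aff _, .aff _ => exact h1.elim
  | .aff x, .aff y, .aff z =>
    rw [Berk.aff_le_aff] at h1 h2
    by_cases hy : ∀ a, y.rad a ≤ x.rad a
    · exact Or.inl (Berk.aff_le_aff.2 fun a => (hy a).trans (h2 a))
    by_cases hz : ∀ a, z.rad a ≤ x.rad a
    · exact Or.inr (Berk.aff_le_aff.2 fun a => (hz a).trans (h1 a))
    push Not at hy hz
    obtain ⟨b, hb⟩ := hy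
    obtain ⟨c, hc⟩ := hz
    have ey := AffPoint.rad_eq_max_of_lt h1 hb
    have ez := AffPoint.rad_eq_max_of_lt h2 hc
    rcases le_total (y.rad b) (z.rad c) with h | h
    · exact Or.inl (Berk.aff_le_aff.2 fun a => by rw [ey a, ez a]; exact max_le_max le_rfl h)
    · exact Or.inr (Berk.aff_le_aff.2 fun a => by rw [ey a, ez a]; exact max_le_max le_rfl h)

/-! ### Intervals and directions in terms of the order -/

theorem mem_interval_iff {S S' R : Berk K} :
    R ∈ interval S S' ↔ (S ≤ R ∨ S' ≤ R) ∧ R ≤ S ⊔ S' :=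
  and_congr_right fun _ => ⟨fun h => h _ (le_sup_left (a := S)) (le_sup_right (a := S)),
    fun h _ h1 h2 => h.trans (sup_le h1 h2)⟩

/-- There is a single upward direction at `S`. For two points not below `S`, the joins with `S` are
comparable and strictly above `S`, and the lower one lies on both intervals. -/
theorem dir_of_not_le {S T : Berk K} (h : ¬ T ≤ S) : dir S T = {R | ¬ R ≤ S} := by
  have hT : S < S ⊔ T := lt_of_le_of_ne le_sup_left fun e => h (by rw [e]; exact le_sup_right)
  ext R
  constructor
  · rintro ⟨hne, Q, hQ, h1, h2⟩ hR
    rw [mem_interval_iff] at h1 h2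
    rw [sup_eq_left.2 hR] at h2
    rcases h1.1 with h3 | h3
    · exact hQ (le_antisymm h2.2 h3)
    · exact h (h3.trans h2.2)
  · intro hR
    have hR' : S < S ⊔ R := lt_of_le_of_ne le_sup_left fun e => hR (by rw [e]; exact le_sup_right)
    refine ⟨fun e => hR e.le, ?_⟩
    rcases Berk.le_total_of_le (le_sup_left (a := S) (b := T)) (le_sup_left (a := S) (b := R)) with
      h1 | h1
    · exact ⟨S ⊔ T, hT.ne', mem_interval_iff.2 ⟨Or.inl le_sup_left, le_rfl⟩,
        mem_interval_iff.2 ⟨Or.inl le_sup_left, h1⟩⟩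
    · exact ⟨S ⊔ R, hR'.ne', mem_interval_iff.2 ⟨Or.inl le_sup_left, h1⟩,
        mem_interval_iff.2 ⟨Or.inl le_sup_left, le_rfl⟩⟩

theorem dir_of_lt {S T : Berk K} (h : T < S) : dir S T = {R | R ⊔ T < S} := by
  ext R
  constructor
  · rintro ⟨hne, Q, hQ, h1, h2⟩
    rw [mem_interval_iff, sup_eq_left.2 h.le] at h1
    rw [mem_interval_iff] at h2
    have h3 : T ≤ Q := h1.1.resolve_left fun h3 => hQ (le_antisymm h1.2 h3)
    have h4 : R ≤ Q := h2.1.resolve_left fun h3 => hQ (le_antisymm h1.2 h3)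
    exact (sup_le h4 h3).trans_lt (lt_of_le_of_ne h1.2 hQ)
  · intro hR
    have hRS : R < S := le_sup_left.trans_lt hR
    exact ⟨hRS.ne, R ⊔ T, hR.ne,
      mem_interval_iff.2 ⟨Or.inr le_sup_right, by rw [sup_eq_left.2 h.le]; exact hR.le⟩,
      mem_interval_iff.2 ⟨Or.inr le_sup_left, by rw [sup_eq_left.2 hRS.le]; exact hR.le⟩⟩

theorem notMem_dir_self (S T : Berk K) : S ∉ dir S T := fun h => h.1 rfl

theorem mem_dir_of_ne {S T : Berk K} (h : T ≠ S) : T ∈ dir S T := by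
  by_cases hT : T ≤ S
  · have := lt_of_le_of_ne hT h
    rw [dir_of_lt this]
    simpa using this
  · rw [dir_of_not_le hT]
    exact hT

/-- Directions at `S` are the classes of an equivalence relation. Below `S`, transitivity holds
because two joins with the same point are comparable. -/
theorem dir_eq_of_mem {S T R : Berk K} (hT : T ≠ S) (h : R ∈ dir S T) : dir S R = dir S T := by
  by_cases hT' : T ≤ S
  · have hlt := lt_of_le_of_ne hT' hT
    rw [dir_of_lt hlt] at h ⊢
    have hR : R < S := le_sup_left.trans_lt h
    rw [dir_of_lt hR]
    have key : ∀ {A B : Berk K}, B ⊔ A < S → ∀ Q, Q ⊔ A < S → Q ⊔ B < S := by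
      intro A B h Q hQ
      rcases Berk.le_total_of_le (le_sup_right (a := B) (b := A))
        (le_sup_right (a := Q) (b := A)) with h1 | h1
      · exact (sup_le le_sup_left (le_sup_left.trans h1)).trans_lt hQ
      · exact (sup_le (le_sup_left.trans h1) le_sup_left).trans_lt h
    ext Q
    exact ⟨fun hQ => key (by rw [sup_comm]; exact h) Q hQ, fun hQ => key h Q hQ⟩
  · rw [dir_of_not_le hT'] at h ⊢
    rw [dir_of_not_le h]

theorem mem_dir_of_mem_interval {S T R : Berk K} (hR : R ≠ S) (h : R ∈ interval S T) :
    R ∈ dir S T :=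
  ⟨hR, R, hR, h, mem_interval_iff.2 ⟨Or.inr le_rfl, le_sup_right⟩⟩

theorem interval_comm (S T : Berk K) : interval S T = interval T S := by
  ext R
  rw [mem_interval_iff, mem_interval_iff, or_comm, sup_comm]

theorem mem_dir_of_notMem_interval {S T R : Berk K} (hR : R ≠ S)
    (h : S ∉ interval T R) : T ∈ dir S R := by
  rw [mem_interval_iff] at h
  by_cases hRS : R ≤ S
  · rw [dir_of_lt (lt_of_le_of_ne hRS hR)]
    have h1 : ¬ S ≤ T ⊔ R := fun h1 => h ⟨Or.inr hRS, h1⟩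
    rcases Berk.le_total_of_le hRS (le_sup_right (a := T) (b := R)) with h2 | h2
    · exact absurd h2 h1
    · exact lt_of_le_not_ge h2 h1
  · rw [dir_of_not_le hRS]
    intro hTS
    rcases Berk.le_total_of_le hTS (le_sup_left (a := T) (b := R)) with h2 | h2
    · exact h ⟨Or.inl hTS, h2⟩
    · exact hRS (le_sup_right.trans h2)

/-- A direction at `S` that does not contain `R` is contained in the direction of `S` at `R`. -/
theorem dir_subset_dir {S T R : Berk K} (hT : T ≠ S) (hRS : R ≠ S) (hR : R ∉ dir S T) :
    dir S T ⊆ dir R S := by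
  intro Q hQ
  refine mem_dir_of_notMem_interval hRS.symm fun h => hR ?_
  rw [← dir_eq_of_mem hT hQ]
  rw [interval_comm] at h
  exact mem_dir_of_mem_interval hRS h

end Tree

/-! ### Connectedness -/

section Connected

variable {K : Type*} [NormedField K] [IsUltrametricDist K] [IsAlgClosed K]

/-- The path from `x` to `∞`, parametrized by the height. -/
def AffPoint.path (x : AffPoint K) (r : ℝ≥0∞) : Berk K := open Classical in
  if r = ⊤ then .infty else .aff (x.exists_rad_eq_max_const r.toReal).choose

theorem AffPoint.path_top (x : AffPoint K) : x.path ⊤ = .infty := if_pos rfl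

theorem AffPoint.exists_path_eq (x : AffPoint K) {r : ℝ≥0∞} (hr : r ≠ ⊤) :
    ∃ z : AffPoint K, x.path r = .aff z ∧ ∀ a, z.rad a = max (x.rad a) r.toReal :=
  ⟨_, if_neg hr, (x.exists_rad_eq_max_const r.toReal).choose_spec⟩

theorem AffPoint.path_le_aff_iff (x t : AffPoint K) (r : ℝ≥0∞) :
    x.path r ≤ .aff t ↔ (∀ a, x.rad a ≤ t.rad a) ∧ ∀ a, r ≤ ENNReal.ofReal (t.rad a) := by
  by_cases hr : r = ⊤
  · subst hr
    rw [x.path_top]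
    exact ⟨fun h => (Berk.not_infty_le _ h).elim, fun h => absurd (h.2 0) (by simp)⟩
  · obtain ⟨z, hz, hz'⟩ := x.exists_path_eq hr
    rw [hz, Berk.aff_le_aff, ← forall_and]
    refine forall_congr' fun a => ?_
    rw [hz', max_le_iff, ENNReal.le_ofReal_iff_toReal_le hr (t.rad_nonneg a)]

theorem AffPoint.le_path (x : AffPoint K) (r : ℝ≥0∞) : .aff x ≤ x.path r := by
  by_cases hr : r = ⊤
  · subst hr
    rw [x.path_top]
    exact Berk.le_infty _
  · obtain ⟨z, hz, hz'⟩ := x.exists_path_eq hr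
    rw [hz, Berk.aff_le_aff]
    exact fun a => by rw [hz']; exact le_max_left _ _

theorem AffPoint.path_mono (x : AffPoint K) : Monotone x.path := by
  intro r s hrs
  by_cases hs : s = ⊤
  · subst hs
    rw [x.path_top]
    exact Berk.le_infty _
  have hr : r ≠ ⊤ := ne_top_of_le_ne_top hs hrs
  obtain ⟨z, hz, hz'⟩ := x.exists_path_eq hr
  obtain ⟨w, hw, hw'⟩ := x.exists_path_eq hs
  rw [hz, hw, Berk.aff_le_aff]
  intro a
  rw [hz', hw']
  exact max_le_max le_rfl (ENNReal.toReal_mono hs hrs)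

theorem AffPoint.path_zero (x : AffPoint K) : x.path 0 = .aff x := by
  obtain ⟨z, hz, hz'⟩ := x.exists_path_eq ENNReal.zero_ne_top
  rw [hz, AffPoint.ext_rad (x := z) (y := x)]
  intro a
  rw [hz', ENNReal.toReal_zero, max_eq_left (x.rad_nonneg a)]

theorem AffPoint.exists_eq_path {x : AffPoint K} {T : Berk K} (h : .aff x ≤ T) :
    ∃ r, x.path r = T := by
  match T with
  | .infty => exact ⟨⊤, x.path_top⟩
  | .aff t =>
    rw [Berk.aff_le_aff] at h
    by_cases ht : ∀ a, t.rad a ≤ x.rad a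
    · exact ⟨0, by rw [x.path_zero, AffPoint.ext_rad fun a => le_antisymm (h a) (ht a)]⟩
    · push Not at ht
      obtain ⟨b, hb⟩ := ht
      refine ⟨ENNReal.ofReal (t.rad b), ?_⟩
      obtain ⟨z, hz, hz'⟩ := x.exists_path_eq (r := ENNReal.ofReal (t.rad b)) (by simp)
      rw [hz, AffPoint.ext_rad (x := z) (y := t)]
      intro a
      rw [hz', ENNReal.toReal_ofReal (t.rad_nonneg b), AffPoint.rad_eq_max_of_lt h hb a]

theorem AffPoint.isClosed_path_le (x : AffPoint K) (T : Berk K) : IsClosed {r | x.path r ≤ T} := by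
  match T with
  | .infty =>
    rw [Set.eq_univ_of_forall (s := {r | x.path r ≤ .infty}) fun r => Berk.le_infty (x.path r)]
    exact isClosed_univ
  | .aff t =>
    simp only [x.path_le_aff_iff]
    by_cases h : ∀ a, x.rad a ≤ t.rad a
    · simp only [h, implies_true, true_and, Set.ofPred_forall]
      exact isClosed_iInter fun a => isClosed_Iic
    · simp [h]

/-- The path stays at `x` for all heights below the radius of `x` and is strictly increasing only
from there on. If `T` is not strictly above `x`, the set is empty and is treated separately. -/
theorem AffPoint.isOpen_path_lt (x : AffPoint K) (T : Berk K) : IsOpen {r | x.path r < T} := by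
  by_cases hT : .aff x < T
  swap
  · convert isOpen_empty
    ext r
    simp only [Set.mem_ofPred_eq, Set.mem_empty_iff_false, iff_false]
    exact fun h => hT ((x.le_path r).trans_lt h)
  obtain ⟨t, rfl⟩ := AffPoint.exists_eq_path hT.le
  suffices {r | x.path r < x.path t} = Set.Iio t by rw [this]; exact isOpen_Iio
  ext r
  simp only [Set.mem_ofPred_eq, Set.mem_Iio]
  constructor
  · intro h
    by_contra! hle
    exact absurd (x.path_mono hle) (not_le_of_gt h)
  · intro h
    refine lt_of_le_not_ge (x.path_mono h.le) fun hle => ?_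
    have hr : r ≠ ⊤ := ne_top_of_lt h
    obtain ⟨z, hz, hz'⟩ := x.exists_path_eq hr
    rw [hz, x.path_le_aff_iff] at hle
    -- at a point where the two paths have separated, the heights agree
    by_cases hx : ∃ a, x.rad a < t.toReal ∨ t = ⊤
    · obtain ⟨a, ha⟩ := hx
      rcases ha with ha | rfl
      · have := hle.2 a
        rw [hz'] at this
        have ht : t ≠ ⊤ := ne_top_of_le_ne_top ENNReal.ofReal_ne_top this
        rw [ENNReal.le_ofReal_iff_toReal_le ht
          (le_max_of_le_left (x.rad_nonneg a)), le_max_iff] at this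
        rcases this with h1 | h1
        · linarith
        · exact absurd ((ENNReal.toReal_lt_toReal hr ht).2 h) (not_lt.2 h1)
      · exact absurd (hle.2 0) (by simp)
    · push Not at hx
      have ht : t ≠ ⊤ := (hx 0).2
      obtain ⟨w, hw, hw'⟩ := x.exists_path_eq ht
      rw [hw, AffPoint.ext_rad (x := w) (y := x)] at hT
      · exact lt_irrefl _ hT
      · intro a
        rw [hw', max_eq_left (hx a).1]

theorem isOpen_dir {S T : Berk K} (h : T ≠ S) : IsOpen (dir S T) :=
  TopologicalSpace.isOpen_generateFrom_of_mem ⟨S, T, h, rfl⟩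

/-- Continuity is tested on the generating directions. An upward direction pulls back to the
complement of a closed set, a downward one to the empty set or to the heights at which the path is
below `S`. -/
theorem AffPoint.continuous_path (x : AffPoint K) : Continuous x.path := by
  refine continuous_generateFrom_iff.2 ?_
  rintro U ⟨S, T, hne, rfl⟩
  by_cases hT : T ≤ S
  · rw [dir_of_lt (lt_of_le_of_ne hT hne)]
    by_cases hx : .aff x ⊔ T < S
    · convert x.isOpen_path_lt S using 1
      ext r
      change x.path r ⊔ T < S ↔ x.path r < S
      refine ⟨fun h => le_sup_left.trans_lt h, fun h => ?_⟩
      rcases Berk.le_total_of_le (x.le_path r) (le_sup_left (a := .aff x) (b := T)) with h1 | h1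
      · exact (sup_le h1 le_sup_right).trans_lt hx
      · exact (sup_le le_rfl (le_sup_right.trans h1)).trans_lt h
    · convert isOpen_empty
      ext r
      simp only [Set.mem_preimage, Set.mem_ofPred_eq, Set.mem_empty_iff_false, iff_false]
      exact fun h => hx ((sup_le_sup_right (x.le_path r) T).trans_lt h)
  · rw [dir_of_not_le hT]
    exact (x.isClosed_path_le S).isOpen_compl

theorem isPreconnected_Icc_berk (S T : Berk K) : IsPreconnected (Set.Icc S T) := by
  by_cases h : S ≤ T
  swap
  · rw [Set.Icc_eq_empty h]
    exact isPreconnected_empty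
  match S with
  | .infty =>
    have : Set.Icc .infty T = {(.infty : Berk K)} := by
      ext R
      exact ⟨fun hR => le_antisymm (Berk.le_infty _) hR.1, fun hR => by
        rw [Set.mem_singleton_iff.1 hR]; exact ⟨le_rfl, h⟩⟩
    rw [this]
    exact isPreconnected_singleton
  | .aff x =>
    obtain ⟨t, rfl⟩ := AffPoint.exists_eq_path h
    have : Set.Icc (.aff x) (x.path t) = x.path '' Set.Icc 0 t := by
      ext R
      constructor
      · rintro ⟨h1, h2⟩
        obtain ⟨r, rfl⟩ := AffPoint.exists_eq_path h1
        rcases le_total r t with hr | hr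
        · exact ⟨r, ⟨zero_le, hr⟩, rfl⟩
        · exact ⟨t, ⟨zero_le, le_rfl⟩, le_antisymm (x.path_mono hr) h2⟩
      · rintro ⟨r, hr, rfl⟩
        exact ⟨x.le_path r, x.path_mono hr.2⟩
    rw [this]
    exact isPreconnected_Icc.image _ x.continuous_path.continuousOn

/-- A set that contains the intervals between its points. -/
def IsTreeConvex (W : Set (Berk K)) : Prop :=
  ∀ u ∈ W, ∀ v ∈ W, Set.Icc u (u ⊔ v) ⊆ W

theorem IsTreeConvex.inter {W V : Set (Berk K)} (hW : IsTreeConvex W) (hV : IsTreeConvex V) :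
    IsTreeConvex (W ∩ V) := fun u hu v hv _ hR =>
  ⟨hW u hu.1 v hv.1 hR, hV u hu.2 v hv.2 hR⟩

/-- Two points are connected by the two chains that lead up to their join. -/
theorem IsTreeConvex.isPreconnected {W : Set (Berk K)} (hW : IsTreeConvex W) :
    IsPreconnected W := by
  refine isPreconnected_of_forall_pair fun u hu v hv => ?_
  refine ⟨Set.Icc u (u ⊔ v) ∪ Set.Icc v (u ⊔ v), Set.union_subset (hW u hu v hv) ?_,
    Or.inl ⟨le_rfl, le_sup_left⟩, Or.inr ⟨le_rfl, le_sup_right⟩, ?_⟩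
  · rw [sup_comm]
    exact hW v hv u hu
  · exact (isPreconnected_Icc_berk _ _).union (u ⊔ v) ⟨le_sup_left, le_rfl⟩ ⟨le_sup_right, le_rfl⟩
      (isPreconnected_Icc_berk _ _)

theorem isTreeConvex_dir {S T : Berk K} (h : T ≠ S) : IsTreeConvex (dir S T) := by
  intro u hu v hv R hR
  by_cases hT : T ≤ S
  · rw [dir_of_lt (lt_of_le_of_ne hT h)] at *
    have key : u ⊔ v ⊔ T < S := by
      rcases Berk.le_total_of_le (le_sup_right (a := u) (b := T))
        (le_sup_right (a := v) (b := T)) with h1 | h1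
      · exact (sup_le (sup_le (le_sup_left.trans h1) le_sup_left) le_sup_right).trans_lt hv
      · exact (sup_le (sup_le le_sup_left (le_sup_left.trans h1)) le_sup_right).trans_lt hu
    exact (sup_le_sup_right hR.2 T).trans_lt key
  · rw [dir_of_not_le hT] at *
    exact fun h1 => hu (hR.1.trans h1)

/-- The components of the complement of two points. -/
theorem pieceSet_pair {G S x : Berk K} (hG : x ≠ G) (hS : x ≠ S) :
    pieceSet {G, S} x = dir G x ∩ dir S x := by
  have hx : x ∉ ({G, S} : Set (Berk K)) := by simp [hG, hS]
  rw [pieceSet, if_neg hx]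
  have sub : ∀ y, dir G y ∩ dir S y ⊆ ({G, S} : Set (Berk K))ᶜ := by
    intro y z hz
    simp only [Set.mem_compl_iff, Set.mem_insert_iff, Set.mem_singleton_iff, not_or]
    exact ⟨hz.1.1, hz.2.1⟩
  have mem : ∀ {y}, y ∈ ({G, S} : Set (Berk K))ᶜ → y ∈ dir G y ∩ dir S y := by
    intro y hy
    simp only [Set.mem_compl_iff, Set.mem_insert_iff, Set.mem_singleton_iff, not_or] at hy
    exact ⟨mem_dir_of_ne hy.1, mem_dir_of_ne hy.2⟩
  have opn : ∀ {y}, y ∈ ({G, S} : Set (Berk K))ᶜ → IsOpen (dir G y ∩ dir S y) := by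
    intro y hy
    have := mem hy
    exact (isOpen_dir this.1.1).inter (isOpen_dir this.2.1)
  apply Set.Subset.antisymm
  -- The sets `dir G y ∩ dir S y` are open and partition the complement of the two points. The union
  -- of those that do not belong to `x` is open too, so the component of `x` cannot reach it.
  · refine isPreconnected_connectedComponentIn.subset_left_of_subset_union (opn hx)
      (v := ⋃ y ∈ {y | y ∈ ({G, S} : Set (Berk K))ᶜ ∧ y ∉ dir G x ∩ dir S x},
        dir G y ∩ dir S y) ?_ ?_ ?_ ?_
    · exact isOpen_biUnion fun y hy => opn hy.1
    · rw [Set.disjoint_iUnion₂_right]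
      intro y hy
      rw [Set.disjoint_left]
      intro z hz hz'
      have hy' := mem hy.1
      refine hy.2 ?_
      rw [← dir_eq_of_mem hG hz.1, ← dir_eq_of_mem hS hz.2, dir_eq_of_mem hy'.1.1 hz'.1,
        dir_eq_of_mem hy'.2.1 hz'.2]
      exact hy'
    · intro z hz
      have hz' := connectedComponentIn_subset _ _ hz
      by_cases hzx : z ∈ dir G x ∩ dir S x
      · exact Or.inl hzx
      · exact Or.inr (Set.mem_biUnion ⟨hz', hzx⟩ (mem hz'))
    · exact ⟨x, mem_connectedComponentIn hx, mem hx⟩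
  -- Conversely, the intersection is convex in the tree, hence connected.
  · exact ((isTreeConvex_dir hG).inter (isTreeConvex_dir hS)).isPreconnected.subset_connectedComponentIn
      (mem hx) (sub x)

/-! ### Directions at disks -/

theorem aff_le_disk_of_rad_le {t : AffPoint K} {a : K} {r : ℝ} (hr : 0 < r) (h : t.rad a ≤ r) :
    Berk.aff t ≤ .aff (.disk a r hr) := by
  rw [Berk.aff_le_aff]
  intro b
  rw [AffPoint.disk_rad]
  exact (t.rad_le_max b a).trans (max_le_max h le_rfl)

theorem aff_le_disk_iff {t : AffPoint K} {a : K} {r : ℝ} (hr : 0 < r) :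
    Berk.aff t ≤ .aff (.disk a r hr) ↔ t.rad a ≤ r := by
  refine ⟨fun h => ?_, aff_le_disk_of_rad_le hr⟩
  have := Berk.aff_le_aff.1 h a
  rw [AffPoint.disk_rad] at this
  simpa [hr.le] using this

/-- The join of `t` with another point stays strictly below the disk exactly if that point too has
distance less than `r` to the centre `a`. So the downward directions are the open disks of the same
radius. -/
theorem dir_disk_of_rad_lt {t : AffPoint K} {a : K} {r : ℝ} (hr : 0 < r) (h : t.rad a < r) :
    dir (.aff (.disk a r hr)) (.aff t) = {T | ∃ u, T = .aff u ∧ u.rad a < r} := by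
  have hle := aff_le_disk_of_rad_le hr h.le
  have hlt : Berk.aff t < .aff (.disk a r hr) := lt_of_le_not_ge hle fun h' => by
    have := Berk.aff_le_aff.1 h' a
    rw [AffPoint.disk_rad] at this
    simp only [sub_self, norm_zero, max_eq_left hr.le] at this
    linarith
  rw [dir_of_lt hlt]
  ext T
  match T with
  | .infty =>
    simp only [Set.mem_ofPred_eq, reduceCtorEq, false_and, exists_false, iff_false]
    exact fun h' => Berk.not_infty_le _ (le_sup_left.trans h'.le)
  | .aff u =>
    obtain ⟨z, hz, hz'⟩ := Berk.exists_aff_sup u t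
    simp only [Set.mem_ofPred_eq, Berk.aff.injEq, exists_eq_left']
    rw [hz]
    constructor
    · intro h'
      by_contra! hu
      refine not_le_of_gt h' (Berk.aff_le_aff.2 fun b => ?_)
      rw [AffPoint.disk_rad, hz', max_comm (u.rad b),
        AffPoint.max_rad_of_lt (x := t) (y := u) (h.trans_le hu) b]
      exact max_le_max hu le_rfl
    · intro hu
      have hz1 : z.rad a < r := by rw [hz']; exact max_lt hu h
      refine lt_of_le_not_ge (aff_le_disk_of_rad_le hr hz1.le) fun h' => ?_
      have := Berk.aff_le_aff.1 h' a
      rw [AffPoint.disk_rad] at this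
      simp only [sub_self, norm_zero, max_eq_left hr.le] at this
      linarith

end Connected

/-! ### Directions at a type II point, indexed by `ℙ¹(ℂ)` -/

/-- The image of the Gauss point under `z ↦ c z + b`. -/
def diskPt (c : 𝕃ˣ) (b : 𝕃) : Berk 𝕃 := .aff (.disk b ‖(c : 𝕃)‖ (norm_pos_iff.2 c.ne_zero))

/-- The directions at `diskPt c b`, indexed by the residue class of `(z - b) / c`. -/
def dirAt (c : 𝕃ˣ) (b : 𝕃) : OnePoint ℂ → Set (Berk 𝕃)
  | OnePoint.some ζ => {T | ∃ u, T = .aff u ∧ u.rad (b + c * constEmb ζ) < ‖(c : 𝕃)‖}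
  | OnePoint.infty => {T | ¬ T ≤ diskPt c b}

/-- The coordinate `(z - b) / c` on `ℙ¹(𝕃)`. -/
def affCoord (c : 𝕃ˣ) (b : 𝕃) : OnePoint 𝕃 → OnePoint 𝕃
  | OnePoint.some z => OnePoint.some ((z - b) / c)
  | OnePoint.infty => OnePoint.infty

theorem norm_unit_pos (c : 𝕃ˣ) : 0 < ‖(c : 𝕃)‖ := norm_pos_iff.2 c.ne_zero

theorem norm_mul_constEmb_le (c : 𝕃ˣ) (ζ : ℂ) : ‖(c : 𝕃) * constEmb ζ‖ ≤ ‖(c : 𝕃)‖ := by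
  rw [norm_mul]
  exact mul_le_of_le_one_right (norm_nonneg _) (norm_constEmb_le ζ)

theorem max_norm_eq_of_norm_sub_le {K : Type*} [SeminormedAddCommGroup K] [IsUltrametricDist K]
    {x y : K} {r : ℝ} (h : ‖x - y‖ ≤ r) : max r ‖x‖ = max r ‖y‖ := by
  have h1 := IsUltrametricDist.norm_add_le_max (x - y) y
  have h2 := IsUltrametricDist.norm_add_le_max (y - x) x
  rw [sub_add_cancel] at h1 h2
  rw [norm_sub_rev] at h2
  grind

theorem diskPt_eq_disk (c : 𝕃ˣ) (b : 𝕃) (ζ : ℂ) :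
    diskPt c b = .aff (.disk (b + c * constEmb ζ) ‖(c : 𝕃)‖ (norm_unit_pos c)) := by
  rw [diskPt, AffPoint.ext_rad (x := .disk b ‖(c : 𝕃)‖ _)
    (y := .disk (b + c * constEmb ζ) ‖(c : 𝕃)‖ _)]
  intro a
  rw [AffPoint.disk_rad, AffPoint.disk_rad]
  apply max_norm_eq_of_norm_sub_le
  rw [show a - b - (a - (b + c * constEmb ζ)) = c * constEmb ζ by ring]
  exact norm_mul_constEmb_le c ζ

theorem dirAt_eq_dir {c : 𝕃ˣ} {b : 𝕃} {y : OnePoint ℂ} {T : Berk 𝕃} (h : T ∈ dirAt c b y) :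
    dirAt c b y = dir (diskPt c b) T := by
  match y with
  | OnePoint.some ζ =>
    obtain ⟨u, rfl, hu⟩ := h
    rw [diskPt_eq_disk c b ζ, dir_disk_of_rad_lt _ hu]
    rfl
  | OnePoint.infty =>
    rw [dir_of_not_le h]
    rfl

theorem notMem_dirAt (c : 𝕃ˣ) (b : 𝕃) (y : OnePoint ℂ) : diskPt c b ∉ dirAt c b y := by
  intro h
  rw [dirAt_eq_dir h] at h
  exact notMem_dir_self _ _ h

theorem ne_of_mem_dirAt {c : 𝕃ˣ} {b : 𝕃} {y : OnePoint ℂ} {T : Berk 𝕃} (h : T ∈ dirAt c b y) :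
    T ≠ diskPt c b := fun e => notMem_dirAt c b y (e ▸ h)

/-- A point strictly below the disk need not be classical, but it has distance less than `‖c‖` to
some `a` in the disk: the failure of the reverse inequality provides `a`. The residue class of `(a -
b) / c` is the direction. -/
theorem exists_mem_dirAt {c : 𝕃ˣ} {b : 𝕃} {T : Berk 𝕃} (h : T ≠ diskPt c b) :
    ∃ y, T ∈ dirAt c b y := by
  by_cases hle : T ≤ diskPt c b
  swap
  · exact ⟨OnePoint.infty, hle⟩
  match T with
  | .infty => exact (Berk.not_infty_le _ hle).elim
  | .aff u =>
    have hub : u.rad b ≤ ‖(c : 𝕃)‖ := (aff_le_disk_iff _).1 hle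
    have hnot : ¬ diskPt c b ≤ .aff u := fun h' => h (le_antisymm hle h')
    rw [diskPt, Berk.aff_le_aff] at hnot
    push Not at hnot
    obtain ⟨a, ha⟩ := hnot
    rw [AffPoint.disk_rad] at ha
    have h1 := u.norm_sub_le_max a b
    have hab : ‖a - b‖ ≤ ‖(c : 𝕃)‖ := by grind
    have hac : u.rad a < ‖(c : 𝕃)‖ := by grind
    have hq : ‖(a - b) / c‖ ≤ 1 := by
      rw [norm_div]
      exact div_le_one_of_le₀ hab (norm_nonneg _)
    refine ⟨OnePoint.some (redC ((a - b) / c)), u, rfl, ?_⟩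
    refine (u.rad_le_max _ a).trans_lt (max_lt hac ?_)
    rw [norm_sub_rev, show a - (b + c * constEmb (redC ((a - b) / c))) =
      c * ((a - b) / c - constEmb (redC ((a - b) / c))) by
        rw [mul_sub, mul_div_cancel₀ _ c.ne_zero]; ring, norm_mul]
    exact mul_lt_of_lt_one_right (norm_unit_pos c) (norm_sub_redC_lt hq)

theorem dirAt_some_le {c : 𝕃ˣ} {b : 𝕃} {ζ : ℂ} {T : Berk 𝕃}
    (h : T ∈ dirAt c b (OnePoint.some ζ)) : T ≤ diskPt c b := by
  obtain ⟨u, rfl, hu⟩ := h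
  rw [diskPt_eq_disk c b ζ]
  exact aff_le_disk_of_rad_le _ hu.le

theorem dirAt_injective_of_mem {c : 𝕃ˣ} {b : 𝕃} {y y' : OnePoint ℂ} {T : Berk 𝕃}
    (h : T ∈ dirAt c b y) (h' : T ∈ dirAt c b y') : y = y' := by
  match y, y' with
  | OnePoint.infty, OnePoint.infty => rfl
  | OnePoint.some ζ, OnePoint.infty => exact (h' (dirAt_some_le h)).elim
  | OnePoint.infty, OnePoint.some ζ => exact (h (dirAt_some_le h')).elim
  | OnePoint.some ζ, OnePoint.some ζ' =>
    obtain ⟨u, rfl, hu⟩ := h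
    obtain ⟨u', e, hu'⟩ := h'
    cases e
    have h1 := u.norm_sub_le_max (b + c * constEmb ζ) (b + c * constEmb ζ')
    have h2 := h1.trans_lt (max_lt hu hu')
    rw [show b + c * constEmb ζ - (b + c * constEmb ζ') =
      c * (constEmb ζ - constEmb ζ') by ring, norm_mul] at h2
    have h3 : ‖constEmb ζ - constEmb ζ'‖ < 1 := by
      by_contra! h4
      exact absurd h2 (not_lt.2 (le_mul_of_one_le_right (norm_nonneg _) h4))
    rw [constEmb_eq_of_norm_sub_lt h3]

theorem classicalPt_mem_dirAt_iff {c : 𝕃ˣ} {b : 𝕃} {y : OnePoint ℂ} {z : OnePoint 𝕃} :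
    classicalPt z ∈ dirAt c b y ↔ redPt (affCoord c b z) = y := by
  have key : ∀ z, classicalPt z ∈ dirAt c b (redPt (affCoord c b z)) := by
    intro z
    match z with
    | OnePoint.infty =>
      change Berk.infty ∈ dirAt c b (redPt OnePoint.infty)
      rw [redPt_infty]
      exact Berk.not_infty_le _
    | OnePoint.some a =>
      change Berk.aff (AffPoint.classical a) ∈ dirAt c b (redPt (OnePoint.some ((a - b) / c)))
      have hc := norm_unit_pos c
      rcases le_or_gt ‖(a - b) / c‖ 1 with h | h
      · rw [redPt_of_norm_le h]
        refine ⟨_, rfl, ?_⟩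
        rw [AffPoint.classical_rad, show a - (b + c * constEmb (redC ((a - b) / c))) =
          c * ((a - b) / c - constEmb (redC ((a - b) / c))) by
            rw [mul_sub, mul_div_cancel₀ _ c.ne_zero]; ring, norm_mul]
        exact mul_lt_of_lt_one_right hc (norm_sub_redC_lt h)
      · rw [redPt_of_one_lt h]
        intro hle
        rw [diskPt, aff_le_disk_iff, AffPoint.classical_rad] at hle
        rw [norm_div, one_lt_div hc] at h
        linarith
  exact ⟨fun h => dirAt_injective_of_mem (key z) h, fun h => h ▸ key z⟩

theorem affCoord_surjective (c : 𝕃ˣ) (b : 𝕃) : Function.Surjective (affCoord c b) := by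
  intro z
  match z with
  | OnePoint.infty => exact ⟨OnePoint.infty, rfl⟩
  | OnePoint.some a =>
    refine ⟨OnePoint.some (b + c * a), ?_⟩
    change OnePoint.some ((b + c * a - b) / c) = _
    rw [add_sub_cancel_left, mul_div_cancel_left₀ _ c.ne_zero]

theorem redPt_surjective : Function.Surjective redPt := by
  intro y
  match y with
  | OnePoint.infty => exact ⟨OnePoint.infty, rfl⟩
  | OnePoint.some ζ => exact ⟨OnePoint.some (constEmb ζ), redPt_constEmb ζ⟩

theorem exists_classicalPt_mem_dirAt (c : 𝕃ˣ) (b : 𝕃) (y : OnePoint ℂ) :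
    ∃ z, classicalPt z ∈ dirAt c b y := by
  obtain ⟨w, rfl⟩ := redPt_surjective y
  obtain ⟨z, rfl⟩ := affCoord_surjective c b w
  exact ⟨z, classicalPt_mem_dirAt_iff.2 rfl⟩

theorem gaussPt_eq_diskPt : (gaussPt : Berk 𝕃) = diskPt 1 0 := by
  rw [gaussPt, AffPoint.gauss_eq_disk, diskPt]
  congr 2
  simp

theorem affCoord_one_zero (z : OnePoint 𝕃) : affCoord 1 0 z = z := by
  match z with
  | OnePoint.infty => rfl
  | OnePoint.some a => simp [affCoord]

theorem classicalPt_mem_dirAt_gauss_iff {y : OnePoint ℂ} {z : OnePoint 𝕃} :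
    classicalPt z ∈ dirAt 1 0 y ↔ redPt z = y := by
  rw [classicalPt_mem_dirAt_iff, affCoord_one_zero]

theorem dir_gauss_classicalPt (z : OnePoint 𝕃) :
    dir gaussPt (classicalPt z) = dirAt 1 0 (redPt z) := by
  rw [dirAt_eq_dir (classicalPt_mem_dirAt_gauss_iff.2 rfl), gaussPt_eq_diskPt]

/-! ### Fibers of rational maps of `ℙ¹` over a field -/

section Fibers

variable {k : Type*} [Field k]

/-- No member of the pencil spanned by `p` and `q` vanishes. -/
def NonDeg (p q : k[X]) : Prop := ∀ w, fiberPoly p q w ≠ 0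

theorem NonDeg.den_ne {p q : k[X]} (h : NonDeg p q) : q ≠ 0 := h OnePoint.infty

theorem NonDeg.num_ne {p q : k[X]} (h : NonDeg p q) : p ≠ 0 := by
  have := h (OnePoint.some 0)
  simpa [fiberPoly] using this

theorem NonDeg.comb_ne {p q : k[X]} (h : NonDeg p q) {a b : k} (hab : a ≠ 0 ∨ b ≠ 0) :
    C a * p + C b * q ≠ 0 := by
  intro h0
  by_cases ha : a = 0
  · subst ha
    have hb : b ≠ 0 := by simpa using hab
    simp [h.den_ne, hb] at h0
  · apply h (OnePoint.some (-(b / a)))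
    change p - C (-(b / a)) * q = 0
    have : C a * (p - C (-(b / a)) * q) = 0 := by
      rw [← h0, mul_sub, ← mul_assoc, ← C_mul, mul_neg, mul_div_cancel₀ _ ha, C_neg]
      ring
    simpa [ha] using this

/-- The order of vanishing of a polynomial at a point of `ℙ¹`. -/
def ordAt : OnePoint k → k[X] → ℤ
  | OnePoint.some ζ, p => p.rootMultiplicity ζ
  | OnePoint.infty, p => -(p.natDegree : ℤ)

theorem ordAt_mul (ζ : OnePoint k) {p q : k[X]} (hp : p ≠ 0) (hq : q ≠ 0) :
    ordAt ζ (p * q) = ordAt ζ p + ordAt ζ q := by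
  match ζ with
  | OnePoint.some ζ => simp [ordAt, rootMultiplicity_mul (mul_ne_zero hp hq)]
  | OnePoint.infty =>
    simp only [ordAt, natDegree_mul hp hq]
    push_cast
    ring

theorem ordAt_C_mul (ζ : OnePoint k) {e : k} (he : e ≠ 0) (p : k[X]) :
    ordAt ζ (C e * p) = ordAt ζ p := by
  by_cases hp : p = 0
  · simp [hp]
  rw [ordAt_mul ζ (C_ne_zero.2 he) hp]
  match ζ with
  | OnePoint.some ζ => simp [ordAt]
  | OnePoint.infty => simp [ordAt]

theorem min_ordAt_le_add (ζ : OnePoint k) {p q : k[X]} (h : p + q ≠ 0) :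
    min (ordAt ζ p) (ordAt ζ q) ≤ ordAt ζ (p + q) := by
  match ζ with
  | OnePoint.some ζ =>
    simp only [ordAt]
    exact_mod_cast rootMultiplicity_add ζ h
  | OnePoint.infty =>
    simp only [ordAt, min_neg_neg, neg_le_neg_iff]
    exact_mod_cast natDegree_add_le p q

/-- The order at a point of the common divisor of two polynomials. -/
def baseOrd (ζ : OnePoint k) (p q : k[X]) : ℤ := min (ordAt ζ p) (ordAt ζ q)

theorem NonDeg.baseOrd_le_comb {p q : k[X]} (h : NonDeg p q) (ζ : OnePoint k) {a b : k}
    (hab : a ≠ 0 ∨ b ≠ 0) : baseOrd ζ p q ≤ ordAt ζ (C a * p + C b * q) := by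
  by_cases ha : a = 0
  · subst ha
    have hb : b ≠ 0 := by simpa using hab
    rw [C_0, zero_mul, zero_add, ordAt_C_mul ζ hb]
    exact min_le_right _ _
  by_cases hb : b = 0
  · subst hb
    rw [C_0, zero_mul, add_zero, ordAt_C_mul ζ ha]
    exact min_le_left _ _
  refine le_trans ?_ (min_ordAt_le_add ζ (h.comb_ne hab))
  rw [ordAt_C_mul ζ ha, ordAt_C_mul ζ hb]
  rfl

theorem exists_fiberPoly_eq_comb (p q : k[X]) (w : OnePoint k) :
    ∃ a b : k, (a ≠ 0 ∨ b ≠ 0) ∧ fiberPoly p q w = C a * p + C b * q := by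
  match w with
  | OnePoint.some u => exact ⟨1, -u, Or.inl one_ne_zero, by simp [fiberPoly, sub_eq_add_neg]⟩
  | OnePoint.infty => exact ⟨0, 1, Or.inr one_ne_zero, by simp [fiberPoly]⟩

theorem NonDeg.baseOrd_le_fiber {p q : k[X]} (h : NonDeg p q) (ζ w : OnePoint k) :
    baseOrd ζ p q ≤ ordAt ζ (fiberPoly p q w) := by
  obtain ⟨a, b, hab, e⟩ := exists_fiberPoly_eq_comb p q w
  rw [e]
  exact h.baseOrd_le_comb ζ hab

/-- `w` is the value of `p / q` at `ζ`. -/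
def IsVal (p q : k[X]) (ζ w : OnePoint k) : Prop := baseOrd ζ p q < ordAt ζ (fiberPoly p q w)

/-- If the value is finite, `q` has the least order in the pencil. The inequality then compares
numerator and denominator of `p / q - u`, the form needed for seminorms. -/
theorem IsVal.some_lt {p q : k[X]} (h : NonDeg p q) {ζ : OnePoint k} {u : k}
    (hv : IsVal p q ζ (OnePoint.some u)) : ordAt ζ q < ordAt ζ (p - C u * q) := by
  by_contra! hle
  have h1 : baseOrd ζ p q < ordAt ζ q := lt_of_lt_of_le hv hle
  have h2 : ordAt ζ p < ordAt ζ q := by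
    rw [baseOrd] at h1
    exact (min_lt_iff.1 h1).resolve_right (lt_irrefl _)
  have h3 : baseOrd ζ p q = ordAt ζ p := min_eq_left h2.le
  have hv' : ordAt ζ p < ordAt ζ (p - C u * q) := by
    rw [← h3]; exact hv
  have h4 := min_ordAt_le_add ζ (p := p - C u * q) (q := C u * q)
    (by rw [sub_add_cancel]; exact h.num_ne)
  rw [sub_add_cancel] at h4
  by_cases hu : u = 0
  · subst hu
    simp at hv'
  · rw [ordAt_C_mul ζ hu] at h4
    exact absurd (lt_min hv' h2) (not_lt.2 h4)

theorem IsVal.infty_lt {p q : k[X]} {ζ : OnePoint k}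
    (hv : IsVal p q ζ OnePoint.infty) : ordAt ζ p < ordAt ζ q := by
  have : min (ordAt ζ p) (ordAt ζ q) < ordAt ζ q := hv
  exact (min_lt_iff.1 this).resolve_right (lt_irrefl _)

theorem IsVal.ne_infty {p q : k[X]} (h : NonDeg p q) {ζ : OnePoint k} {u : k}
    (hw : IsVal p q ζ (OnePoint.some u)) : ¬ IsVal p q ζ OnePoint.infty := by
  intro hw'
  have h2 := hw'.infty_lt
  have h3 : ordAt ζ p < ordAt ζ (p - C u * q) := h2.trans (hw.some_lt h)
  have h5 := min_ordAt_le_add ζ (p := p - C u * q) (q := C u * q)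
    (by rw [sub_add_cancel]; exact h.num_ne)
  rw [sub_add_cancel] at h5
  by_cases hu : u = 0
  · subst hu
    simp at h3
  · rw [ordAt_C_mul ζ hu] at h5
    exact absurd (lt_min h3 h2) (not_lt.2 h5)

/-- Two different members span the pencil. If both vanished to more than the base order, so would
every member. -/
theorem IsVal.unique {p q : k[X]} (h : NonDeg p q) {ζ w w' : OnePoint k}
    (hw : IsVal p q ζ w) (hw' : IsVal p q ζ w') : w = w' := by
  match w, w' with
  | OnePoint.infty, OnePoint.infty => rfl
  | OnePoint.some u, OnePoint.infty => exact (hw.ne_infty h hw').elim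
  | OnePoint.infty, OnePoint.some u => exact (hw'.ne_infty h hw).elim
  | OnePoint.some u, OnePoint.some u' =>
    by_contra hne
    have hne' : u' - u ≠ 0 := sub_ne_zero.2 fun e => hne (by rw [e])
    have h1 := hw.some_lt h
    have h2 := hw'.some_lt h
    have e : C (u' - u) * q = (p - C u * q) + C (-1) * (p - C u' * q) := by
      simp only [C_sub, C_neg, C_1]
      ring
    have h3 := min_ordAt_le_add ζ (p := p - C u * q) (q := C (-1) * (p - C u' * q))
      (by rw [← e]; exact mul_ne_zero (C_ne_zero.2 hne') h.den_ne)
    rw [← e, ordAt_C_mul ζ hne', ordAt_C_mul ζ (by simp)] at h3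
    exact absurd (lt_min h1 h2) (not_lt.2 h3)

/-- The action on `ℙ¹` of a matrix. -/
def mob (α β γ δ : k) : OnePoint k → OnePoint k
  | OnePoint.some u => open Classical in
      if γ * u + δ = 0 then OnePoint.infty else OnePoint.some ((α * u + β) / (γ * u + δ))
  | OnePoint.infty => open Classical in
      if γ = 0 then OnePoint.infty else OnePoint.some (α / γ)

/-- An invertible change of basis permutes the members of a pencil, up to constants, by the Möbius
action. Values and local degrees can thus be computed in any convenient basis. -/
theorem exists_fiberPoly_mob (p q : k[X]) {α β γ δ : k} (hdet : α * δ - β * γ ≠ 0)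
    (w : OnePoint k) : ∃ e : k, e ≠ 0 ∧
      fiberPoly (C α * p + C β * q) (C γ * p + C δ * q) (mob α β γ δ w) =
        C e * fiberPoly p q w := by
  match w with
  | OnePoint.some u =>
    by_cases h0 : γ * u + δ = 0
    · have e : mob α β γ δ (OnePoint.some u) = OnePoint.infty := if_pos h0
      rw [e]
      refine ⟨γ, fun hγ => ?_, ?_⟩
      · subst hγ
        rw [zero_mul, zero_add] at h0
        simp [h0] at hdet
      · have : δ = -(γ * u) := by linear_combination h0
        simp only [fiberPoly, this, C_neg, C_mul]
        ring
    · have e : mob α β γ δ (OnePoint.some u) =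
        OnePoint.some ((α * u + β) / (γ * u + δ)) := if_neg h0
      rw [e]
      refine ⟨(α * δ - β * γ) / (γ * u + δ), div_ne_zero hdet h0, ?_⟩
      have hd := div_mul_cancel₀ (α * u + β) h0
      have hd' := div_mul_cancel₀ (α * δ - β * γ) h0
      have e1 : α - (α * u + β) / (γ * u + δ) * γ = (α * δ - β * γ) / (γ * u + δ) := by
        rw [eq_div_iff h0]
        linear_combination (-γ) * hd
      have e2 : β - (α * u + β) / (γ * u + δ) * δ =
          -((α * δ - β * γ) / (γ * u + δ) * u) := by
        apply mul_right_cancel₀ h0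
        linear_combination (-δ) * hd + u * hd'
      have e1' := congrArg C e1
      have e2' := congrArg C e2
      simp only [C_sub, C_mul, C_neg] at e1' e2'
      simp only [fiberPoly]
      linear_combination p * e1' + q * e2'
  | OnePoint.infty =>
    by_cases h0 : γ = 0
    · have e : mob α β γ δ OnePoint.infty = OnePoint.infty := if_pos h0
      rw [e]
      refine ⟨δ, fun hδ => ?_, ?_⟩
      · simp [hδ, h0] at hdet
      · simp [fiberPoly, h0]
    · have e : mob α β γ δ OnePoint.infty = OnePoint.some (α / γ) := if_neg h0
      rw [e]
      refine ⟨-((α * δ - β * γ) / γ), neg_ne_zero.2 (div_ne_zero hdet h0), ?_⟩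
      have e1 : α - α / γ * γ = 0 := by field_simp; ring
      have e2 : β - α / γ * δ = -((α * δ - β * γ) / γ) := by
        field_simp
        ring
      have e1' := congrArg C e1
      have e2' := congrArg C e2
      simp only [C_sub, C_mul, C_0] at e1' e2'
      simp only [fiberPoly]
      linear_combination p * e1' + q * e2'

theorem NonDeg.fiber_injective {p q : k[X]} (h : NonDeg p q) {e e' : k} (he : e ≠ 0)
    {w w' : OnePoint k} (hw : C e * fiberPoly p q w = C e' * fiberPoly p q w') : w = w' := by
  match w, w' with
  | OnePoint.infty, OnePoint.infty => rfl
  | OnePoint.some u, OnePoint.infty =>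
    refine absurd ?_ (h.comb_ne (a := e) (b := -(e * u) - e') (Or.inl he))
    simp only [fiberPoly] at hw
    simp only [C_sub, C_mul, C_neg]
    linear_combination hw
  | OnePoint.infty, OnePoint.some u =>
    refine absurd ?_ (h.comb_ne (a := -e') (b := e + e' * u) ?_)
    · simp only [fiberPoly] at hw
      simp only [C_add, C_mul, C_neg]
      linear_combination hw
    · by_cases he' : e' = 0
      · exact Or.inr (by simpa [he'] using he)
      · exact Or.inl (by simpa using he')
  | OnePoint.some u, OnePoint.some u' =>
    have h1 : C (e - e') * p + C (-(e * u) + e' * u') * q = 0 := by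
      simp only [fiberPoly] at hw
      simp only [C_add, C_mul, C_neg, C_sub]
      linear_combination hw
    by_contra hne
    refine h.comb_ne ?_ h1
    by_cases hee : e - e' = 0
    · refine Or.inr fun h2 => hne ?_
      rw [← sub_eq_zero.1 hee] at h2
      have : e * (u' - u) = 0 := by linear_combination h2
      rw [sub_eq_zero.1 ((mul_eq_zero.1 this).resolve_left he)]
    · exact Or.inl hee

theorem nonDeg_X_one : NonDeg (X : k[X]) 1 := by
  intro w
  match w with
  | OnePoint.some u => simpa [fiberPoly] using X_sub_C_ne_zero u
  | OnePoint.infty => simp [fiberPoly]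

theorem mob_injective {α β γ δ : k} (hdet : α * δ - β * γ ≠ 0) :
    Function.Injective (mob α β γ δ) := by
  intro w w' h
  obtain ⟨e, he, h1⟩ := exists_fiberPoly_mob (X : k[X]) 1 hdet w
  obtain ⟨e', he', h2⟩ := exists_fiberPoly_mob (X : k[X]) 1 hdet w'
  rw [h, h2] at h1
  exact nonDeg_X_one.fiber_injective he h1.symm

/-- The composition is read off the members of the pencil of `X` and `1`, where a matrix and its
adjugate multiply to the determinant; this avoids the case distinctions in `mob`. -/
theorem mob_mob_inv {α β γ δ : k} (hdet : α * δ - β * γ ≠ 0) (w : OnePoint k) :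
    mob α β γ δ (mob δ (-β) (-γ) α w) = w := by
  have hdet' : δ * α - -β * -γ ≠ 0 := by
    intro h0
    exact hdet (by linear_combination h0)
  obtain ⟨e, he, h1⟩ := exists_fiberPoly_mob (X : k[X]) 1 hdet' w
  obtain ⟨e', he', h2⟩ := exists_fiberPoly_mob (C δ * X + C (-β) * 1 : k[X])
    (C (-γ) * X + C α * 1) hdet (mob δ (-β) (-γ) α w)
  rw [h1] at h2
  have e3 : (C α * (C δ * X + C (-β) * 1) + C β * (C (-γ) * X + C α * 1) : k[X]) =
      C (α * δ - β * γ) * X := by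
    simp only [C_sub, C_mul, C_neg]
    ring
  have e4 : (C γ * (C δ * X + C (-β) * 1) + C δ * (C (-γ) * X + C α * 1) : k[X]) =
      C (α * δ - β * γ) * 1 := by
    simp only [C_sub, C_mul, C_neg]
    ring
  have e5 : ∀ (D : k) (w : OnePoint k), fiberPoly (C D * X : k[X]) (C D * 1) w =
      C D * fiberPoly (X : k[X]) 1 w := by
    intro D w
    match w with
    | OnePoint.some u => simp only [fiberPoly]; ring
    | OnePoint.infty => rfl
  rw [e3, e4, e5, ← mul_assoc, ← C_mul] at h2
  exact nonDeg_X_one.fiber_injective hdet h2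

theorem mob_surjective {α β γ δ : k} (hdet : α * δ - β * γ ≠ 0) :
    Function.Surjective (mob α β γ δ) := fun w => ⟨_, mob_mob_inv hdet w⟩

/-! ### Invariance of orders and values under a change of basis of the pencil -/

section Change

variable {p q : k[X]} {α β γ δ : k}

theorem nonDeg_change (hdet : α * δ - β * γ ≠ 0) :
    NonDeg (C α * p + C β * q) (C γ * p + C δ * q) ↔ NonDeg p q := by
  constructor
  · intro h w h0
    obtain ⟨e, -, h1⟩ := exists_fiberPoly_mob p q hdet w
    exact h _ (by rw [h1, h0, mul_zero])
  · intro h w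
    obtain ⟨w, rfl⟩ := mob_surjective hdet w
    obtain ⟨e, he, h1⟩ := exists_fiberPoly_mob p q hdet w
    rw [h1]
    exact mul_ne_zero (C_ne_zero.2 he) (h w)

/-- Linear combinations have at least the base order. The adjugate matrix recovers `p` and `q` up to
the determinant, which gives the opposite inequality. -/
theorem NonDeg.baseOrd_change (h : NonDeg p q) (hdet : α * δ - β * γ ≠ 0) (ζ : OnePoint k) :
    baseOrd ζ (C α * p + C β * q) (C γ * p + C δ * q) = baseOrd ζ p q := by
  have hrow : ∀ {α β γ δ : k}, α * δ - β * γ ≠ 0 → (α ≠ 0 ∨ β ≠ 0) ∧ (γ ≠ 0 ∨ δ ≠ 0) := by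
    intro α β γ δ hdet
    constructor
    · by_contra! h0
      simp [h0.1, h0.2] at hdet
    · by_contra! h0
      simp [h0.1, h0.2] at hdet
  have key : ∀ {p q : k[X]} {α β γ δ : k}, NonDeg p q → α * δ - β * γ ≠ 0 →
      baseOrd ζ p q ≤ baseOrd ζ (C α * p + C β * q) (C γ * p + C δ * q) :=
    fun h hdet => le_min (h.baseOrd_le_comb ζ (hrow hdet).1) (h.baseOrd_le_comb ζ (hrow hdet).2)
  refine le_antisymm ?_ (key h hdet)
  have hdet' : δ * α - -β * -γ ≠ 0 := by
    intro h0
    exact hdet (by linear_combination h0)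
  have h1 := key ((nonDeg_change hdet).2 h) hdet'
  have e3 : C δ * (C α * p + C β * q) + C (-β) * (C γ * p + C δ * q) =
      C (α * δ - β * γ) * p := by
    simp only [C_sub, C_mul, C_neg]
    ring
  have e4 : C (-γ) * (C α * p + C β * q) + C α * (C γ * p + C δ * q) =
      C (α * δ - β * γ) * q := by
    simp only [C_sub, C_mul, C_neg]
    ring
  rw [e3, e4, baseOrd, baseOrd, ordAt_C_mul ζ hdet, ordAt_C_mul ζ hdet] at h1
  exact h1

theorem NonDeg.isVal_change (h : NonDeg p q) (hdet : α * δ - β * γ ≠ 0) {ζ w : OnePoint k} :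
    IsVal (C α * p + C β * q) (C γ * p + C δ * q) ζ (mob α β γ δ w) ↔ IsVal p q ζ w := by
  obtain ⟨e, he, h1⟩ := exists_fiberPoly_mob p q hdet w
  rw [IsVal, IsVal, h.baseOrd_change hdet, h1, ordAt_C_mul ζ he]

theorem max_natDegree_change (hdet : α * δ - β * γ ≠ 0) :
    max (C α * p + C β * q).natDegree (C γ * p + C δ * q).natDegree =
      max p.natDegree q.natDegree := by
  have key : ∀ (p q : k[X]) (a b : k), (C a * p + C b * q).natDegree ≤
      max p.natDegree q.natDegree := fun p q a b =>
    (natDegree_add_le _ _).trans (max_le_max (natDegree_C_mul_le _ _) (natDegree_C_mul_le _ _))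
  refine le_antisymm (max_le (key _ _ _ _) (key _ _ _ _)) ?_
  have e3 : C δ * (C α * p + C β * q) + C (-β) * (C γ * p + C δ * q) =
      C (α * δ - β * γ) * p := by
    simp only [C_sub, C_mul, C_neg]
    ring
  have e4 : C (-γ) * (C α * p + C β * q) + C α * (C γ * p + C δ * q) =
      C (α * δ - β * γ) * q := by
    simp only [C_sub, C_mul, C_neg]
    ring
  have h1 := key (C α * p + C β * q) (C γ * p + C δ * q) δ (-β)
  have h2 := key (C α * p + C β * q) (C γ * p + C δ * q) (-γ) α
  rw [e3, natDegree_C_mul hdet] at h1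
  rw [e4, natDegree_C_mul hdet] at h2
  exact max_le h1 h2

theorem isCoprime_change (hdet : α * δ - β * γ ≠ 0) (h : IsCoprime p q) :
    IsCoprime (C α * p + C β * q) (C γ * p + C δ * q) := by
  obtain ⟨u, v, huv⟩ := h
  refine ⟨C (α * δ - β * γ)⁻¹ * (u * C δ - v * C γ), C (α * δ - β * γ)⁻¹ * (v * C α - u * C β), ?_⟩
  have e : (C (α * δ - β * γ)⁻¹ : k[X]) * (C α * C δ - C β * C γ) = 1 := by
    rw [← C_mul, ← C_mul, ← C_sub, ← C_mul, inv_mul_cancel₀ hdet, C_1]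
  linear_combination huv + (u * p + v * q) * e

end Change

/-! ### Values and local degrees -/

theorem eval_fiberPoly_eq_zero_iff {p q : k[X]} (h : IsCoprime p q) (a : k) (w : OnePoint k) :
    evalP1 p q (OnePoint.some a) = w ↔ (fiberPoly p q w).eval a = 0 := by
  have hne : q.eval a = 0 → p.eval a ≠ 0 := by
    intro hq hp
    obtain ⟨u, v, huv⟩ := h
    have := congrArg (eval a) huv
    simp [hp, hq] at this
  by_cases hq : q.eval a = 0
  · have e : evalP1 p q (OnePoint.some a) = OnePoint.infty := if_pos hq
    rw [e]
    match w with
    | OnePoint.some u => simp [fiberPoly, hq, hne hq]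
    | OnePoint.infty => simpa [fiberPoly] using hq
  · have e : evalP1 p q (OnePoint.some a) = OnePoint.some (p.eval a / q.eval a) := if_neg hq
    rw [e]
    match w with
    | OnePoint.some u =>
      simp only [fiberPoly, eval_sub, eval_mul, eval_C, sub_eq_zero]
      rw [OnePoint.coe_eq_coe, div_eq_iff hq]
    | OnePoint.infty => simpa [fiberPoly] using hq

theorem natDegree_fiberPoly_le (p q : k[X]) (w : OnePoint k) :
    (fiberPoly p q w).natDegree ≤ max p.natDegree q.natDegree := by
  match w with
  | OnePoint.some u =>
    exact (natDegree_sub_le _ _).trans (max_le_max le_rfl (natDegree_C_mul_le _ _))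
  | OnePoint.infty => exact le_max_right _ _

theorem evalP1_infty_eq_iff {p q : k[X]} (h : NonDeg p q) (w : OnePoint k) :
    evalP1 p q OnePoint.infty = w ↔
      (fiberPoly p q w).natDegree < max p.natDegree q.natDegree := by
  set N := max p.natDegree q.natDegree with hN
  have hlt : (fiberPoly p q w).natDegree < N ↔ (fiberPoly p q w).coeff N = 0 := by
    constructor
    · exact coeff_eq_zero_of_natDegree_lt
    · intro h0
      refine lt_of_le_of_ne (natDegree_fiberPoly_le p q w) fun e => h w ?_
      rwa [← e, coeff_natDegree, leadingCoeff_eq_zero] at h0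
  rw [hlt]
  have hne : q.coeff N = 0 → p.coeff N ≠ 0 := by
    intro hq hp
    rcases max_choice p.natDegree q.natDegree with e | e
    · rw [hN, e, coeff_natDegree, leadingCoeff_eq_zero] at hp
      exact h.num_ne hp
    · rw [hN, e, coeff_natDegree, leadingCoeff_eq_zero] at hq
      exact h.den_ne hq
  by_cases hq : q.coeff N = 0
  · have e : evalP1 p q OnePoint.infty = OnePoint.infty := if_pos hq
    rw [e]
    match w with
    | OnePoint.some u => simp [fiberPoly, hq, hne hq]
    | OnePoint.infty => simpa [fiberPoly] using hq
  · have e : evalP1 p q OnePoint.infty = OnePoint.some (p.coeff N / q.coeff N) := if_neg hq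
    rw [e]
    match w with
    | OnePoint.some u =>
      simp only [fiberPoly, coeff_sub, coeff_C_mul, sub_eq_zero]
      rw [OnePoint.coe_eq_coe, div_eq_iff hq]
    | OnePoint.infty => simpa [fiberPoly] using hq

/-- A finite point that is not a solution has root multiplicity zero, and if `∞` is not a solution
the degree does not drop. So the condition `evalP1 p q z = w` can be omitted, and the sum becomes a
count in the multiset of roots. -/
theorem finsum_localDegP1 {p q : k[X]} (hc : IsCoprime p q) (h : NonDeg p q) (w : OnePoint k)
    (E : Set (OnePoint k)) [DecidablePred fun a : k => (OnePoint.some a : OnePoint k) ∈ E]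
    [Decidable (OnePoint.infty ∈ E)] :
    ∑ᶠ z ∈ {z : OnePoint k | evalP1 p q z = w ∧ z ∈ E}, localDegP1 p q z =
      ((fiberPoly p q w).roots.filter fun a => (OnePoint.some a : OnePoint k) ∈ E).card +
        if OnePoint.infty ∈ E then
          max p.natDegree q.natDegree - (fiberPoly p q w).natDegree else 0 := by
  classical
  set F := fiberPoly p q w with hF
  let g : OnePoint k → ℕ := fun z => OnePoint.rec
    (if OnePoint.infty ∈ E then max p.natDegree q.natDegree - F.natDegree else 0)
    (fun a => if (OnePoint.some a : OnePoint k) ∈ E then F.rootMultiplicity a else 0) z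
  have hg : ∀ z, (∑ᶠ (_ : z ∈ {z : OnePoint k | evalP1 p q z = w ∧ z ∈ E}), localDegP1 p q z)
      = g z := by
    intro z
    rw [finsum_eq_if]
    match z with
    | OnePoint.some a =>
      change _ = if (OnePoint.some a : OnePoint k) ∈ E then F.rootMultiplicity a else 0
      by_cases hE : (OnePoint.some a : OnePoint k) ∈ E
      · by_cases hw : evalP1 p q (OnePoint.some a) = w
        · rw [if_pos ⟨hw, hE⟩, if_pos hE, localDegP1.eq_def]
          simp only [hw, hF]
        · rw [if_neg fun h => hw h.1, if_pos hE, eq_comm, rootMultiplicity_eq_zero_iff]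
          intro h0
          exact absurd ((eval_fiberPoly_eq_zero_iff hc a w).2 h0) hw
      · rw [if_neg fun h => hE h.2, if_neg hE]
    | OnePoint.infty =>
      change _ = if OnePoint.infty ∈ E then max p.natDegree q.natDegree - F.natDegree else 0
      by_cases hE : (OnePoint.infty : OnePoint k) ∈ E
      · by_cases hw : evalP1 p q OnePoint.infty = w
        · rw [if_pos ⟨hw, hE⟩, if_pos hE, localDegP1.eq_def]
          simp only [hw, hF]
        · rw [if_neg fun h => hw h.1, if_pos hE, eq_comm, Nat.sub_eq_zero_iff_le]
          by_contra! h0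
          exact hw ((evalP1_infty_eq_iff h w).2 h0)
      · rw [if_neg fun h => hE h.2, if_neg hE]
  rw [finsum_congr hg]
  have hsupp : Function.support g ⊆
      (insert OnePoint.infty (F.roots.toFinset.image (OnePoint.some : k → OnePoint k)) :
        Finset (OnePoint k)) := by
    intro z hz
    match z with
    | OnePoint.infty => simp
    | OnePoint.some a =>
      have hz' : (if (OnePoint.some a : OnePoint k) ∈ E then F.rootMultiplicity a else 0) ≠ 0 := hz
      have : F.rootMultiplicity a ≠ 0 := fun h0 => hz' (by simp [h0])
      simp only [Finset.coe_insert, Finset.coe_image, Set.mem_insert_iff, Set.mem_image]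
      refine Or.inr ⟨a, ?_, rfl⟩
      simp only [Finset.mem_coe, Multiset.mem_toFinset]
      rw [← Multiset.count_pos, count_roots]
      exact Nat.pos_of_ne_zero this
  rw [finsum_eq_sum_of_support_subset g hsupp, Finset.sum_insert (by simp), add_comm]
  congr 1
  rw [Finset.sum_image fun a _ b _ h => OnePoint.coe_injective h]
  rw [← Multiset.toFinset_sum_count_eq]
  rw [Multiset.toFinset_filter, Finset.sum_filter]
  refine Finset.sum_congr rfl fun a _ => ?_
  change (if (OnePoint.some a : OnePoint k) ∈ E then F.rootMultiplicity a else 0) = _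
  split_ifs with hE
  · rw [Multiset.count_filter_of_pos (p := fun a : k => (OnePoint.some a : OnePoint k) ∈ E) hE,
      count_roots]
  · rfl

end Fibers

/-! ### The reduction of a rational function, in terms of orders -/

theorem coeff_redNum (h : RatFunc 𝕃) (i : ℕ) :
    (redNum h).coeff i = redC (h.num.coeff i / normConst h) := by
  rw [redNum, finsetSum_coeff]
  simp only [coeff_monomial, Finset.sum_ite_eq', Finset.mem_range]
  split_ifs with hi
  · rfl
  · rw [coeff_eq_zero_of_natDegree_lt, zero_div]
    · exact (redC_eq_of_norm_sub_lt (by simp)).symm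
    · have : h.num.natDegree ≤ ratDeg h := le_max_left _ _
      omega

theorem coeff_redDen (h : RatFunc 𝕃) (i : ℕ) :
    (redDen h).coeff i = redC (h.denom.coeff i / normConst h) := by
  rw [redDen, finsetSum_coeff]
  simp only [coeff_monomial, Finset.sum_ite_eq', Finset.mem_range]
  split_ifs with hi
  · rfl
  · rw [coeff_eq_zero_of_natDegree_lt, zero_div]
    · exact (redC_eq_of_norm_sub_lt (by simp)).symm
    · have : h.denom.natDegree ≤ ratDeg h := le_max_right _ _
      omega

theorem max_natDegree_red_le (h : RatFunc 𝕃) :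
    max (redNum h).natDegree (redDen h).natDegree ≤ ratDeg h := by
  have key : ∀ g : ℕ → ℂ, (∑ i ∈ Finset.range (ratDeg h + 1), monomial i (g i)).natDegree ≤
      ratDeg h := fun g => natDegree_sum_le_of_forall_le _ _ fun i hi =>
    (natDegree_monomial_le _).trans (Nat.lt_succ_iff.1 (Finset.mem_range.1 hi))
  exact max_le (key _) (key _)

/-- The degree of the reduction `φ` of `h`. -/
def phiDegree (h : RatFunc 𝕃) : ℕ := max (phiNum h).natDegree (phiDen h).natDegree

section Red

variable {h : RatFunc 𝕃}

theorem redGcd_mul_phiNum (h : RatFunc 𝕃) : redGcd h * phiNum h = redNum h := by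
  by_cases h0 : redGcd h = 0
  · rw [h0, zero_mul, (EuclideanDomain.gcd_eq_zero_iff.1 h0).1]
  · exact EuclideanDomain.mul_div_cancel' h0 (EuclideanDomain.gcd_dvd_left _ _)

theorem redGcd_mul_phiDen (h : RatFunc 𝕃) : redGcd h * phiDen h = redDen h := by
  by_cases h0 : redGcd h = 0
  · rw [h0, zero_mul, (EuclideanDomain.gcd_eq_zero_iff.1 h0).2]
  · exact EuclideanDomain.mul_div_cancel' h0 (EuclideanDomain.gcd_dvd_right _ _)

theorem fiberPoly_red (h : RatFunc 𝕃) (w : OnePoint ℂ) :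
    fiberPoly (redNum h) (redDen h) w = redGcd h * fiberPoly (phiNum h) (phiDen h) w := by
  rw [← redGcd_mul_phiNum, ← redGcd_mul_phiDen]
  match w with
  | OnePoint.some u => simp only [fiberPoly]; ring
  | OnePoint.infty => rfl

theorem redGcd_ne (hn : NonDeg (redNum h) (redDen h)) : redGcd h ≠ 0 := fun h0 =>
  hn.den_ne (by rw [← redGcd_mul_phiDen, h0, zero_mul])

theorem nonDeg_phi (hn : NonDeg (redNum h) (redDen h)) : NonDeg (phiNum h) (phiDen h) :=
  fun w h0 => hn w (by rw [fiberPoly_red, h0, mul_zero])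

theorem isCoprime_phi (hn : NonDeg (redNum h) (redDen h)) : IsCoprime (phiNum h) (phiDen h) := by
  have e : redGcd h = redNum h * _ + redDen h * _ := EuclideanDomain.gcd_eq_gcd_ab _ _
  refine ⟨EuclideanDomain.gcdA (redNum h) (redDen h), EuclideanDomain.gcdB (redNum h) (redDen h),
    mul_left_cancel₀ (redGcd_ne hn) ?_⟩
  rw [mul_one]
  linear_combination EuclideanDomain.gcdA (redNum h) (redDen h) * redGcd_mul_phiNum h +
    EuclideanDomain.gcdB (redNum h) (redDen h) * redGcd_mul_phiDen h - e

/-- The common divisor splits off from the pencil. The remaining pencil has no base point in `ℂ`, so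
the base orders there are the multiplicities of the holes. -/
theorem baseOrd_red (hn : NonDeg (redNum h) (redDen h)) (ζ : OnePoint ℂ) :
    baseOrd ζ (redNum h) (redDen h) =
      ordAt ζ (redGcd h) + baseOrd ζ (phiNum h) (phiDen h) := by
  rw [baseOrd, ← redGcd_mul_phiNum, ← redGcd_mul_phiDen, ordAt_mul ζ (redGcd_ne hn)
    (nonDeg_phi hn).num_ne, ordAt_mul ζ (redGcd_ne hn) (nonDeg_phi hn).den_ne, min_add_add_left]
  rfl

theorem baseOrd_some_of_isCoprime {k : Type*} [Field k] {p q : k[X]} (hc : IsCoprime p q) (ζ : k) :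
    baseOrd (OnePoint.some ζ) p q = 0 := by
  refine le_antisymm ?_ (le_min (Int.natCast_nonneg _) (Int.natCast_nonneg _))
  by_contra! h0
  obtain ⟨h1, h2⟩ := lt_min_iff.1 h0
  have h1' : 0 < p.rootMultiplicity ζ := Int.natCast_pos.1 h1
  have h2' : 0 < q.rootMultiplicity ζ := Int.natCast_pos.1 h2
  have e1 : p.eval ζ = 0 := (rootMultiplicity_pos'.1 h1').2
  have e2 : q.eval ζ = 0 := (rootMultiplicity_pos'.1 h2').2
  obtain ⟨u, v, huv⟩ := hc
  have := congrArg (eval ζ) huv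
  simp [e1, e2] at this

theorem baseOrd_infty {k : Type*} [Field k] (p q : k[X]) :
    baseOrd OnePoint.infty p q = -((max p.natDegree q.natDegree : ℕ) : ℤ) := by
  simp only [baseOrd, ordAt, min_neg_neg]
  push_cast
  rfl

theorem isVal_evalP1 {k : Type*} [Field k] {p q : k[X]} (hc : IsCoprime p q) (h : NonDeg p q)
    (ζ : OnePoint k) : IsVal p q ζ (evalP1 p q ζ) := by
  match ζ with
  | OnePoint.some a =>
    rw [IsVal, baseOrd_some_of_isCoprime hc]
    simp only [ordAt]
    exact_mod_cast (rootMultiplicity_pos (h _)).2 ((eval_fiberPoly_eq_zero_iff hc a _).1 rfl)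
  | OnePoint.infty =>
    rw [IsVal, baseOrd_infty]
    simp only [ordAt, neg_lt_neg_iff]
    exact_mod_cast (evalP1_infty_eq_iff h _).1 rfl

theorem localDegP1_eq {k : Type*} [Field k] {p q : k[X]} (hc : IsCoprime p q) (ζ : OnePoint k) :
    (localDegP1 p q ζ : ℤ) = ordAt ζ (fiberPoly p q (evalP1 p q ζ)) - baseOrd ζ p q := by
  match ζ with
  | OnePoint.some a =>
    rw [baseOrd_some_of_isCoprime hc, sub_zero]
    rfl
  | OnePoint.infty =>
    rw [baseOrd_infty]
    have := natDegree_fiberPoly_le p q (evalP1 p q OnePoint.infty)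
    simp only [localDegP1.eq_def, ordAt]
    omega

theorem isVal_phi (hn : NonDeg (redNum h) (redDen h)) (ζ : OnePoint ℂ) :
    IsVal (redNum h) (redDen h) ζ (phi h ζ) := by
  have := isVal_evalP1 (isCoprime_phi hn) (nonDeg_phi hn) ζ
  rw [IsVal] at this ⊢
  rw [baseOrd_red hn, fiberPoly_red, ordAt_mul ζ (redGcd_ne hn) (nonDeg_phi hn _)]
  exact add_lt_add_right this _

theorem phiDeg_eq (hn : NonDeg (redNum h) (redDen h)) (ζ : OnePoint ℂ) :
    (phiDeg h ζ : ℤ) = ordAt ζ (fiberPoly (redNum h) (redDen h) (phi h ζ)) -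
      baseOrd ζ (redNum h) (redDen h) := by
  rw [phiDeg, localDegP1_eq (isCoprime_phi hn), baseOrd_red hn, fiberPoly_red,
    ordAt_mul ζ (redGcd_ne hn) (nonDeg_phi hn _), phi]
  ring

theorem phiDeg_pos (hn : NonDeg (redNum h) (redDen h)) (ζ : OnePoint ℂ) : 0 < phiDeg h ζ := by
  have h1 := phiDeg_eq hn ζ
  have h2 : baseOrd ζ (redNum h) (redDen h) < _ := isVal_phi hn ζ
  omega

/-- The contribution of the point `∞` to the homogenization in degree `N`. -/
def inftyDeg (N : ℕ) : OnePoint ℂ → ℤ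
  | OnePoint.some _ => 0
  | OnePoint.infty => N

/-- Orders at `∞` are minus the degrees. Adding the degree of the homogenization turns the base
order into the multiplicity of the hole at `∞` as well. -/
theorem ordH_eq (hn : NonDeg (redNum h) (redDen h)) (ζ : OnePoint ℂ) :
    (ordH h ζ : ℤ) = baseOrd ζ (redNum h) (redDen h) + inftyDeg (ratDeg h) ζ := by
  match ζ with
  | OnePoint.some a =>
    rw [baseOrd_red hn, baseOrd_some_of_isCoprime (isCoprime_phi hn)]
    simp [inftyDeg, ordH, ordAt]
  | OnePoint.infty =>
    rw [baseOrd_infty]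
    have := max_natDegree_red_le h
    simp only [ordH, inftyDeg]
    omega

theorem max_natDegree_red (hn : NonDeg (redNum h) (redDen h)) :
    max (redNum h).natDegree (redDen h).natDegree = (redGcd h).natDegree + phiDegree h := by
  rw [← redGcd_mul_phiNum, ← redGcd_mul_phiDen, natDegree_mul (redGcd_ne hn)
    (nonDeg_phi hn).num_ne, natDegree_mul (redGcd_ne hn) (nonDeg_phi hn).den_ne, phiDegree,
    Nat.add_max_add_left]

theorem finite_support_ordH (h : RatFunc 𝕃) :
    (Function.support (ordH h)).Finite := by
  refine (((redGcd h).roots.toFinset.finite_toSet.image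
    (OnePoint.some : ℂ → OnePoint ℂ)).insert OnePoint.infty).subset fun z hz => ?_
  match z with
  | OnePoint.infty => exact Or.inl rfl
  | OnePoint.some a =>
    refine Or.inr ⟨a, ?_, rfl⟩
    have hz' : (redGcd h).rootMultiplicity a ≠ 0 := hz
    simp only [Finset.mem_coe, Multiset.mem_toFinset]
    rw [← Multiset.count_pos, count_roots]
    exact Nat.pos_of_ne_zero hz'

/-- Over `ℂ` the common divisor has as many roots as its degree, and the part of the degree of `h`
that is lost in the reduction sits at the hole `∞`. -/
theorem finsum_ordH (hn : NonDeg (redNum h) (redDen h)) :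
    ∑ᶠ ζ, ordH h ζ + phiDegree h = ratDeg h := by
  classical
  have hsupp : Function.support (ordH h) ⊆ (insert OnePoint.infty
      ((redGcd h).roots.toFinset.image (OnePoint.some : ℂ → OnePoint ℂ)) :
        Finset (OnePoint ℂ)) := by
    intro z hz
    match z with
    | OnePoint.infty => simp
    | OnePoint.some a =>
      have hz' : (redGcd h).rootMultiplicity a ≠ 0 := hz
      simp only [Finset.coe_insert, Finset.coe_image, Set.mem_insert_iff, Set.mem_image]
      refine Or.inr ⟨a, ?_, rfl⟩
      simp only [Finset.mem_coe, Multiset.mem_toFinset]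
      rw [← Multiset.count_pos, count_roots]
      exact Nat.pos_of_ne_zero hz'
  rw [finsum_eq_sum_of_support_subset _ hsupp, Finset.sum_insert (by simp),
    Finset.sum_image fun a _ b _ h => OnePoint.coe_injective h]
  have e : ∑ a ∈ (redGcd h).roots.toFinset, ordH h (OnePoint.some a) = (redGcd h).natDegree := by
    rw [← (IsAlgClosed.splits (redGcd h)).natDegree_eq_card_roots.symm,
      ← Multiset.toFinset_sum_count_eq]
    exact Finset.sum_congr rfl fun a _ => (count_roots _).symm
  rw [e]
  have h1 := max_natDegree_red hn
  have h2 := max_natDegree_red_le h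
  simp only [ordH]
  omega

theorem finsum_phiDeg (hn : NonDeg (redNum h) (redDen h)) (w : OnePoint ℂ) :
    ∑ᶠ z ∈ {z : OnePoint ℂ | phi h z = w ∧ z ∈ Set.univ}, phiDeg h z = phiDegree h := by
  classical
  have := finsum_localDegP1 (isCoprime_phi hn) (nonDeg_phi hn) w Set.univ
  simp only [Set.mem_univ, Multiset.filter_true, if_true] at this
  rw [← (IsAlgClosed.splits (fiberPoly (phiNum h) (phiDen h) w)).natDegree_eq_card_roots] at this
  have h1 := natDegree_fiberPoly_le (phiNum h) (phiDen h) w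
  rw [phiDegree]
  refine Eq.trans ?_ (this.trans (by omega))
  rfl

theorem finite_fiber_phi (hn : NonDeg (redNum h) (redDen h)) (w : OnePoint ℂ) :
    {z | phi h z = w}.Finite := by
  refine (((fiberPoly (phiNum h) (phiDen h) w).roots.toFinset.finite_toSet.image
    (OnePoint.some : ℂ → OnePoint ℂ)).insert OnePoint.infty).subset fun z hz => ?_
  match z with
  | OnePoint.infty => exact Or.inl rfl
  | OnePoint.some a =>
    refine Or.inr ⟨a, ?_, rfl⟩
    simp only [Finset.mem_coe, Multiset.mem_toFinset]
    rw [mem_roots (nonDeg_phi hn w)]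
    exact (eval_fiberPoly_eq_zero_iff (isCoprime_phi hn) a w).1 hz

end Red

/-! ### Polynomials with integral coefficients -/

/-- The inclusion of the polynomials with integral coefficients. -/
def toL : intRing[X] →+* 𝕃[X] := mapRingHom intRing.subtype

/-- The reduction of a polynomial with integral coefficients. -/
def redPoly : intRing[X] →+* ℂ[X] := mapRingHom redHom

theorem toL_injective : Function.Injective toL :=
  map_injective _ Subtype.val_injective

theorem coeff_toL (P : intRing[X]) (i : ℕ) : (toL P).coeff i = P.coeff i := coeff_map _ _

theorem coeff_redPoly (P : intRing[X]) (i : ℕ) : (redPoly P).coeff i = redHom (P.coeff i) :=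
  coeff_map _ _

theorem toL_C (a : intRing) : toL (C a) = C (a : 𝕃) := map_C _

theorem toL_X : toL X = X := map_X _

theorem redPoly_C (a : intRing) : redPoly (C a) = C (redHom a) := map_C _

theorem redPoly_X : redPoly X = X := map_X _

theorem exists_toL_eq {p : 𝕃[X]} (hp : ∀ i, ‖p.coeff i‖ ≤ 1) : ∃ P, toL P = p := by
  have : p ∈ lifts intRing.subtype := (lifts_iff_coeff_lifts p).2 fun i =>
    ⟨⟨p.coeff i, hp i⟩, rfl⟩
  exact (mem_lifts p).1 this

theorem norm_coeff_le_gauss (p : 𝕃[X]) (i : ℕ) : ‖p.coeff i‖ ≤ AffPoint.gauss.sn p := by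
  have := p.le_gaussNorm (NormedField.toAbsoluteValue 𝕃) zero_le_one i
  rw [one_pow, mul_one] at this
  exact this

theorem exists_norm_coeff_eq_gauss (p : 𝕃[X]) : ∃ i, AffPoint.gauss.sn p = ‖p.coeff i‖ := by
  obtain ⟨i, hi⟩ := p.exists_eq_gaussNorm (NormedField.toAbsoluteValue 𝕃) 1
  rw [one_pow, mul_one] at hi
  exact ⟨i, hi⟩

theorem gauss_toL_le (P : intRing[X]) : AffPoint.gauss.sn (toL P) ≤ 1 := by
  obtain ⟨i, hi⟩ := exists_norm_coeff_eq_gauss (toL P)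
  rw [hi, coeff_toL]
  exact (P.coeff i).2

theorem redPoly_ne_zero_iff (P : intRing[X]) : redPoly P ≠ 0 ↔ AffPoint.gauss.sn (toL P) = 1 := by
  constructor
  · intro h
    obtain ⟨i, hi⟩ : ∃ i, (redPoly P).coeff i ≠ 0 := by
      by_contra! h0
      exact h (Polynomial.ext fun i => by rw [h0, coeff_zero])
    rw [coeff_redPoly, redHom_ne_zero_iff, ← coeff_toL] at hi
    exact le_antisymm (gauss_toL_le P) (hi ▸ norm_coeff_le_gauss _ i)
  · intro h h0
    obtain ⟨i, hi⟩ := exists_norm_coeff_eq_gauss (toL P)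
    rw [h, coeff_toL] at hi
    have := (redHom_ne_zero_iff (P.coeff i)).2 hi.symm
    rw [← coeff_redPoly, h0] at this
    exact this rfl

theorem toL_ne_zero_of_red {P : intRing[X]} (h : redPoly P ≠ 0) : toL P ≠ 0 := fun h0 => by
  rw [redPoly_ne_zero_iff, h0, map_zero] at h
  exact zero_ne_one h

/-- A multiple of `z - a` with integral coefficients and nonzero reduction. -/
def linFactor (a : 𝕃) : intRing[X] := open Classical in
  if h : ‖a‖ ≤ 1 then X - C ⟨a, h⟩
  else 1 - C ⟨a⁻¹, by
    rw [mem_intRing, norm_inv]; exact inv_le_one_of_one_le₀ (not_le.1 h).le⟩ * X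

theorem exists_toL_linFactor (a : 𝕃) : ∃ e : 𝕃, e ≠ 0 ∧ toL (linFactor a) = C e * (X - C a) := by
  by_cases h : ‖a‖ ≤ 1
  · refine ⟨1, one_ne_zero, ?_⟩
    rw [linFactor, dif_pos h, map_sub, toL_X, toL_C, C_1, one_mul]
  · have ha : a ≠ 0 := fun h0 => h (by simp [h0])
    refine ⟨-a⁻¹, by simpa using ha, ?_⟩
    rw [linFactor, dif_neg h, map_sub, map_mul, toL_X, toL_C, map_one, C_neg, mul_sub, neg_mul,
      neg_mul, ← C_mul, inv_mul_cancel₀ ha, C_1]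
    ring

theorem redPoly_linFactor (a : 𝕃) : redPoly (linFactor a) =
    if ‖a‖ ≤ 1 then X - C (redC a) else 1 := by
  by_cases h : ‖a‖ ≤ 1
  · rw [linFactor, dif_pos h, if_pos h, map_sub, redPoly_X, redPoly_C, redHom_apply]
  · rw [linFactor, dif_neg h, if_neg h, map_sub, map_mul, redPoly_X, redPoly_C, map_one,
      (redHom_eq_zero_iff _).2, C_0, zero_mul, sub_zero]
    rw [norm_inv]
    exact inv_lt_one_of_one_lt₀ (not_le.1 h)

/-- `F` and the product `G` of the normalized linear factors of its roots differ by a constant. Both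
have Gauss norm one, so this constant is a unit of the valuation ring. A linear factor whose root
has norm above one reduces to `1`. -/
theorem roots_redPoly {F : intRing[X]} (hF : redPoly F ≠ 0) :
    (redPoly F).roots = ((toL F).roots.filter fun a => ‖a‖ ≤ 1).map redC := by
  set s := (toL F).roots with hs
  let G : intRing[X] := (s.map linFactor).prod
  have hG : ∃ e : 𝕃, e ≠ 0 ∧ toL G = C e * (s.map fun a => X - C a).prod := by
    simp only [G]
    generalize s = s
    induction s using Multiset.induction_on with
    | empty => exact ⟨1, one_ne_zero, by simp⟩
    | cons a s ih =>
      obtain ⟨e, he, h1⟩ := ih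
      obtain ⟨e', he', h2⟩ := exists_toL_linFactor a
      refine ⟨e' * e, mul_ne_zero he' he, ?_⟩
      rw [Multiset.map_cons, Multiset.prod_cons, map_mul, h1, h2, Multiset.map_cons,
        Multiset.prod_cons, C_mul]
      ring
  have hGr : redPoly G = ((s.filter fun a => ‖a‖ ≤ 1).map fun a => X - C (redC a)).prod := by
    simp only [G]
    generalize s = s
    induction s using Multiset.induction_on with
    | empty => simp
    | cons a s ih =>
      rw [Multiset.map_cons, Multiset.prod_cons, map_mul, ih, redPoly_linFactor]
      by_cases h : ‖a‖ ≤ 1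
      · rw [if_pos h, Multiset.filter_cons_of_pos (p := fun a : 𝕃 => ‖a‖ ≤ 1) _ h,
          Multiset.map_cons, Multiset.prod_cons]
      · rw [if_neg h, Multiset.filter_cons_of_neg (p := fun a : 𝕃 => ‖a‖ ≤ 1) _ h, one_mul]
  have hGr' : redPoly G = (((s.filter fun a => ‖a‖ ≤ 1).map redC).map fun ζ => X - C ζ).prod := by
    rw [hGr, Multiset.map_map]
    rfl
  have hG0 : redPoly G ≠ 0 := by
    rw [hGr']
    exact (monic_multiset_prod_of_monic _ _ fun ζ _ => monic_X_sub_C ζ).ne_zero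
  obtain ⟨e, he, hGe⟩ := hG
  have hFe : toL F = C ((toL F).leadingCoeff / e) * toL G := by
    rw [hGe, ← mul_assoc, ← C_mul, div_mul_cancel₀ _ he]
    exact (IsAlgClosed.splits (toL F)).eq_prod_roots
  set u := (toL F).leadingCoeff / e with hu
  have hnorm : ‖u‖ = 1 := by
    have := congrArg AffPoint.gauss.sn hFe
    rw [map_mul, AffPoint.map_C, (redPoly_ne_zero_iff F).1 hF, (redPoly_ne_zero_iff G).1 hG0,
      mul_one] at this
    exact this.symm
  have hFG : F = C ⟨u, hnorm.le⟩ * G := toL_injective (by rw [map_mul, toL_C]; exact hFe)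
  have hu0 : redHom ⟨u, hnorm.le⟩ ≠ 0 := (redHom_ne_zero_iff _).2 hnorm
  rw [hFG, map_mul, redPoly_C, roots_C_mul _ hu0, hGr', roots_multiset_prod_X_sub_C]

theorem natDegree_redPoly {F : intRing[X]} (hF : redPoly F ≠ 0) :
    (redPoly F).natDegree = ((toL F).roots.filter fun a => ‖a‖ ≤ 1).card := by
  rw [(IsAlgClosed.splits (redPoly F)).natDegree_eq_card_roots, roots_redPoly hF,
    Multiset.card_map]

open Classical in
/-- The number of roots in a residue class, with the roots at `∞` of the homogenization in
degree `N`. -/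
theorem card_roots_class {F : intRing[X]} (hF : redPoly F ≠ 0) {N : ℕ}
    (hN : (toL F).natDegree ≤ N) (ζ : OnePoint ℂ) :
    (((toL F).roots.filter fun a => redPt (OnePoint.some a) = ζ).card +
      (if OnePoint.infty = ζ then N - (toL F).natDegree else 0 : ℕ) : ℤ) =
      ordAt ζ (redPoly F) + inftyDeg N ζ := by
  match ζ with
  | OnePoint.some c =>
    rw [if_neg (OnePoint.infty_ne_coe c)]
    simp only [ordAt, inftyDeg, Nat.cast_zero, add_zero, Nat.cast_inj]
    rw [← count_roots, roots_redPoly hF, Multiset.count_map, Multiset.filter_filter]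
    congr 1
    refine Multiset.filter_congr fun a _ => ?_
    constructor
    · intro h
      have ha : ‖a‖ ≤ 1 := by
        by_contra! h1
        rw [redPt_of_one_lt h1] at h
        exact OnePoint.infty_ne_coe _ h
      rw [redPt_of_norm_le ha] at h
      exact ⟨(OnePoint.coe_injective h).symm, ha⟩
    · rintro ⟨h1, h2⟩
      rw [redPt_of_norm_le h2, h1]
  -- Roots of norm above one disappear from the reduction and lower its degree; with the roots at
  -- infinity they fill it up to `N`.
  | OnePoint.infty =>
    rw [if_pos rfl]
    simp only [ordAt, inftyDeg, redPt_eq_infty_iff]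
    have h1 := natDegree_redPoly hF
    have h2 := (IsAlgClosed.splits (toL F)).natDegree_eq_card_roots
    have h3 := congrArg Multiset.card
      (Multiset.filter_add_not (fun a : 𝕃 => ‖a‖ ≤ 1) (toL F).roots)
    simp only [not_le, Multiset.card_add] at h3
    omega

/-! ### Points near the Gauss point -/

/-- The point at distance `τ` from the Gauss point in the direction `ζ`. -/
def nearPt : OnePoint ℂ → ℝ → AffPoint 𝕃
  | OnePoint.some ζ, τ => .disk (constEmb ζ) (Real.exp (-τ)) (Real.exp_pos _)
  | OnePoint.infty, τ => .disk 0 (Real.exp τ) (Real.exp_pos _)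

theorem nearPt_some_rad (ζ : ℂ) (τ : ℝ) (a : 𝕃) :
    (nearPt (OnePoint.some ζ) τ).rad a = max (Real.exp (-τ)) ‖a - constEmb ζ‖ :=
  AffPoint.disk_rad _ _ (Real.exp_pos _) _

theorem nearPt_infty_rad (τ : ℝ) (a : 𝕃) :
    (nearPt OnePoint.infty τ).rad a = max (Real.exp τ) ‖a‖ := by
  refine (AffPoint.disk_rad _ _ (Real.exp_pos _) _).trans ?_
  rw [sub_zero]

theorem multiset_prod_map_mul_ite {α : Type*} (s : Multiset α) (g h : α → ℝ) (p : α → Prop)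
    [DecidablePred p] (c : ℝ) (hg : ∀ a ∈ s, g a = h a * if p a then c else 1) :
    (s.map g).prod = (s.map h).prod * c ^ (s.filter p).card := by
  rw [Multiset.map_congr rfl hg, Multiset.prod_map_mul]
  congr 1
  clear hg
  induction s using Multiset.induction_on with
  | empty => simp
  | cons a s ih =>
    rw [Multiset.map_cons, Multiset.prod_cons, ih]
    by_cases ha : p a
    · rw [if_pos ha, Multiset.filter_cons_of_pos _ ha, Multiset.card_cons, pow_succ, mul_comm]
    · rw [if_neg ha, Multiset.filter_cons_of_neg _ ha, one_mul]

open Filter Topology in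
/-- Near the Gauss point, seminorms decrease exponentially, at a rate given by the order of the
reduction. -/
theorem eventually_sn_nearPt {F : intRing[X]} (hF : redPoly F ≠ 0) (ζ : OnePoint ℂ) :
    ∀ᶠ τ in 𝓝[>] (0 : ℝ), (nearPt ζ τ).sn (toL F) = Real.exp (-τ * ordAt ζ (redPoly F)) := by
  classical
  have hgauss := (redPoly_ne_zero_iff F).1 hF
  rw [AffPoint.sn_eq_prod] at hgauss
  have hpos : ∀ᶠ τ in 𝓝[>] (0 : ℝ), 0 < τ := self_mem_nhdsWithin
  have hexp : Tendsto (fun τ : ℝ => Real.exp τ) (𝓝[>] 0) (𝓝 1) := by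
    have : Tendsto (fun τ : ℝ => Real.exp τ) (𝓝 0) (𝓝 (Real.exp 0)) :=
      Real.continuous_exp.continuousAt
    rw [Real.exp_zero] at this
    exact this.mono_left nhdsWithin_le_nhds
  have hexp' : Tendsto (fun τ : ℝ => Real.exp (-τ)) (𝓝[>] 0) (𝓝 1) := by
    have : Tendsto (fun τ : ℝ => Real.exp (-τ)) (𝓝 0) (𝓝 (Real.exp (-0))) :=
      (Real.continuous_exp.comp continuous_neg).continuousAt
    rw [neg_zero, Real.exp_zero] at this
    exact this.mono_left nhdsWithin_le_nhds
  match ζ with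
  | OnePoint.some c =>
    -- There are finitely many roots, so for small `τ` the disk of radius `exp (-τ)` contains all
    -- roots in the residue class of `c`. Each of them contributes a factor `exp (-τ)`; the other
    -- factors are as at the Gauss point.
    have hall : ∀ᶠ τ in 𝓝[>] (0 : ℝ), ∀ a ∈ (toL F).roots.toFinset,
        ‖a - constEmb c‖ < 1 → ‖a - constEmb c‖ < Real.exp (-τ) := by
      rw [Filter.eventually_all_finset]
      intro a _
      by_cases ha : ‖a - constEmb c‖ < 1
      · filter_upwards [hexp'.eventually (lt_mem_nhds ha)] with τ hτ _ using hτ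
      · exact Eventually.of_forall fun τ h => absurd h ha
    filter_upwards [hall, hpos] with τ hτ hτ0
    have hτ1 : Real.exp (-τ) < 1 := by simpa using hτ0
    rw [AffPoint.sn_eq_prod, multiset_prod_map_mul_ite _ _ (AffPoint.gauss (K := 𝕃)).rad
      (fun a => redPt (OnePoint.some a) = OnePoint.some c) (Real.exp (-τ)), ← mul_assoc, hgauss,
      one_mul]
    · have := card_roots_class hF le_rfl (OnePoint.some c)
      rw [if_neg (OnePoint.infty_ne_coe c)] at this
      simp only [inftyDeg, Nat.cast_zero, add_zero] at this
      rw [← this, ← Real.exp_nat_mul]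
      push_cast
      ring_nf
    · intro a ha
      rw [nearPt_some_rad, AffPoint.gauss_rad]
      split_ifs with hr
      · have h1 := redPt_eq_some_iff.1 hr
        have h2 : ‖a‖ ≤ 1 := by
          rw [← sub_add_cancel a (constEmb c)]
          exact (IsUltrametricDist.norm_add_le_max _ _).trans (max_le h1.le (norm_constEmb_le c))
        rw [max_eq_left h2, one_mul, max_eq_left (hτ a (by simpa using ha) h1).le]
      · rw [redPt_eq_some_iff, not_lt] at hr
        rw [max_eq_right (hτ1.le.trans hr), mul_one, ← max_eq_right hr]
        exact max_norm_eq_of_norm_sub_le (by simpa using norm_constEmb_le c)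
  | OnePoint.infty =>
    -- In the direction `∞` it is the roots of norm at most one whose factors change, by `exp τ`;
    -- their number is the degree of the reduction.
    have hall : ∀ᶠ τ in 𝓝[>] (0 : ℝ), ∀ a ∈ (toL F).roots.toFinset,
        1 < ‖a‖ → Real.exp τ < ‖a‖ := by
      rw [Filter.eventually_all_finset]
      intro a _
      by_cases ha : 1 < ‖a‖
      · filter_upwards [hexp.eventually (gt_mem_nhds ha)] with τ hτ _ using hτ
      · exact Eventually.of_forall fun τ h => absurd h ha
    filter_upwards [hall, hpos] with τ hτ hτ0
    have hτ1 : 1 < Real.exp τ := by simpa using hτ0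
    rw [AffPoint.sn_eq_prod, multiset_prod_map_mul_ite _ _ (AffPoint.gauss (K := 𝕃)).rad
      (fun a => ‖a‖ ≤ 1) (Real.exp τ), ← mul_assoc, hgauss, one_mul, ← natDegree_redPoly hF,
      ← Real.exp_nat_mul]
    · simp only [ordAt]
      push_cast
      ring_nf
    · intro a ha
      rw [nearPt_infty_rad, AffPoint.gauss_rad]
      split_ifs with hr
      · rw [max_eq_left hr, one_mul, max_eq_left (hr.trans hτ1.le)]
      · rw [not_le] at hr
        rw [max_eq_right hr.le, mul_one, max_eq_right (hτ a (by simpa using ha) hr).le]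

/-! ### Integral representatives of rational functions -/

/-- `h = P / Q` for coprime polynomials with integral coefficients, not all of which reduce
to `0`. -/
structure IsRep (h : RatFunc 𝕃) (P Q : intRing[X]) : Prop where
  coprime : IsCoprime (toL P) (toL Q)
  den_ne : toL Q ≠ 0
  eq : h = algebraMap 𝕃[X] (RatFunc 𝕃) (toL P) / algebraMap 𝕃[X] (RatFunc 𝕃) (toL Q)
  red_ne : redPoly P ≠ 0 ∨ redPoly Q ≠ 0

theorem exists_num_denom_eq {k : Type*} [Field k] {p q : k[X]} (hc : IsCoprime p q) (hq : q ≠ 0) :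
    ∃ u : k, u ≠ 0 ∧
      p = C u * (algebraMap k[X] (RatFunc k) p / algebraMap k[X] (RatFunc k) q).num ∧
      q = C u * (algebraMap k[X] (RatFunc k) p / algebraMap k[X] (RatFunc k) q).denom := by
  set h := algebraMap k[X] (RatFunc k) p / algebraMap k[X] (RatFunc k) q with hh
  have e : h.num * q = p * h.denom := (RatFunc.num_mul_eq_mul_denom_iff hq).2 hh
  have hcop := RatFunc.isCoprime_num_denom h
  have d1 : q ∣ h.denom := hc.symm.dvd_of_dvd_mul_left (by rw [← e]; exact dvd_mul_left _ _)
  have d2 : h.denom ∣ q := hcop.symm.dvd_of_dvd_mul_left (by rw [e]; exact dvd_mul_left _ _)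
  obtain ⟨u, hu⟩ := associated_of_dvd_dvd d2 d1
  obtain ⟨c, hc0, hcu⟩ := isUnit_iff.1 u.isUnit
  have hden : h.denom ≠ 0 := h.denom_ne_zero
  refine ⟨c, hc0.ne_zero, ?_, ?_⟩
  · refine mul_right_cancel₀ hden ?_
    rw [← e, ← hu, ← hcu]
    ring
  · rw [← hu, ← hcu, mul_comm]

theorem IsRep.exists_num {h : RatFunc 𝕃} {P Q : intRing[X]} (hr : IsRep h P Q) :
    ∃ u : 𝕃, u ≠ 0 ∧ toL P = C u * h.num ∧ toL Q = C u * h.denom := by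
  have := exists_num_denom_eq hr.coprime hr.den_ne
  rwa [← hr.eq] at this

theorem normConst_spec (h : RatFunc 𝕃) :
    (∃ i, h.num.coeff i = normConst h ∨ h.denom.coeff i = normConst h) ∧
      ∀ i, ‖h.num.coeff i‖ ≤ ‖normConst h‖ ∧ ‖h.denom.coeff i‖ ≤ ‖normConst h‖ := by
  refine Classical.epsilon_spec (p := fun c : 𝕃 =>
    (∃ i, h.num.coeff i = c ∨ h.denom.coeff i = c) ∧
      ∀ i, ‖h.num.coeff i‖ ≤ ‖c‖ ∧ ‖h.denom.coeff i‖ ≤ ‖c‖) ?_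
  obtain ⟨i, hi⟩ := exists_norm_coeff_eq_gauss h.num
  obtain ⟨j, hj⟩ := exists_norm_coeff_eq_gauss h.denom
  rcases le_total ‖h.num.coeff i‖ ‖h.denom.coeff j‖ with hle | hle
  · exact ⟨h.denom.coeff j, ⟨j, Or.inr rfl⟩, fun n =>
      ⟨((norm_coeff_le_gauss _ n).trans hi.le).trans hle, (norm_coeff_le_gauss _ n).trans hj.le⟩⟩
  · exact ⟨h.num.coeff i, ⟨i, Or.inl rfl⟩, fun n =>
      ⟨(norm_coeff_le_gauss _ n).trans hi.le, ((norm_coeff_le_gauss _ n).trans hj.le).trans hle⟩⟩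

theorem normConst_ne_zero (h : RatFunc 𝕃) : normConst h ≠ 0 := by
  intro h0
  have := (normConst_spec h).2 h.denom.natDegree
  rw [h0, norm_zero] at this
  have h1 : h.denom.leadingCoeff = 0 := norm_le_zero_iff.1 this.2
  exact h.denom_ne_zero (leadingCoeff_eq_zero.1 h1)

/-- The scaling factor between `P`, `Q` and the normalized numerator and denominator has norm one,
since on both sides the largest coefficient has norm one. The choice in `normConst` thus only
affects a nonzero constant. -/
theorem IsRep.exists_red {h : RatFunc 𝕃} {P Q : intRing[X]} (hr : IsRep h P Q) :
    ∃ e : ℂ, e ≠ 0 ∧ redPoly P = C e * redNum h ∧ redPoly Q = C e * redDen h := by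
  obtain ⟨u, hu, hP, hQ⟩ := hr.exists_num
  have hκ := normConst_ne_zero h
  obtain ⟨⟨i, hi⟩, hmax⟩ := normConst_spec h
  have hle : ‖u * normConst h‖ ≤ 1 := by
    rcases hi with hi | hi
    · rw [← hi, ← coeff_C_mul, ← hP, coeff_toL]
      exact (P.coeff i).2
    · rw [← hi, ← coeff_C_mul, ← hQ, coeff_toL]
      exact (Q.coeff i).2
  have hge : 1 ≤ ‖u * normConst h‖ := by
    rcases hr.red_ne with h0 | h0
    · rw [redPoly_ne_zero_iff] at h0
      obtain ⟨j, hj⟩ := exists_norm_coeff_eq_gauss (toL P)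
      rw [← h0, hj, hP, coeff_C_mul, norm_mul, norm_mul]
      exact mul_le_mul_of_nonneg_left (hmax j).1 (norm_nonneg _)
    · rw [redPoly_ne_zero_iff] at h0
      obtain ⟨j, hj⟩ := exists_norm_coeff_eq_gauss (toL Q)
      rw [← h0, hj, hQ, coeff_C_mul, norm_mul, norm_mul]
      exact mul_le_mul_of_nonneg_left (hmax j).2 (norm_nonneg _)
  have key : ∀ (R : intRing[X]) (p : 𝕃[X]) (n : ℕ), toL R = C u * p →
      ‖p.coeff n‖ ≤ ‖normConst h‖ → (redPoly R).coeff n =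
        redHom ⟨u * normConst h, hle⟩ * redC (p.coeff n / normConst h) := by
    intro R p n hR hp
    have hq : ‖p.coeff n / normConst h‖ ≤ 1 := by
      rw [norm_div]
      exact div_le_one_of_le₀ hp (norm_nonneg _)
    rw [coeff_redPoly, show redC (p.coeff n / normConst h) = redHom ⟨_, hq⟩ from rfl, ← map_mul]
    congr 1
    apply Subtype.ext
    rw [← coeff_toL, hR, coeff_C_mul]
    change _ = u * normConst h * (p.coeff n / normConst h)
    field_simp
  refine ⟨redHom ⟨u * normConst h, hle⟩, (redHom_ne_zero_iff _).2 (le_antisymm hle hge), ?_, ?_⟩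
  · ext n
    rw [coeff_C_mul, coeff_redNum, key P h.num n hP (hmax n).1]
  · ext n
    rw [coeff_C_mul, coeff_redDen, key Q h.denom n hQ (hmax n).2]

theorem IsRep.ratDeg_eq {h : RatFunc 𝕃} {P Q : intRing[X]} (hr : IsRep h P Q) :
    ratDeg h = max (toL P).natDegree (toL Q).natDegree := by
  obtain ⟨u, hu, hP, hQ⟩ := hr.exists_num
  rw [hP, hQ, natDegree_C_mul hu, natDegree_C_mul hu, ratDeg]

theorem exists_isRep (h : RatFunc 𝕃) : ∃ P Q, IsRep h P Q := by
  have hκ := normConst_ne_zero h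
  obtain ⟨⟨i, hi⟩, hmax⟩ := normConst_spec h
  have key : ∀ p : 𝕃[X], (∀ n, ‖p.coeff n‖ ≤ ‖normConst h‖) →
      ∃ P, toL P = C (normConst h)⁻¹ * p := fun p hp => exists_toL_eq fun n => by
    rw [coeff_C_mul, norm_mul, norm_inv]
    exact inv_mul_le_one_of_le₀ (hp n) (norm_nonneg _)
  obtain ⟨P, hP⟩ := key h.num fun n => (hmax n).1
  obtain ⟨Q, hQ⟩ := key h.denom fun n => (hmax n).2
  have hu : IsUnit (C (normConst h)⁻¹ : 𝕃[X]) := isUnit_C.2 (inv_ne_zero hκ).isUnit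
  have hred : ∀ (R : intRing[X]) (p : 𝕃[X]), toL R = C (normConst h)⁻¹ * p →
      p.coeff i = normConst h → redPoly R ≠ 0 := by
    intro R p hR hp
    rw [redPoly_ne_zero_iff]
    refine le_antisymm (gauss_toL_le R) ((norm_coeff_le_gauss (toL R) i).trans' ?_)
    rw [hR, coeff_C_mul, hp, inv_mul_cancel₀ hκ, norm_one]
  refine ⟨P, Q, ?_, ?_, ?_, ?_⟩
  · rw [hP, hQ]
    exact (isCoprime_mul_unit_left hu _ _).2 (RatFunc.isCoprime_num_denom h)
  · rw [hQ]
    exact mul_ne_zero hu.ne_zero h.denom_ne_zero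
  · rw [hP, hQ, map_mul, map_mul, mul_div_mul_left, RatFunc.num_div_denom]
    exact (map_ne_zero_iff _ (RatFunc.algebraMap_injective 𝕃)).2 hu.ne_zero
  · rcases hi with hi | hi
    · exact Or.inl (hred P h.num hP hi)
    · exact Or.inr (hred Q h.denom hQ hi)

/-! ### The action of a rational function near the Gauss point -/

theorem AffPoint.sn_ne_zero_of_rad_pos {K : Type*} [NormedField K]
    [IsUltrametricDist K] [IsAlgClosed K] {x : AffPoint K}
    (hx : ∀ a, 0 < x.rad a) {p : K[X]} (hp : p ≠ 0) : x.sn p ≠ 0 := by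
  rw [x.sn_eq_prod]
  refine mul_ne_zero (norm_ne_zero_iff.2 (leadingCoeff_ne_zero.2 hp)) ?_
  intro h0
  rw [Multiset.prod_eq_zero_iff, Multiset.mem_map] at h0
  obtain ⟨a, -, ha⟩ := h0
  exact (hx a).ne' ha

theorem AffPoint.disk_rad_pos (a : 𝕃) (r : ℝ) (hr : 0 < r) (b : 𝕃) :
    0 < (AffPoint.disk a r hr).rad b := by
  rw [AffPoint.disk_rad]
  exact lt_max_of_lt_left hr

theorem AffPoint.gauss_rad_pos (b : 𝕃) : 0 < (AffPoint.gauss : AffPoint 𝕃).rad b := by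
  rw [AffPoint.gauss_rad]
  exact lt_max_of_lt_left one_pos

theorem nearPt_rad_pos (ζ : OnePoint ℂ) (τ : ℝ) (b : 𝕃) : 0 < (nearPt ζ τ).rad b := by
  match ζ with
  | OnePoint.some _ => exact AffPoint.disk_rad_pos _ _ (Real.exp_pos _) _
  | OnePoint.infty => exact AffPoint.disk_rad_pos _ _ (Real.exp_pos _) _

/-- The distance of the image to `w` is the value of `h - w` at `x`. Positive distances keep
denominators from vanishing, and `p / q` need be neither reduced nor normalized. -/
theorem exists_berkMap_aff {x : AffPoint 𝕃} (hx : ∀ a, 0 < x.rad a) {h : RatFunc 𝕃} {p q : 𝕃[X]}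
    (hq : q ≠ 0) (hh : h = algebraMap 𝕃[X] (RatFunc 𝕃) p / algebraMap 𝕃[X] (RatFunc 𝕃) q) :
    ∃ y, berkMap h (.aff x) = .aff y ∧ ∀ w, y.rad w = x.sn (p - C w * q) / x.sn q := by
  have hd : x.sn h.denom ≠ 0 := AffPoint.sn_ne_zero_of_rad_pos hx h.denom_ne_zero
  refine ⟨x.push h hd, dif_neg hd, fun w => ?_⟩
  change x.ratVal (aeval h (X - C w)) = _
  rw [← x.ratVal_div _ _ (AffPoint.sn_ne_zero_of_rad_pos hx hq)]
  congr 1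
  have hq' : algebraMap 𝕃[X] (RatFunc 𝕃) q ≠ 0 :=
    (map_ne_zero_iff _ (RatFunc.algebraMap_injective 𝕃)).2 hq
  rw [map_sub, aeval_X, aeval_C, hh, map_sub, map_mul, sub_div, mul_div_cancel_right₀ _ hq']
  rw [RatFunc.algebraMap_C]
  rfl

section Action

variable {h g : RatFunc 𝕃} {c : 𝕃ˣ} {b : 𝕃} {P Q : intRing[X]}

theorem IsRep.eq_div_of_affine (hr : IsRep g P Q)
    (hh : h = RatFunc.C (c : 𝕃) * g + RatFunc.C b) :
    h = algebraMap 𝕃[X] (RatFunc 𝕃) (C (c : 𝕃) * toL P + C b * toL Q) /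
      algebraMap 𝕃[X] (RatFunc 𝕃) (toL Q) := by
  have hq' : algebraMap 𝕃[X] (RatFunc 𝕃) (toL Q) ≠ 0 :=
    (map_ne_zero_iff _ (RatFunc.algebraMap_injective 𝕃)).2 hr.den_ne
  rw [hh, hr.eq, map_add, map_mul, map_mul, RatFunc.algebraMap_C, RatFunc.algebraMap_C, add_div,
    mul_div_cancel_right₀ _ hq', mul_div_assoc]

theorem IsRep.exists_berkMap (hr : IsRep g P Q)
    (hh : h = RatFunc.C (c : 𝕃) * g + RatFunc.C b) {x : AffPoint 𝕃} (hx : ∀ a, 0 < x.rad a) :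
    ∃ y, berkMap h (.aff x) = .aff y ∧ ∀ w, y.rad (b + c * w) =
      ‖(c : 𝕃)‖ * (x.sn (toL P - C w * toL Q) / x.sn (toL Q)) := by
  obtain ⟨y, hy, hy'⟩ := exists_berkMap_aff hx hr.den_ne (hr.eq_div_of_affine hh)
  refine ⟨y, hy, fun w => ?_⟩
  rw [hy', ← mul_div_assoc, ← x.map_C, ← map_mul]
  congr 2
  simp only [C_add, C_mul]
  ring

theorem exists_coe_int {w : 𝕃} (hw : ‖w‖ ≤ 1) : ∃ a : intRing, (a : 𝕃) = w := ⟨⟨w, hw⟩, rfl⟩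

/-- The members of the pencil of `toL P` and `toL Q` are multiples of integral polynomials whose
reductions are the members of the pencil of the reductions. -/
theorem exists_lift_fiberPoly (P Q : intRing[X]) (w : OnePoint 𝕃) : ∃ (F : intRing[X]) (e : 𝕃),
    e ≠ 0 ∧ fiberPoly (toL P) (toL Q) w = C e * toL F ∧
      redPoly F = fiberPoly (redPoly P) (redPoly Q) (redPt w) := by
  match w with
  | OnePoint.infty => exact ⟨Q, 1, one_ne_zero, by simp [fiberPoly], rfl⟩
  | OnePoint.some w =>
    rcases le_or_gt ‖w‖ 1 with hw | hw
    · obtain ⟨a, rfl⟩ := exists_coe_int hw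
      refine ⟨P - C a * Q, 1, one_ne_zero, ?_, ?_⟩
      · simp [fiberPoly, toL_C]
      · rw [redPt_coe_int, map_sub, map_mul, redPoly_C]
        rfl
    -- For large `w`, division by `-w` turns the member into `Q - w⁻¹ P`, which reduces to the
    -- member at `∞`.
    · have hw0 : w ≠ 0 := fun h0 => by simp [h0] at hw; linarith
      have hi : ‖w⁻¹‖ < 1 := by
        rw [norm_inv]
        exact inv_lt_one_of_one_lt₀ hw
      refine ⟨Q - C ⟨w⁻¹, hi.le⟩ * P, -w, neg_ne_zero.2 hw0, ?_, ?_⟩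
      · rw [map_sub, map_mul, toL_C]
        have e : (C w * C w⁻¹ : 𝕃[X]) = 1 := by rw [← C_mul, mul_inv_cancel₀ hw0, C_1]
        simp only [fiberPoly, C_neg]
        linear_combination (-toL P) * e
      · rw [redPt_of_one_lt hw, map_sub, map_mul, redPoly_C, (redHom_eq_zero_iff _).2 hi, C_0,
          zero_mul, sub_zero]
        rfl

theorem nonDeg_toL (hn : NonDeg (redPoly P) (redPoly Q)) : NonDeg (toL P) (toL Q) := by
  intro w
  obtain ⟨F, e, he, h1, h2⟩ := exists_lift_fiberPoly P Q w
  rw [h1]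
  exact mul_ne_zero (C_ne_zero.2 he) (toL_ne_zero_of_red (by rw [h2]; exact hn _))

/-- Independence of the reductions gives `P - w Q` the Gauss norm `max 1 ‖w‖`, the distance of the
Gauss point to `w`. So `g` fixes the Gauss point and only the affine map moves it. -/
theorem IsRep.berkMap_gaussPt (hr : IsRep g P Q) (hn : NonDeg (redPoly P) (redPoly Q))
    (hh : h = RatFunc.C (c : 𝕃) * g + RatFunc.C b) : berkMap h gaussPt = diskPt c b := by
  obtain ⟨y, hy, hy'⟩ := hr.exists_berkMap hh AffPoint.gauss_rad_pos
  rw [gaussPt, hy, diskPt, AffPoint.ext_rad (x := y)]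
  intro a
  obtain ⟨w, rfl⟩ : ∃ w, a = b + c * w :=
    ⟨(a - b) / c, by rw [mul_div_cancel₀ _ c.ne_zero]; ring⟩
  rw [hy', AffPoint.disk_rad, (redPoly_ne_zero_iff Q).1 hn.den_ne, div_one, add_sub_cancel_left,
    norm_mul]
  suffices AffPoint.gauss.sn (toL P - C w * toL Q) = max 1 ‖w‖ by
    rw [this, mul_max_of_nonneg _ _ (norm_nonneg _), mul_one]
  rcases le_or_gt ‖w‖ 1 with hw | hw
  · obtain ⟨a, rfl⟩ := exists_coe_int hw
    rw [max_eq_left hw, ← toL_C, ← map_mul, ← map_sub, ← redPoly_ne_zero_iff, map_sub, map_mul,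
      redPoly_C]
    exact hn (OnePoint.some (redHom a))
  · have hw0 : w ≠ 0 := fun h0 => by simp [h0] at hw; linarith
    have hi : ‖w⁻¹‖ < 1 := by
      rw [norm_inv]
      exact inv_lt_one_of_one_lt₀ hw
    have e : toL P - C w * toL Q = C (-w) * toL (Q - C ⟨w⁻¹, hi.le⟩ * P) := by
      rw [map_sub, map_mul, toL_C]
      have e : (C w * C w⁻¹ : 𝕃[X]) = 1 := by rw [← C_mul, mul_inv_cancel₀ hw0, C_1]
      simp only [C_neg]
      linear_combination (-toL P) * e
    rw [e, map_mul, AffPoint.map_C, norm_neg, max_eq_right hw.le, (redPoly_ne_zero_iff _).1,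
      mul_one]
    rw [map_sub, map_mul, redPoly_C, (redHom_eq_zero_iff _).2 hi, C_0, zero_mul, sub_zero]
    exact hn.den_ne

/-- The Gauss point has distance one to every constant. The constant `0` shows that `P` and `Q` have
equal Gauss norms, hence norm one; the other constants exclude a vanishing member of the reduced
pencil. -/
theorem IsRep.nonDeg (hr : IsRep g P Q) (hG : berkMap g gaussPt = gaussPt) :
    NonDeg (redPoly P) (redPoly Q) := by
  obtain ⟨y, hy, hy'⟩ := exists_berkMap_aff AffPoint.gauss_rad_pos hr.den_ne hr.eq
  have hyG : y = AffPoint.gauss := by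
    rw [gaussPt] at hG
    rw [hy] at hG
    exact Berk.aff.inj hG
  subst hyG
  have hQ0 : AffPoint.gauss.sn (toL Q) ≠ 0 :=
    AffPoint.sn_ne_zero_of_rad_pos AffPoint.gauss_rad_pos hr.den_ne
  have h0 := hy' 0
  rw [AffPoint.gauss_rad, norm_zero, max_eq_left zero_le_one, C_0, zero_mul, sub_zero,
    eq_div_iff hQ0, one_mul] at h0
  have hQ : AffPoint.gauss.sn (toL Q) = 1 := by
    rcases hr.red_ne with h1 | h1
    · rw [h0]
      exact (redPoly_ne_zero_iff P).1 h1
    · exact (redPoly_ne_zero_iff Q).1 h1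
  intro w
  match w with
  | OnePoint.infty => exact (redPoly_ne_zero_iff Q).2 hQ
  | OnePoint.some ζ =>
    have h1 := hy' (liftC ζ)
    rw [AffPoint.gauss_rad, max_eq_left (liftC ζ).2, hQ, div_one, ← toL_C, ← map_mul, ← map_sub]
      at h1
    have h2 := (redPoly_ne_zero_iff _).2 h1.symm
    rw [map_sub, map_mul, redPoly_C, redHom_liftC] at h2
    exact h2

-- Along `nearPt ζ τ`, values behave like `exp (-τ n)`, with `n` a difference of orders in the
-- reduced pencil. The sign of `n` for `g - u`, or for `g` if `w = ∞`, decides the direction of the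
-- image.
open Filter Topology in
theorem IsRep.eventually_berkMap_nearPt (hr : IsRep g P Q) (hn : NonDeg (redPoly P) (redPoly Q))
    (hh : h = RatFunc.C (c : 𝕃) * g + RatFunc.C b) {ζ w : OnePoint ℂ}
    (hv : IsVal (redPoly P) (redPoly Q) ζ w) :
    ∀ᶠ τ in 𝓝[>] (0 : ℝ), berkMap h (.aff (nearPt ζ τ)) ∈ dirAt c b w := by
  have hpos : ∀ᶠ τ in 𝓝[>] (0 : ℝ), 0 < τ := self_mem_nhdsWithin
  have hc := norm_unit_pos c
  match w with
  | OnePoint.some u =>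
    have hfib : redPoly (P - C (liftC u) * Q) = redPoly P - C u * redPoly Q := by
      rw [map_sub, map_mul, redPoly_C, redHom_liftC]
    filter_upwards [hpos, eventually_sn_nearPt hn.den_ne ζ,
      eventually_sn_nearPt (F := P - C (liftC u) * Q) (by rw [hfib]; exact hn (OnePoint.some u)) ζ]
      with τ hτ hQ hF
    obtain ⟨y, hy, hy'⟩ := hr.exists_berkMap hh (nearPt_rad_pos ζ τ)
    refine ⟨y, hy, ?_⟩
    have e : constEmb u = (liftC u : 𝕃) := rfl
    rw [hy', e, ← toL_C, ← map_mul, ← map_sub, hQ, hF, hfib]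
    refine mul_lt_of_lt_one_right hc ((div_lt_one (Real.exp_pos _)).2 (Real.exp_lt_exp.2 ?_))
    have := hv.some_lt hn
    have h1 : (ordAt ζ (redPoly Q) : ℝ) < ordAt ζ (redPoly P - C u * redPoly Q) := by
      exact_mod_cast this
    nlinarith
  | OnePoint.infty =>
    filter_upwards [hpos, eventually_sn_nearPt hn.den_ne ζ, eventually_sn_nearPt hn.num_ne ζ]
      with τ hτ hQ hP
    obtain ⟨y, hy, hy'⟩ := hr.exists_berkMap hh (nearPt_rad_pos ζ τ)
    rw [hy]
    intro hle
    rw [diskPt, aff_le_disk_iff] at hle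
    have h1 := hy' 0
    rw [mul_zero, add_zero, C_0, zero_mul, sub_zero] at h1
    rw [h1, hP, hQ] at hle
    refine absurd hle (not_le.2 (lt_mul_of_one_lt_right hc
      ((one_lt_div (Real.exp_pos _)).2 (Real.exp_lt_exp.2 ?_))))
    have := hv.infty_lt
    have h1 : (ordAt ζ (redPoly P) : ℝ) < ordAt ζ (redPoly Q) := by
      exact_mod_cast this
    nlinarith

end Action

/-! ### Intervals issued from the Gauss point -/

theorem AffPoint.eq_disk_of_norm_sub_le {u : AffPoint 𝕃} {a : 𝕃} (h : ∀ w, ‖w - a‖ ≤ u.rad w)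
    (hpos : 0 < u.rad a) : u = .disk a (u.rad a) hpos := by
  refine AffPoint.ext_rad fun w => ?_
  rw [AffPoint.disk_rad]
  have h1 := u.rad_le_max w a
  have h2 := u.rad_le_max a w
  have h3 := h w
  rw [norm_sub_rev] at h2
  grind

theorem aff_nearPt_mem_dirAt (ζ : OnePoint ℂ) {τ : ℝ} (hτ : 0 < τ) :
    Berk.aff (nearPt ζ τ) ∈ dirAt 1 0 ζ := by
  match ζ with
  | OnePoint.some c =>
    refine ⟨_, rfl, ?_⟩
    rw [nearPt_some_rad]
    simpa using hτ
  | OnePoint.infty =>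
    intro hle
    rw [diskPt, aff_le_disk_iff] at hle
    rw [nearPt_infty_rad] at hle
    have : Real.exp τ ≤ 1 := by simpa using (max_le_iff.1 hle).1
    rw [Real.exp_le_one_iff] at this
    linarith

theorem gauss_le_aff_iff {u : AffPoint 𝕃} :
    (gaussPt : Berk 𝕃) ≤ .aff u ↔ ∀ a, max 1 ‖a‖ ≤ u.rad a := by
  rw [gaussPt, Berk.aff_le_aff]
  simp only [AffPoint.gauss_rad]

theorem aff_le_gauss_iff {u : AffPoint 𝕃} :
    Berk.aff u ≤ (gaussPt : Berk 𝕃) ↔ u.rad 0 ≤ 1 := by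
  rw [gaussPt, AffPoint.gauss_eq_disk, aff_le_disk_iff]

/-- A point of the interval is squeezed between two disks with a common centre, so it is itself a
disk around that centre. -/
theorem exists_nearPt_of_mem_interval {ζ : OnePoint ℂ} {τ₀ : ℝ} (hτ₀ : 0 < τ₀) {R : Berk 𝕃}
    (hR : R ∈ interval gaussPt (.aff (nearPt ζ τ₀))) (hne : R ≠ gaussPt) :
    ∃ τ, 0 < τ ∧ τ ≤ τ₀ ∧ R = .aff (nearPt ζ τ) := by
  rw [mem_interval_iff] at hR
  match ζ with
  | OnePoint.some c =>
    have hle : Berk.aff (nearPt (OnePoint.some c) τ₀) ≤ gaussPt := by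
      rw [gaussPt_eq_diskPt]
      exact dirAt_some_le (aff_nearPt_mem_dirAt _ hτ₀)
    rw [sup_eq_left.2 hle] at hR
    have h1 := hR.1.resolve_left fun h1 => hne (le_antisymm hR.2 h1)
    match R with
    | .infty => exact (Berk.not_infty_le _ hR.2).elim
    | .aff u =>
      have h2 := Berk.aff_le_aff.1 h1
      have h3 := Berk.aff_le_aff.1 hR.2
      simp only [nearPt_some_rad, max_le_iff] at h2
      simp only [AffPoint.gauss_rad] at h3
      have hpos : 0 < u.rad (constEmb c) := (Real.exp_pos _).trans_le (h2 _).1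
      have hu := AffPoint.eq_disk_of_norm_sub_le (fun w => (h2 w).2) hpos
      have hle1 : u.rad (constEmb c) ≤ 1 := (h3 _).trans (max_le le_rfl (norm_constEmb_le c))
      have hlt : u.rad (constEmb c) < 1 := by
        refine lt_of_le_of_ne hle1 fun e => hne ?_
        rw [gaussPt, AffPoint.ext_rad (x := u) (y := AffPoint.gauss)]
        intro a
        rw [hu, AffPoint.disk_rad, e, AffPoint.gauss_rad]
        exact max_norm_eq_of_norm_sub_le (by simpa using norm_constEmb_le c)
      refine ⟨-Real.log (u.rad (constEmb c)), by simpa using Real.log_neg hpos hlt, ?_, ?_⟩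
      · have := Real.log_le_log (Real.exp_pos _) (h2 (constEmb c)).1
        rw [Real.log_exp] at this
        linarith
      · conv_lhs => rw [hu]
        simp only [nearPt, neg_neg, Real.exp_log hpos]
  | OnePoint.infty =>
    have hG : gaussPt ≤ Berk.aff (nearPt OnePoint.infty τ₀) := by
      rw [gauss_le_aff_iff]
      intro a
      rw [nearPt_infty_rad]
      exact max_le_max (Real.one_le_exp hτ₀.le) le_rfl
    rw [sup_eq_right.2 hG] at hR
    have h1 : gaussPt ≤ R := hR.1.elim id hG.trans
    match R with
    | .infty => exact (Berk.not_infty_le _ hR.2).elim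
    | .aff u =>
      have h2 := gauss_le_aff_iff.1 h1
      have h3 := Berk.aff_le_aff.1 hR.2 0
      rw [nearPt_infty_rad, norm_zero, max_eq_left (Real.exp_pos _).le] at h3
      have hge : 1 ≤ u.rad 0 := (le_max_left _ _).trans (h2 0)
      have hpos : 0 < u.rad 0 := one_pos.trans_le hge
      have hu := AffPoint.eq_disk_of_norm_sub_le (u := u) (a := 0)
        (fun w => by rw [sub_zero]; exact (le_max_right _ _).trans (h2 w)) hpos
      have hlt : 1 < u.rad 0 := by
        refine lt_of_le_of_ne hge fun e => hne ?_
        rw [gaussPt, AffPoint.ext_rad (x := u) (y := AffPoint.gauss)]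
        intro a
        rw [hu, AffPoint.disk_rad, ← e, AffPoint.gauss_rad, sub_zero]
      refine ⟨Real.log (u.rad 0), Real.log_pos hlt, ?_, ?_⟩
      · have := Real.log_le_log hpos h3
        rwa [Real.log_exp] at this
      · conv_lhs => rw [hu]
        simp only [nearPt, Real.exp_log hpos]

-- All intervals issued from the Gauss point in one direction share their germ, so that a direction
-- can be tested on the path `nearPt ζ`.
open Filter Topology in
theorem eventually_nearPt_mem_interval {ζ : OnePoint ℂ} {T : Berk 𝕃} (hT : T ∈ dirAt 1 0 ζ) :
    ∀ᶠ τ in 𝓝[>] (0 : ℝ), Berk.aff (nearPt ζ τ) ∈ interval gaussPt T := by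
  have hpos : ∀ᶠ τ in 𝓝[>] (0 : ℝ), 0 < τ := self_mem_nhdsWithin
  match ζ with
  | OnePoint.some c =>
    have hTG := dirAt_some_le hT
    rw [← gaussPt_eq_diskPt] at hTG
    obtain ⟨u, rfl, hu⟩ := hT
    simp only [Units.val_one, zero_add, one_mul, norm_one] at hu
    have hexp' : Tendsto (fun τ : ℝ => Real.exp (-τ)) (𝓝[>] 0) (𝓝 1) := by
      have : Tendsto (fun τ : ℝ => Real.exp (-τ)) (𝓝 0) (𝓝 (Real.exp (-0))) :=
        (Real.continuous_exp.comp continuous_neg).continuousAt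
      rw [neg_zero, Real.exp_zero] at this
      exact this.mono_left nhdsWithin_le_nhds
    filter_upwards [hpos, hexp'.eventually (lt_mem_nhds hu)] with τ hτ hτu
    rw [mem_interval_iff, sup_eq_left.2 hTG]
    refine ⟨Or.inr (aff_le_disk_of_rad_le (Real.exp_pos _) hτu.le), ?_⟩
    rw [gaussPt_eq_diskPt]
    exact dirAt_some_le (aff_nearPt_mem_dirAt _ hτ)
  | OnePoint.infty =>
    have hT' : ¬ T ≤ gaussPt := by rw [gaussPt_eq_diskPt]; exact hT
    have hG : ∀ {τ : ℝ}, 0 < τ → gaussPt ≤ Berk.aff (nearPt OnePoint.infty τ) := by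
      intro τ hτ
      rw [gauss_le_aff_iff]
      intro a
      rw [nearPt_infty_rad]
      exact max_le_max (Real.one_le_exp hτ.le) le_rfl
    match T with
    | .infty =>
      filter_upwards [hpos] with τ hτ
      rw [mem_interval_iff, sup_eq_right.2 (Berk.le_infty _)]
      exact ⟨Or.inl (hG hτ), Berk.le_infty _⟩
    | .aff u =>
      rw [aff_le_gauss_iff, not_le] at hT'
      have hexp : Tendsto (fun τ : ℝ => Real.exp τ) (𝓝[>] 0) (𝓝 1) := by
        have : Tendsto (fun τ : ℝ => Real.exp τ) (𝓝 0) (𝓝 (Real.exp 0)) :=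
          Real.continuous_exp.continuousAt
        rw [Real.exp_zero] at this
        exact this.mono_left nhdsWithin_le_nhds
      filter_upwards [hpos, hexp.eventually (gt_mem_nhds hT')] with τ hτ hτu
      refine mem_interval_iff.2 ⟨Or.inl (hG hτ), ?_⟩
      obtain ⟨z, hz, hz'⟩ := Berk.exists_aff_sup (AffPoint.gauss (K := 𝕃)) u
      rw [gaussPt, hz, Berk.aff_le_aff]
      intro a
      rw [nearPt_infty_rad, hz', AffPoint.gauss_rad]
      have h1 := u.rad_le_max 0 a
      rw [zero_sub, norm_neg] at h1
      refine max_le (hτu.le.trans (h1.trans (max_le (le_max_right _ _) ?_))) ?_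
      · exact le_max_of_le_left (le_max_right _ _)
      · exact le_max_of_le_left (le_max_right _ _)

/-! ### Tangent map and preimage counts at the Gauss point -/

section Tangent

variable {h g : RatFunc 𝕃} {c : 𝕃ˣ} {b : 𝕃} {P Q : intRing[X]}

open Filter Topology in
/-- The tangent map at the Gauss point is given by the reduction. -/
theorem IsRep.dirMap_gauss (hr : IsRep g P Q) (hn : NonDeg (redPoly P) (redPoly Q))
    (hh : h = RatFunc.C (c : 𝕃) * g + RatFunc.C b) {ζ w : OnePoint ℂ}
    (hv : IsVal (redPoly P) (redPoly Q) ζ w) :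
    dirMap h gaussPt (dirAt 1 0 ζ) = dirAt c b w := by
  have hev := hr.eventually_berkMap_nearPt hn hh hv
  have hpos : ∀ᶠ τ in 𝓝[>] (0 : ℝ), 0 < τ := self_mem_nhdsWithin
  have hhG := hr.berkMap_gaussPt hn hh
  ext T
  constructor
  · rintro ⟨S₀, hS₀, hall⟩
    obtain ⟨τ, hτ0, hτ1, hτ2⟩ :=
      (hpos.and (hev.and (eventually_nearPt_mem_interval hS₀))).exists
    have := hall _ hτ2 (by rw [gaussPt_eq_diskPt]; exact ne_of_mem_dirAt (aff_nearPt_mem_dirAt ζ hτ0))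
    rwa [hhG, ← dirAt_eq_dir hτ1] at this
  -- For all `τ` in `(0, τ₀]` the image has the right direction, so `nearPt ζ τ₀` can serve as the
  -- end point in the definition of the tangent map.
  · intro hT
    obtain ⟨τ₀, hτ₀, hsub⟩ := mem_nhdsGT_iff_exists_Ioc_subset.1 hev
    refine ⟨.aff (nearPt ζ τ₀), aff_nearPt_mem_dirAt ζ hτ₀, fun S' hS' hne => ?_⟩
    obtain ⟨τ, h1, h2, rfl⟩ := exists_nearPt_of_mem_interval hτ₀ hS' hne
    rw [hhG, ← dirAt_eq_dir (hsub ⟨h1, h2⟩)]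
    exact hT

theorem mob_affCoord (c : 𝕃ˣ) (b : 𝕃) (w : OnePoint 𝕃) :
    mob (c : 𝕃) b 0 1 (affCoord c b w) = w := by
  match w with
  | OnePoint.infty => exact if_pos rfl
  | OnePoint.some a =>
    have h1 : (0 : 𝕃) * ((a - b) / c) + 1 ≠ 0 := by simp
    refine (if_neg h1).trans ?_
    rw [zero_mul, zero_add, div_one, mul_div_cancel₀ _ c.ne_zero, sub_add_cancel]

theorem IsRep.exists_num_denom_of_affine (hr : IsRep g P Q)
    (hh : h = RatFunc.C (c : 𝕃) * g + RatFunc.C b) :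
    ∃ u : 𝕃, u ≠ 0 ∧ C (c : 𝕃) * toL P + C b * toL Q = C u * h.num ∧
      C 0 * toL P + C 1 * toL Q = C u * h.denom := by
  have hdet : (c : 𝕃) * 1 - b * 0 ≠ 0 := by simp
  have hcop := isCoprime_change hdet hr.coprime
  have e : C 0 * toL P + C 1 * toL Q = toL Q := by simp
  rw [e] at hcop ⊢
  have := exists_num_denom_eq hcop hr.den_ne
  rwa [← hr.eq_div_of_affine hh] at this

theorem fiberPoly_C_mul {k : Type*} [Field k] (u : k) (p q : k[X]) (w : OnePoint k) :
    fiberPoly (C u * p) (C u * q) w = C u * fiberPoly p q w := by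
  match w with
  | OnePoint.some a => simp only [fiberPoly]; ring
  | OnePoint.infty => rfl

/-- The fibers of `h`, up to constants, are integral polynomials whose reductions are the fibers
of the reduction. -/
theorem IsRep.exists_fiberPoly_num_denom (hr : IsRep g P Q)
    (hh : h = RatFunc.C (c : 𝕃) * g + RatFunc.C b) (w : OnePoint 𝕃) :
    ∃ (F : intRing[X]) (e : 𝕃), e ≠ 0 ∧ fiberPoly h.num h.denom w = C e * toL F ∧
      redPoly F = fiberPoly (redPoly P) (redPoly Q) (redPt (affCoord c b w)) := by
  obtain ⟨u, hu, h1, h2⟩ := hr.exists_num_denom_of_affine hh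
  have hdet : (c : 𝕃) * 1 - b * 0 ≠ 0 := by simp
  obtain ⟨e, he, h3⟩ := exists_fiberPoly_mob (toL P) (toL Q) hdet (affCoord c b w)
  obtain ⟨F, e', he', h4, h5⟩ := exists_lift_fiberPoly P Q (affCoord c b w)
  rw [mob_affCoord, h1, h2, fiberPoly_C_mul, h4, ← mul_assoc, ← C_mul] at h3
  refine ⟨F, u⁻¹ * (e * e'), mul_ne_zero (inv_ne_zero hu) (mul_ne_zero he he'), ?_, h5⟩
  rw [C_mul, mul_assoc, ← h3, ← mul_assoc, ← C_mul, inv_mul_cancel₀ hu, C_1, one_mul]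

theorem IsRep.ratDeg_affine (hr : IsRep g P Q)
    (hh : h = RatFunc.C (c : 𝕃) * g + RatFunc.C b) : ratDeg h = ratDeg g := by
  obtain ⟨u, hu, h1, h2⟩ := hr.exists_num_denom_of_affine hh
  have hdet : (c : 𝕃) * 1 - b * 0 ≠ 0 := by simp
  have := max_natDegree_change (p := toL P) (q := toL Q) hdet
  rwa [h1, h2, natDegree_C_mul hu, natDegree_C_mul hu, ← hr.ratDeg_eq] at this

theorem IsRep.nonDeg_num_denom (hr : IsRep g P Q) (hn : NonDeg (redPoly P) (redPoly Q))
    (hh : h = RatFunc.C (c : 𝕃) * g + RatFunc.C b) : NonDeg h.num h.denom := by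
  intro w
  obtain ⟨F, e, he, h1, h2⟩ := hr.exists_fiberPoly_num_denom hh w
  rw [h1]
  exact mul_ne_zero (C_ne_zero.2 he) (toL_ne_zero_of_red (by rw [h2]; exact hn _))

/-- The number of solutions of `h = w` in a direction at the Gauss point. -/
theorem IsRep.solCount_dirAt (hr : IsRep g P Q) (hn : NonDeg (redPoly P) (redPoly Q))
    (hh : h = RatFunc.C (c : 𝕃) * g + RatFunc.C b) (w : OnePoint 𝕃) (ζ : OnePoint ℂ) :
    (solCount h w (dirAt 1 0 ζ) : ℤ) =
      ordAt ζ (fiberPoly (redPoly P) (redPoly Q) (redPt (affCoord c b w))) +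
        inftyDeg (ratDeg h) ζ := by
  classical
  obtain ⟨F, e, he, h1, h2⟩ := hr.exists_fiberPoly_num_denom hh w
  have hF : redPoly F ≠ 0 := by rw [h2]; exact hn _
  have hN : (toL F).natDegree ≤ ratDeg h := by
    have := natDegree_fiberPoly_le h.num h.denom w
    rwa [h1, natDegree_C_mul he] at this
  rw [← h2, ← card_roots_class hF hN ζ]
  have := finsum_localDegP1 (RatFunc.isCoprime_num_denom h) (hr.nonDeg_num_denom hn hh) w
    {z | classicalPt z ∈ dirAt 1 0 ζ}
  simp only [Set.mem_ofPred_eq, classicalPt_mem_dirAt_gauss_iff, h1, roots_C_mul _ he,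
    natDegree_C_mul he] at this
  rw [solCount]
  simp only [Set.mem_ofPred_eq, classicalPt_mem_dirAt_gauss_iff]
  rw [this, redPt_infty, Nat.cast_add]
  rfl

end Tangent

/-! ### Composition with Möbius transformations -/

theorem num_eq_of_ratDeg_le_one {k : Type*} [Field k] {A : RatFunc k} (hA : ratDeg A ≤ 1) :
    A.num = C (A.num.coeff 1) * X + C (A.num.coeff 0) :=
  eq_X_add_C_of_natDegree_le_one ((le_max_left _ _).trans hA)

theorem denom_eq_of_ratDeg_le_one {k : Type*} [Field k] {A : RatFunc k} (hA : ratDeg A ≤ 1) :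
    A.denom = C (A.denom.coeff 1) * X + C (A.denom.coeff 0) :=
  eq_X_add_C_of_natDegree_le_one ((le_max_right _ _).trans hA)

theorem mobius_det_ne_zero {k : Type*} [Field k] {A : RatFunc k} (hA : ratDeg A = 1) :
    A.num.coeff 1 * A.denom.coeff 0 - A.num.coeff 0 * A.denom.coeff 1 ≠ 0 := by
  intro h0
  obtain ⟨u, v, huv⟩ := RatFunc.isCoprime_num_denom A
  have h1 := num_eq_of_ratDeg_le_one hA.le
  have h2 := denom_eq_of_ratDeg_le_one hA.le
  set a₁ := A.num.coeff 1
  set a₀ := A.num.coeff 0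
  set b₁ := A.denom.coeff 1
  set b₀ := A.denom.coeff 0
  have h0' : C a₁ * C b₀ - C a₀ * C b₁ = (0 : k[X]) := by
    rw [← C_mul, ← C_mul, ← C_sub, h0, C_0]
  have hor : a₁ ≠ 0 ∨ b₁ ≠ 0 := by
    by_contra! h
    rw [h.1, C_0, zero_mul, zero_add] at h1
    rw [h.2, C_0, zero_mul, zero_add] at h2
    have : ratDeg A = 0 := by
      rw [ratDeg, h1, h2, natDegree_C, natDegree_C, max_self]
    omega
  rcases hor with h | h
  · have hroot := congrArg (eval (-(a₀ / a₁))) huv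
    have e1 : A.num.eval (-(a₀ / a₁)) = 0 := by
      rw [h1]
      simp only [eval_add, eval_mul, eval_C, eval_X]
      field_simp
      ring
    have e2 : A.denom.eval (-(a₀ / a₁)) = 0 := by
      rw [h2]
      simp only [eval_add, eval_mul, eval_C, eval_X]
      field_simp
      linear_combination h0
    simp [e1, e2] at hroot
  · have hroot := congrArg (eval (-(b₀ / b₁))) huv
    have e1 : A.num.eval (-(b₀ / b₁)) = 0 := by
      rw [h1]
      simp only [eval_add, eval_mul, eval_C, eval_X]
      field_simp
      linear_combination -h0
    have e2 : A.denom.eval (-(b₀ / b₁)) = 0 := by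
      rw [h2]
      simp only [eval_add, eval_mul, eval_C, eval_X]
      field_simp
      ring
    simp [e1, e2] at hroot

section Compose

variable {f g B : RatFunc 𝕃} {c : 𝕃ˣ} {b : 𝕃} {P Q : intRing[X]}

theorem IsRep.ratComp_eq (hr : IsRep g P Q) (hf : f = RatFunc.C (c : 𝕃) * g + RatFunc.C b)
    (hB : ratDeg B ≤ 1) : ratComp B f =
      algebraMap 𝕃[X] (RatFunc 𝕃) (C (B.num.coeff 1 * c) * toL P +
        C (B.num.coeff 1 * b + B.num.coeff 0) * toL Q) /
      algebraMap 𝕃[X] (RatFunc 𝕃) (C (B.denom.coeff 1 * c) * toL P +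
        C (B.denom.coeff 1 * b + B.denom.coeff 0) * toL Q) := by
  have hq' : algebraMap 𝕃[X] (RatFunc 𝕃) (toL Q) ≠ 0 :=
    (map_ne_zero_iff _ (RatFunc.algebraMap_injective 𝕃)).2 hr.den_ne
  have key : ∀ s t : 𝕃, RatFunc.C s * f + RatFunc.C t =
      algebraMap 𝕃[X] (RatFunc 𝕃) (C (s * c) * toL P + C (s * b + t) * toL Q) /
        algebraMap 𝕃[X] (RatFunc 𝕃) (toL Q) := by
    intro s t
    rw [eq_div_iff hq', hr.eq_div_of_affine hf, add_mul, mul_assoc, div_mul_cancel₀ _ hq']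
    simp only [map_add, map_mul, RatFunc.algebraMap_C]
    ring
  have e1 : B.num.eval₂ RatFunc.C f = RatFunc.C (B.num.coeff 1) * f + RatFunc.C (B.num.coeff 0) := by
    conv_lhs => rw [num_eq_of_ratDeg_le_one hB]
    simp
  have e2 : B.denom.eval₂ RatFunc.C f =
      RatFunc.C (B.denom.coeff 1) * f + RatFunc.C (B.denom.coeff 0) := by
    conv_lhs => rw [denom_eq_of_ratDeg_le_one hB]
    simp
  rw [ratComp, RatFunc.eval, e1, e2, key, key, div_div_div_cancel_right₀ hq']

theorem IsRep.mobius {k : RatFunc 𝕃} (hr : IsRep g P Q) (hn : NonDeg (toL P) (toL Q))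
    {α β γ δ : intRing} (hdet : ((α * δ - β * γ : intRing) : 𝕃) ≠ 0)
    (hred : redPoly (C α * P + C β * Q) ≠ 0 ∨ redPoly (C γ * P + C δ * Q) ≠ 0)
    (hk : k = algebraMap 𝕃[X] (RatFunc 𝕃) (toL (C α * P + C β * Q)) /
      algebraMap 𝕃[X] (RatFunc 𝕃) (toL (C γ * P + C δ * Q))) :
    IsRep k (C α * P + C β * Q) (C γ * P + C δ * Q) where
  coprime := by
    simp only [map_add, map_mul, toL_C]
    exact isCoprime_change (by push_cast at hdet; exact hdet) hr.coprime
  den_ne := by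
    simp only [map_add, map_mul, toL_C]
    refine hn.comb_ne ?_
    by_contra! h0
    push_cast at hdet
    simp [h0.1, h0.2] at hdet
  eq := hk
  red_ne := hred

theorem toL_comb (α β : intRing) (P Q : intRing[X]) :
    toL (C α * P + C β * Q) = C (α : 𝕃) * toL P + C (β : 𝕃) * toL Q := by
  simp only [map_add, map_mul, toL_C]

theorem redPoly_comb (α β : intRing) (P Q : intRing[X]) :
    redPoly (C α * P + C β * Q) = C (redHom α) * redPoly P + C (redHom β) * redPoly Q := by
  simp only [map_add, map_mul, redPoly_C]

/-- Division of a matrix by a coefficient of maximal absolute value. -/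
theorem exists_normalized_matrix {α₀ β₀ γ₀ δ₀ : 𝕃} (hdet : α₀ * δ₀ - β₀ * γ₀ ≠ 0) :
    ∃ (e : 𝕃) (α β γ δ : intRing), e ≠ 0 ∧ α₀ = e * α ∧ β₀ = e * β ∧ γ₀ = e * γ ∧ δ₀ = e * δ ∧
      (redHom α ≠ 0 ∨ redHom β ≠ 0 ∨ redHom γ ≠ 0 ∨ redHom δ ≠ 0) := by
  obtain ⟨e, he, hmem⟩ : ∃ e : 𝕃, (‖α₀‖ ≤ ‖e‖ ∧ ‖β₀‖ ≤ ‖e‖ ∧ ‖γ₀‖ ≤ ‖e‖ ∧ ‖δ₀‖ ≤ ‖e‖) ∧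
      (α₀ = e ∨ β₀ = e ∨ γ₀ = e ∨ δ₀ = e) := by
    have hx : ∃ x : 𝕃, (‖α₀‖ ≤ ‖x‖ ∧ ‖β₀‖ ≤ ‖x‖) ∧ (α₀ = x ∨ β₀ = x) := by
      rcases le_total ‖α₀‖ ‖β₀‖ with h | h
      · exact ⟨β₀, ⟨h, le_rfl⟩, Or.inr rfl⟩
      · exact ⟨α₀, ⟨le_rfl, h⟩, Or.inl rfl⟩
    have hy : ∃ x : 𝕃, (‖γ₀‖ ≤ ‖x‖ ∧ ‖δ₀‖ ≤ ‖x‖) ∧ (γ₀ = x ∨ δ₀ = x) := by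
      rcases le_total ‖γ₀‖ ‖δ₀‖ with h | h
      · exact ⟨δ₀, ⟨h, le_rfl⟩, Or.inr rfl⟩
      · exact ⟨γ₀, ⟨le_rfl, h⟩, Or.inl rfl⟩
    obtain ⟨x, ⟨h1, h2⟩, h3⟩ := hx
    obtain ⟨y, ⟨h4, h5⟩, h6⟩ := hy
    rcases le_total ‖x‖ ‖y‖ with h | h
    · exact ⟨y, ⟨h1.trans h, h2.trans h, h4, h5⟩, Or.inr (Or.inr h6)⟩
    · exact ⟨x, ⟨h1, h2, h4.trans h, h5.trans h⟩, h3.elim Or.inl fun h => Or.inr (Or.inl h)⟩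
  have he0 : e ≠ 0 := by
    intro h0
    rw [h0, norm_zero] at he
    simp [norm_le_zero_iff.1 he.1, norm_le_zero_iff.1 he.2.1] at hdet
  have hint : ∀ x : 𝕃, ‖x‖ ≤ ‖e‖ → ‖x / e‖ ≤ 1 := fun x hx => by
    rw [norm_div]
    exact div_le_one_of_le₀ hx (norm_nonneg _)
  have hunit : ∀ (x : 𝕃) (hx : ‖x‖ ≤ ‖e‖), x = e → redHom ⟨x / e, hint x hx⟩ ≠ 0 := by
    rintro x hx rfl
    rw [redHom_ne_zero_iff]
    simp [div_self he0]
  refine ⟨e, ⟨α₀ / e, hint _ he.1⟩, ⟨β₀ / e, hint _ he.2.1⟩, ⟨γ₀ / e, hint _ he.2.2.1⟩,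
    ⟨δ₀ / e, hint _ he.2.2.2⟩, he0, (mul_div_cancel₀ _ he0).symm, (mul_div_cancel₀ _ he0).symm,
    (mul_div_cancel₀ _ he0).symm, (mul_div_cancel₀ _ he0).symm, ?_⟩
  rcases hmem with h | h | h | h
  · exact Or.inl (hunit _ he.1 h)
  · exact Or.inr (Or.inl (hunit _ he.2.1 h))
  · exact Or.inr (Or.inr (Or.inl (hunit _ he.2.2.1 h)))
  · exact Or.inr (Or.inr (Or.inr (hunit _ he.2.2.2 h)))

theorem algebraMap_div_scale {e : 𝕃} (he : e ≠ 0) (p q : 𝕃[X]) :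
    algebraMap 𝕃[X] (RatFunc 𝕃) (C e * p) / algebraMap 𝕃[X] (RatFunc 𝕃) (C e * q) =
      algebraMap 𝕃[X] (RatFunc 𝕃) p / algebraMap 𝕃[X] (RatFunc 𝕃) q := by
  rw [map_mul, map_mul, mul_div_mul_left]
  exact (map_ne_zero_iff _ (RatFunc.algebraMap_injective 𝕃)).2 (C_ne_zero.2 he)

/-- A Möbius transformation of `g` that fixes the Gauss point is given by a matrix in
`GL₂` of the valuation ring. -/
theorem IsRep.exists_unimodular (hr : IsRep g P Q) (hn : NonDeg (redPoly P) (redPoly Q))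
    (hf : f = RatFunc.C (c : 𝕃) * g + RatFunc.C b) (hB : ratDeg B = 1)
    (hG : berkMap (ratComp B f) gaussPt = gaussPt) :
    ∃ α β γ δ : intRing, redHom α * redHom δ - redHom β * redHom γ ≠ 0 ∧
      IsRep (ratComp B f) (C α * P + C β * Q) (C γ * P + C δ * Q) := by
  have hdet : B.num.coeff 1 * c * (B.denom.coeff 1 * b + B.denom.coeff 0) -
      (B.num.coeff 1 * b + B.num.coeff 0) * (B.denom.coeff 1 * c) ≠ 0 := by
    have := mul_ne_zero c.ne_zero (mobius_det_ne_zero hB)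
    intro h0
    exact this (by linear_combination h0)
  obtain ⟨e, α, β, γ, δ, he, h1, h2, h3, h4, hor⟩ := exists_normalized_matrix hdet
  have hcomp := hr.ratComp_eq hf hB.le
  rw [h1, h2, h3, h4] at hcomp
  have e1 : ∀ x y : intRing, C (e * (x : 𝕃)) * toL P + C (e * (y : 𝕃)) * toL Q =
      C e * toL (C x * P + C y * Q) := by
    intro x y
    rw [toL_comb, C_mul, C_mul]
    ring
  rw [e1, e1, algebraMap_div_scale he] at hcomp
  have hrep : IsRep (ratComp B f) (C α * P + C β * Q) (C γ * P + C δ * Q) := by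
    refine hr.mobius (nonDeg_toL hn) ?_ ?_ hcomp
    · rw [h1, h2, h3, h4] at hdet
      push_cast
      intro h0
      exact hdet (by linear_combination e ^ 2 * h0)
    · rw [redPoly_comb, redPoly_comb]
      rcases hor with h | h | h | h
      · exact Or.inl (hn.comb_ne (Or.inl h))
      · exact Or.inl (hn.comb_ne (Or.inr h))
      · exact Or.inr (hn.comb_ne (Or.inl h))
      · exact Or.inr (hn.comb_ne (Or.inr h))
  refine ⟨α, β, γ, δ, fun h0 => ?_, hrep⟩
  have hn' := hrep.nonDeg hG
  rw [redPoly_comb, redPoly_comb] at hn'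
  -- If the reduced matrix were singular, its rows would satisfy a linear relation with coefficients
  -- taken from one of its columns. Then `B ∘ f` would have a degenerate reduction, although it
  -- fixes the Gauss point.
  have h0' : (C (redHom α) * C (redHom δ) - C (redHom β) * C (redHom γ) : ℂ[X]) = 0 := by
    rw [← C_mul, ← C_mul, ← C_sub, h0, C_0]
  by_cases hz : redHom γ ≠ 0 ∨ redHom α ≠ 0
  · refine hn'.comb_ne (a := redHom γ) (b := -redHom α) (hz.imp id (by simp)) ?_
    rw [C_neg]
    linear_combination (-redPoly Q) * h0'
  · push Not at hz
    by_cases hz' : redHom δ ≠ 0 ∨ redHom β ≠ 0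
    · refine hn'.comb_ne (a := redHom δ) (b := -redHom β) (hz'.imp id (by simp)) ?_
      rw [C_neg]
      linear_combination (redPoly P) * h0'
    · push Not at hz'
      simp [hz.1, hz.2, hz'.1, hz'.2] at hor

/-! ### The seminorms of linear combinations -/

/-- Independent reductions make `toL P` and `toL Q` orthonormal for the Gauss norm: after division
by the larger coefficient, the combination has a nonzero reduction. -/
theorem gauss_comb (hn : NonDeg (redPoly P) (redPoly Q)) (s t : 𝕃) :
    AffPoint.gauss.sn (C s * toL P + C t * toL Q) = max ‖s‖ ‖t‖ := by
  have key : ∀ (P Q : intRing[X]) (s t : 𝕃), (∀ w : ℂ, redPoly P + C w * redPoly Q ≠ 0) →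
      ‖t‖ ≤ ‖s‖ → AffPoint.gauss.sn (C s * toL P + C t * toL Q) = ‖s‖ := by
    intro P Q s t hPQ hst
    by_cases hs : s = 0
    · subst hs
      rw [norm_zero] at hst
      simp [norm_le_zero_iff.1 hst]
    have hq : ‖t / s‖ ≤ 1 := by
      rw [norm_div]
      exact div_le_one_of_le₀ hst (norm_nonneg _)
    have e : C s * toL P + C t * toL Q = C s * toL (P + C ⟨t / s, hq⟩ * Q) := by
      rw [map_add, map_mul, toL_C, mul_add, ← mul_assoc, ← C_mul]
      congr 3
      exact (mul_div_cancel₀ _ hs).symm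
    rw [e, map_mul, AffPoint.map_C, (redPoly_ne_zero_iff _).1, mul_one]
    rw [map_add, map_mul, redPoly_C]
    exact hPQ _
  rcases le_total ‖t‖ ‖s‖ with h | h
  · rw [max_eq_left h]
    refine key P Q s t (fun w h0 => ?_) h
    exact hn.comb_ne (a := 1) (b := w) (Or.inl one_ne_zero) (by simpa using h0)
  · rw [max_eq_right h, add_comm]
    refine key Q P t s (fun w h0 => ?_) h
    exact hn.comb_ne (a := w) (b := 1) (Or.inr one_ne_zero) (by rw [C_1, one_mul, add_comm]; exact h0)

theorem disk_sn_linear (a : 𝕃) (r : ℝ) (hr : 0 < r) (s t : 𝕃) :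
    (AffPoint.disk a r hr).sn (C s * X + C t) = max (‖s‖ * r) ‖s * a + t‖ := by
  by_cases hs : s = 0
  · simp [hs, AffPoint.map_C]
  · have e : C s * X + C t = C s * (X - C (-(t / s))) := by
      rw [mul_sub, ← C_mul, mul_neg, mul_div_cancel₀ _ hs, C_neg]
      ring
    rw [e, map_mul, AffPoint.map_C]
    change _ * (AffPoint.disk a r hr).rad _ = _
    rw [AffPoint.disk_rad, mul_max_of_nonneg _ _ (norm_nonneg _), ← norm_mul,
      show s * (-(t / s) - a) = -(s * a + t) by field_simp; ring, norm_neg]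

/-- Functoriality is needed at the Gauss point only. A linear form at the disk point has the same
value as the corresponding combination of `P` and `Q` at the Gauss point, so both images have the
same distances. -/
theorem IsRep.berkMap_ratComp (hr : IsRep g P Q) (hn : NonDeg (redPoly P) (redPoly Q))
    (hf : f = RatFunc.C (c : 𝕃) * g + RatFunc.C b) (hB : ratDeg B = 1) :
    berkMap B (berkMap f gaussPt) = berkMap (ratComp B f) gaussPt := by
  rw [hr.berkMap_gaussPt hn hf]
  have hnL := nonDeg_toL hn
  have hdet := mobius_det_ne_zero hB
  have hden : C (B.denom.coeff 1 * c) * toL P +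
      C (B.denom.coeff 1 * b + B.denom.coeff 0) * toL Q ≠ 0 := by
    refine hnL.comb_ne ?_
    by_contra! h0
    have h1 : B.denom.coeff 1 = 0 := (mul_eq_zero.1 h0.1).resolve_right c.ne_zero
    have h2 := h0.2
    rw [h1, zero_mul, zero_add] at h2
    simp [h1, h2] at hdet
  obtain ⟨y, hy, hy'⟩ := exists_berkMap_aff (h := B)
    (AffPoint.disk_rad_pos b ‖(c : 𝕃)‖ (norm_unit_pos c))
    B.denom_ne_zero (RatFunc.num_div_denom B).symm
  obtain ⟨z, hz, hz'⟩ := exists_berkMap_aff AffPoint.gauss_rad_pos hden (hr.ratComp_eq hf hB.le)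
  rw [diskPt, gaussPt, hy, hz, AffPoint.ext_rad (x := y) (y := z)]
  have key : ∀ s t : 𝕃, (AffPoint.disk b ‖(c : 𝕃)‖ (norm_unit_pos c)).sn (C s * X + C t) =
      AffPoint.gauss.sn (C (s * c) * toL P + C (s * b + t) * toL Q) := by
    intro s t
    rw [disk_sn_linear, gauss_comb hn, norm_mul]
  intro w
  rw [hy', hz', denom_eq_of_ratDeg_le_one hB.le, num_eq_of_ratDeg_le_one hB.le]
  simp only [coeff_add, coeff_C_mul, coeff_X_one, coeff_X_zero, mul_one, mul_zero, zero_add,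
    coeff_C_zero, coeff_C_succ, add_zero]
  rw [key]
  congr 1
  rw [show C (B.num.coeff 1) * X + C (B.num.coeff 0) -
    C w * (C (B.denom.coeff 1) * X + C (B.denom.coeff 0)) =
    C (B.num.coeff 1 - w * B.denom.coeff 1) * X + C (B.num.coeff 0 - w * B.denom.coeff 0) by
      simp only [C_sub, C_mul]; ring, key]
  congr 1
  simp only [C_sub, C_mul, C_add]
  ring

end Compose

/-! ### Reductions of integral representatives -/

section Reduction

variable {k g : RatFunc 𝕃} {P Q : intRing[X]}

theorem IsRep.red_facts (hr : IsRep k P Q) : ∃ e : ℂ, e ≠ 0 ∧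
    (∀ w, fiberPoly (redPoly P) (redPoly Q) w = C e * fiberPoly (redNum k) (redDen k) w) ∧
    ∀ ζ, baseOrd ζ (redPoly P) (redPoly Q) = baseOrd ζ (redNum k) (redDen k) := by
  obtain ⟨e, he, h1, h2⟩ := hr.exists_red
  refine ⟨e, he, fun w => by rw [h1, h2, fiberPoly_C_mul], fun ζ => ?_⟩
  rw [h1, h2, baseOrd, ordAt_C_mul ζ he, ordAt_C_mul ζ he]
  rfl

theorem IsRep.nonDeg_red_iff (hr : IsRep k P Q) :
    NonDeg (redNum k) (redDen k) ↔ NonDeg (redPoly P) (redPoly Q) := by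
  obtain ⟨e, he, h1, -⟩ := hr.red_facts
  refine forall_congr' fun w => ?_
  rw [h1, Ne, Ne, mul_eq_zero, not_or]
  simp [he]

theorem IsRep.ordAt_fiber (hr : IsRep k P Q) (ζ w : OnePoint ℂ) :
    ordAt ζ (fiberPoly (redNum k) (redDen k) w) =
      ordAt ζ (fiberPoly (redPoly P) (redPoly Q) w) := by
  obtain ⟨e, he, h1, -⟩ := hr.red_facts
  rw [h1, ordAt_C_mul ζ he]

theorem IsRep.baseOrd_red (hr : IsRep k P Q) (ζ : OnePoint ℂ) :
    baseOrd ζ (redNum k) (redDen k) = baseOrd ζ (redPoly P) (redPoly Q) := by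
  obtain ⟨e, he, -, h1⟩ := hr.red_facts
  exact (h1 ζ).symm

theorem IsRep.isVal_iff (hr : IsRep k P Q) {ζ w : OnePoint ℂ} :
    IsVal (redNum k) (redDen k) ζ w ↔ IsVal (redPoly P) (redPoly Q) ζ w := by
  rw [IsVal, IsVal, hr.ordAt_fiber, hr.baseOrd_red]

theorem IsRep.exists_isVal (hr : IsRep k P Q) (hn : NonDeg (redPoly P) (redPoly Q))
    (ζ : OnePoint ℂ) : ∃ w, IsVal (redPoly P) (redPoly Q) ζ w :=
  ⟨phi k ζ, hr.isVal_iff.1 (isVal_phi (hr.nonDeg_red_iff.2 hn) ζ)⟩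

/-- The reduction of a Möbius transformation of `g` with good reduction. -/
structure IsUnimodular (k : RatFunc 𝕃) (P Q : intRing[X]) (α β γ δ : intRing) : Prop where
  det_ne : redHom α * redHom δ - redHom β * redHom γ ≠ 0
  rep : IsRep k (C α * P + C β * Q) (C γ * P + C δ * Q)

variable {α β γ δ : intRing}

theorem IsUnimodular.nonDeg_iff (hu : IsUnimodular k P Q α β γ δ) :
    NonDeg (redNum k) (redDen k) ↔ NonDeg (redPoly P) (redPoly Q) := by
  rw [hu.rep.nonDeg_red_iff, redPoly_comb, redPoly_comb, nonDeg_change hu.det_ne]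

theorem IsUnimodular.baseOrd_eq (hu : IsUnimodular k P Q α β γ δ)
    (hn : NonDeg (redPoly P) (redPoly Q)) (ζ : OnePoint ℂ) :
    baseOrd ζ (redNum k) (redDen k) = baseOrd ζ (redPoly P) (redPoly Q) := by
  rw [hu.rep.baseOrd_red, redPoly_comb, redPoly_comb, hn.baseOrd_change hu.det_ne]

theorem IsUnimodular.phi_eq (hu : IsUnimodular k P Q α β γ δ)
    (hn : NonDeg (redPoly P) (redPoly Q)) {ζ w : OnePoint ℂ}
    (hv : IsVal (redPoly P) (redPoly Q) ζ w) :
    phi k ζ = mob (redHom α) (redHom β) (redHom γ) (redHom δ) w := by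
  have hnk := hu.nonDeg_iff.2 hn
  refine (isVal_phi hnk ζ).unique hnk ?_
  rw [hu.rep.isVal_iff, redPoly_comb, redPoly_comb, hn.isVal_change hu.det_ne]
  exact hv

theorem IsUnimodular.phiDeg_eq (hu : IsUnimodular k P Q α β γ δ)
    (hn : NonDeg (redPoly P) (redPoly Q)) {ζ w : OnePoint ℂ}
    (hv : IsVal (redPoly P) (redPoly Q) ζ w) :
    (phiDeg k ζ : ℤ) = ordAt ζ (fiberPoly (redPoly P) (redPoly Q) w) -
      baseOrd ζ (redPoly P) (redPoly Q) := by
  have hnk := hu.nonDeg_iff.2 hn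
  rw [DegBerk.phiDeg_eq hnk, hu.baseOrd_eq hn, hu.phi_eq hn hv, hu.rep.ordAt_fiber, redPoly_comb,
    redPoly_comb]
  obtain ⟨e, he, h1⟩ := exists_fiberPoly_mob (redPoly P) (redPoly Q) hu.det_ne w
  rw [h1, ordAt_C_mul ζ he]

theorem IsUnimodular.det_coe_ne (hu : IsUnimodular k P Q α β γ δ) :
    (α : 𝕃) * δ - β * γ ≠ 0 := by
  intro h0
  have h1 : α * δ - β * γ = 0 := Subtype.ext (by push_cast; exact h0)
  apply hu.det_ne
  rw [← map_mul, ← map_mul, ← map_sub, h1, map_zero]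

theorem IsUnimodular.ratDeg_eq (hu : IsUnimodular k P Q α β γ δ) :
    ratDeg k = max (toL P).natDegree (toL Q).natDegree := by
  rw [hu.rep.ratDeg_eq, toL_comb, toL_comb, max_natDegree_change hu.det_coe_ne]

theorem IsUnimodular.ordH_eq (hu : IsUnimodular k P Q α β γ δ)
    (hn : NonDeg (redPoly P) (redPoly Q)) (ζ : OnePoint ℂ) :
    (ordH k ζ : ℤ) = baseOrd ζ (redPoly P) (redPoly Q) +
      inftyDeg (max (toL P).natDegree (toL Q).natDegree) ζ := by
  rw [DegBerk.ordH_eq (hu.nonDeg_iff.2 hn), hu.baseOrd_eq hn, hu.ratDeg_eq]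

end Reduction

/-! ### The Möbius transformation `A` -/

/-- The image under a constant map has distance zero to the constant, unlike the Gauss point. This
excludes the degenerate cases for `A` and `f`. -/
theorem berkMap_C_gaussPt_ne (k : 𝕃) : berkMap (RatFunc.C k) gaussPt ≠ gaussPt := by
  intro h
  obtain ⟨y, hy, hy'⟩ := exists_berkMap_aff (h := RatFunc.C k) (p := C k) (q := 1)
    AffPoint.gauss_rad_pos one_ne_zero (by simp)
  rw [gaussPt, hy] at h
  injection h with h
  have h1 := hy' k
  rw [h, mul_one, sub_self, map_zero, zero_div] at h1
  exact (AffPoint.gauss_rad_pos k).ne' h1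

theorem ratComp_C_left {F : Type*} [Field F] (k : F) (f : RatFunc F) :
    ratComp (RatFunc.C k) f = RatFunc.C k := by
  rw [ratComp, RatFunc.eval_C]

theorem ratComp_C_right {F : Type*} [Field F] (A : RatFunc F) (k : F) :
    ratComp A (RatFunc.C k) = RatFunc.C (A.num.eval k / A.denom.eval k) := by
  rw [ratComp, RatFunc.eval, eval₂_at_apply, eval₂_at_apply, map_div₀]

theorem ratComp_X {F : Type*} [Field F] (A : RatFunc F) : ratComp A RatFunc.X = A := by
  have key : ∀ p : F[X], p.eval₂ RatFunc.C RatFunc.X = algebraMap F[X] (RatFunc F) p := by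
    intro p
    rw [← RatFunc.algebraMap_X, ← RatFunc.algebraMap_comp_C, ← hom_eval₂, eval₂_C_X]
  rw [ratComp, RatFunc.eval, key, key, RatFunc.num_div_denom]

theorem eq_C_of_ratDeg_eq_zero {F : Type*} [Field F] {A : RatFunc F} (h : ratDeg A = 0) :
    ∃ k, A = RatFunc.C k := by
  have h1 : A.num.natDegree = 0 := Nat.le_zero.1 (h ▸ le_max_left _ _)
  have h2 : A.denom.natDegree = 0 := Nat.le_zero.1 (h ▸ le_max_right _ _)
  refine ⟨A.num.coeff 0 / A.denom.coeff 0, ?_⟩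
  rw [map_div₀]
  conv_lhs => rw [← RatFunc.num_div_denom A, eq_C_of_natDegree_eq_zero h1,
    eq_C_of_natDegree_eq_zero h2]
  rw [RatFunc.algebraMap_C, RatFunc.algebraMap_C]

theorem ratDeg_div_le {F : Type*} [Field F] {p q : F[X]} {n : ℕ} (hp : p.natDegree ≤ n)
    (hq : q.natDegree ≤ n) :
    ratDeg (algebraMap F[X] (RatFunc F) p / algebraMap F[X] (RatFunc F) q) ≤ n := by
  by_cases hq0 : q = 0
  · simp [hq0, ratDeg]
  by_cases hp0 : p = 0
  · simp [hp0, ratDeg]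
  exact max_le ((natDegree_le_of_dvd (RatFunc.num_div_dvd p hq0) hp0).trans hp)
    ((natDegree_le_of_dvd (RatFunc.denom_div_dvd p q) hq0).trans hq)

theorem IsMeromorphicFamily.ratDeg_le {d : ℕ} {h : RatFunc 𝕃} (hh : IsMeromorphicFamily d h) :
    ratDeg h ≤ d := by
  obtain ⟨a, b, -, rfl, -⟩ := hh
  refine ratDeg_div_le ?_ ?_ <;>
  exact natDegree_sum_le_of_forall_le _ _ fun j hj =>
    (natDegree_monomial_le _).trans (Nat.lt_succ_iff.1 (Finset.mem_range.1 hj))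

/-- The shape of the family bounds the degree by one; a constant `A` is excluded because `A ∘ f`
fixes the Gauss point. -/
theorem IsMeromorphicFamily.ratDeg_eq_one {A f : RatFunc 𝕃} (hA : IsMeromorphicFamily 1 A)
    (hG : berkMap (ratComp A f) gaussPt = gaussPt) : ratDeg A = 1 := by
  refine le_antisymm hA.ratDeg_le (Nat.one_le_iff_ne_zero.2 fun h0 => ?_)
  obtain ⟨k, rfl⟩ := eq_C_of_ratDeg_eq_zero h0
  rw [ratComp_C_left] at hG
  exact berkMap_C_gaussPt_ne k hG

/-- A decomposition of `A` as the inverse of a matrix in `GL₂` of the valuation ring, composed with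
the inverse of the affine transformation `z ↦ c z + b`. -/
structure IsIwasawa (A : RatFunc 𝕃) (c : 𝕃ˣ) (b : 𝕃) (α β γ δ : intRing) : Prop where
  deg : ratDeg A = 1
  det : redHom α * redHom δ - redHom β * redHom γ ≠ 0
  ex : ∃ e : 𝕃, e ≠ 0 ∧ A.num.coeff 1 * c = e * δ ∧ A.num.coeff 1 * b + A.num.coeff 0 = -(e * β) ∧
    A.denom.coeff 1 * c = -(e * γ) ∧ A.denom.coeff 1 * b + A.denom.coeff 0 = e * α

/-- The larger of the two leading coefficients of `A` serves as pivot. The integral matrix has the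
rows `(1, 0)`, `(-b₁ / a₁, 1)` in one case and `(0, 1)`, `(1, -a₁ / b₁)` in the other, with
determinant `1` and `-1`. -/
theorem exists_isIwasawa {A : RatFunc 𝕃} (hA : ratDeg A = 1) :
    ∃ c b α β γ δ, IsIwasawa A c b α β γ δ := by
  have hdet := mobius_det_ne_zero hA
  set a₁ := A.num.coeff 1 with ha₁
  set a₀ := A.num.coeff 0 with ha₀
  set b₁ := A.denom.coeff 1 with hb₁
  set b₀ := A.denom.coeff 0 with hb₀
  rcases le_or_gt ‖b₁‖ ‖a₁‖ with h | h
  · have h1 : a₁ ≠ 0 := by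
      intro h0
      rw [h0, norm_zero] at h
      simp [h0, norm_le_zero_iff.1 h] at hdet
    have hq : ‖b₁ / a₁‖ ≤ 1 := by
      rw [norm_div]
      exact div_le_one_of_le₀ h (norm_nonneg _)
    have he : b₀ - a₀ * b₁ / a₁ ≠ 0 := by
      intro h0
      apply hdet
      field_simp at h0
      linear_combination h0
    refine ⟨Units.mk0 ((b₀ - a₀ * b₁ / a₁) / a₁) (div_ne_zero he h1), -a₀ / a₁, 1, 0,
      -⟨b₁ / a₁, hq⟩, 1, hA, by simp, b₀ - a₀ * b₁ / a₁, he, ?_, ?_, ?_, ?_⟩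
    all_goals
      simp only [← ha₁, ← ha₀, ← hb₁, ← hb₀, Units.val_mk0, Subring.coe_one, Subring.coe_zero,
        Subring.coe_neg]
      field_simp
      try ring
  · have h1 : b₁ ≠ 0 := norm_pos_iff.1 ((norm_nonneg _).trans_lt h)
    have hq : ‖a₁ / b₁‖ ≤ 1 := by
      rw [norm_div]
      exact div_le_one_of_le₀ h.le (norm_nonneg _)
    have he : b₀ * a₁ / b₁ - a₀ ≠ 0 := by
      intro h0
      apply hdet
      field_simp at h0
      linear_combination h0
    refine ⟨Units.mk0 (-(b₀ * a₁ / b₁ - a₀) / b₁) (div_ne_zero (neg_ne_zero.2 he) h1), -b₀ / b₁,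
      0, 1, 1, -⟨a₁ / b₁, hq⟩, hA, by simp, b₀ * a₁ / b₁ - a₀, he, ?_, ?_, ?_, ?_⟩
    all_goals
      simp only [← ha₁, ← ha₀, ← hb₁, ← hb₀, Units.val_mk0, Subring.coe_one, Subring.coe_zero,
        Subring.coe_neg]
      field_simp
      try ring

theorem isRep_X : IsRep RatFunc.X X 1 where
  coprime := by rw [map_one]; exact isCoprime_one_right
  den_ne := by simp
  eq := by simp [toL_X]
  red_ne := by simp

theorem isVal_X_one {k : Type*} [Field k] (ζ : OnePoint k) : IsVal (X : k[X]) 1 ζ ζ := by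
  have h := isVal_evalP1 (p := (X : k[X])) (q := 1) isCoprime_one_right nonDeg_X_one ζ
  convert h using 1
  match ζ with
  | OnePoint.some z => simp [evalP1]
  | OnePoint.infty => simp [evalP1, coeff_one]

namespace IsIwasawa

variable {A f g : RatFunc 𝕃} {c : 𝕃ˣ} {b : 𝕃} {α β γ δ : intRing} {P Q : intRing[X]}

theorem det' (hI : IsIwasawa A c b α β γ δ) :
    redHom δ * redHom α - redHom (-β) * redHom (-γ) ≠ 0 := by
  have := hI.det
  rw [map_neg, map_neg]
  intro h0
  exact this (by linear_combination h0)

theorem det_coe (hI : IsIwasawa A c b α β γ δ) : ((α * δ - β * γ : intRing) : 𝕃) ≠ 0 := by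
  intro h0
  have h1 : α * δ - β * γ = 0 := Subtype.ext h0
  apply hI.det
  rw [← map_mul, ← map_mul, ← map_sub, h1, map_zero]

/-- As `A` undoes the affine map and the matrix, `A ∘ f` is the adjugate matrix applied to `g`.
Independence is assumed over `𝕃` only, because the lemma also serves for `f = X`, where the
reduction of `g` may be constant. -/
theorem isUnimodular (hI : IsIwasawa A c b α β γ δ) (hr : IsRep g P Q)
    (hnL : NonDeg (toL P) (toL Q)) (hf : f = RatFunc.C (c : 𝕃) * g + RatFunc.C b) :
    IsUnimodular (ratComp A f) P Q δ (-β) (-γ) α where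
  det_ne := hI.det'
  rep := by
    obtain ⟨e, he, h1, h2, h3, h4⟩ := hI.ex
    have hcomp := hr.ratComp_eq hf hI.deg.le
    have e1 : ∀ x y : intRing, C (e * (x : 𝕃)) * toL P + C (e * (y : 𝕃)) * toL Q =
        C e * toL (C x * P + C y * Q) := by
      intro x y
      rw [toL_comb, C_mul, C_mul]
      ring
    rw [h1, h2, h3, h4, ← mul_neg, ← mul_neg, ← Subring.coe_neg, ← Subring.coe_neg, e1, e1,
      algebraMap_div_scale he] at hcomp
    refine hr.mobius hnL ?_ ?_ hcomp
    · have := hI.det_coe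
      push_cast at this ⊢
      intro h0
      exact this (by linear_combination h0)
    · rw [redPoly_comb, redPoly_comb]
      by_contra! h0
      obtain ⟨h5, h6⟩ := h0
      have hd := hI.det'
      have hP : C (redHom δ * redHom α - redHom (-β) * redHom (-γ)) * redPoly P = 0 := by
        rw [C_sub, C_mul, C_mul]
        linear_combination C (redHom α) * h5 - C (redHom (-β)) * h6
      have hQ : C (redHom δ * redHom α - redHom (-β) * redHom (-γ)) * redPoly Q = 0 := by
        rw [C_sub, C_mul, C_mul]
        linear_combination C (redHom δ) * h6 - C (redHom (-γ)) * h5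
      exact hr.red_ne.elim (fun h => h ((mul_eq_zero.1 hP).resolve_left (C_ne_zero.2 hd)))
        fun h => h ((mul_eq_zero.1 hQ).resolve_left (C_ne_zero.2 hd))

/-- The inverse of `A` is the matrix followed by `z ↦ c z + b`. -/
theorem exists_mobiusInv (hI : IsIwasawa A c b α β γ δ) :
    ∃ M, IsRep M (C α * X + C β * 1) (C γ * X + C δ * 1) ∧
      mobiusInv A = RatFunc.C (c : 𝕃) * M + RatFunc.C b := by
  obtain ⟨e, he, h1, h2, h3, h4⟩ := hI.ex
  have hnd : NonDeg (redPoly X) (redPoly 1) := by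
    rw [redPoly_X, map_one]
    exact nonDeg_X_one
  have hM := isRep_X.mobius (k := algebraMap 𝕃[X] (RatFunc 𝕃) (toL (C α * X + C β * 1)) /
      algebraMap 𝕃[X] (RatFunc 𝕃) (toL (C γ * X + C δ * 1))) (nonDeg_toL hnd) hI.det_coe ?_ rfl
  · refine ⟨_, hM, ?_⟩
    rw [hM.eq_div_of_affine rfl, toL_comb, toL_comb, toL_X, map_one]
    have hc : ((c : 𝕃) / e) ≠ 0 := div_ne_zero c.ne_zero he
    rw [← algebraMap_div_scale (inv_ne_zero hc), mobiusInv]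
    congr 1
    · have e1 : ((c : 𝕃) / e)⁻¹ * (c * α + b * γ) = A.denom.coeff 0 := by
        have := c.ne_zero
        field_simp
        linear_combination (-(c : 𝕃)) * h4 + b * h3
      have e2 : ((c : 𝕃) / e)⁻¹ * (c * β + b * δ) = -A.num.coeff 0 := by
        have := c.ne_zero
        field_simp
        linear_combination (c : 𝕃) * h2 - b * h1
      rw [show C ((c : 𝕃) / e)⁻¹ * (C (c : 𝕃) * (C (α : 𝕃) * X + C (β : 𝕃) * 1) +
        C b * (C (γ : 𝕃) * X + C (δ : 𝕃) * 1)) = C (((c : 𝕃) / e)⁻¹ * (c * α + b * γ)) * X +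
          C (((c : 𝕃) / e)⁻¹ * (c * β + b * δ)) by
        simp only [C_mul, C_add]; ring, e1, e2]
      simp only [map_add, map_mul, RatFunc.algebraMap_C, RatFunc.algebraMap_X, map_neg]
      ring
    · have e1 : ((c : 𝕃) / e)⁻¹ * γ = -A.denom.coeff 1 := by
        have := c.ne_zero
        field_simp
        linear_combination h3
      have e2 : ((c : 𝕃) / e)⁻¹ * δ = A.num.coeff 1 := by
        have := c.ne_zero
        field_simp
        linear_combination -h1
      rw [show C ((c : 𝕃) / e)⁻¹ * (C (γ : 𝕃) * X + C (δ : 𝕃) * 1) =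
        C (((c : 𝕃) / e)⁻¹ * γ) * X + C (((c : 𝕃) / e)⁻¹ * δ) by
        simp only [C_mul]; ring, e1, e2]
      simp only [map_add, map_mul, RatFunc.algebraMap_C, RatFunc.algebraMap_X, map_neg]
      ring
  · rw [redPoly_comb, redPoly_comb]
    left
    refine (hnd.comb_ne ?_)
    by_contra! h0
    exact hI.det (by rw [h0.1, h0.2]; ring)

/-- The direction at `f(𝒮_G)` that is the image under `A⁻¹` of the direction of `y` at `𝒮_G`. -/
def imageDir (c : 𝕃ˣ) (b : 𝕃) (α β γ δ : intRing) (y : OnePoint ℂ) : Set (Berk 𝕃) :=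
  dirAt c b (mob (redHom α) (redHom β) (redHom γ) (redHom δ) y)

theorem invDir_eq (hI : IsIwasawa A c b α β γ δ) (y : OnePoint 𝕃) :
    invDir A y = imageDir c b α β γ δ (redPt y) := by
  obtain ⟨M, hM, hA⟩ := hI.exists_mobiusInv
  have hnd : NonDeg (redPoly (C α * X + C β * 1)) (redPoly (C γ * X + C δ * 1)) := by
    rw [redPoly_comb, redPoly_comb, nonDeg_change hI.det, redPoly_X, map_one]
    exact nonDeg_X_one
  rw [invDir, dir_gauss_classicalPt, hM.dirMap_gauss hnd hA]
  · rfl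
  · rw [redPoly_comb, redPoly_comb, redPoly_X, map_one, nonDeg_X_one.isVal_change hI.det]
    exact isVal_X_one _

end IsIwasawa

/-! ### Degrees of `f` at the Gauss point -/

/-- Data that describe the action of `f` at the Gauss point: `f = c g + b`, where `g` fixes the
Gauss point and has the reduction of `P / Q`, and `A` is the inverse of `z ↦ c z + b`, up to a
matrix in `GL₂` of the valuation ring. -/
structure IsFrame (f A g : RatFunc 𝕃) (c : 𝕃ˣ) (b : 𝕃) (α β γ δ : intRing)
    (P Q : intRing[X]) : Prop where
  iwasawa : IsIwasawa A c b α β γ δ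
  rep : IsRep g P Q
  eq : f = RatFunc.C (c : 𝕃) * g + RatFunc.C b
  nonDeg : NonDeg (redPoly P) (redPoly Q)

/-- Take `g = (f - b) / c`. If `g` were constant, so would be `A ∘ f`, which fixes the Gauss point.
Since `A ∘ f` and `g` differ by an integral matrix of unit determinant, nondegeneracy of the
reduction passes from the former to the latter. -/
theorem IsIwasawa.exists_isFrame {A f : RatFunc 𝕃} {c : 𝕃ˣ} {b : 𝕃} {α β γ δ : intRing}
    (hI : IsIwasawa A c b α β γ δ) (hG : berkMap (ratComp A f) gaussPt = gaussPt) :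
    ∃ g P Q, IsFrame f A g c b α β γ δ P Q := by
  obtain ⟨P, Q, hr⟩ := exists_isRep (RatFunc.C (c : 𝕃)⁻¹ * (f - RatFunc.C b))
  have hf : f = RatFunc.C (c : 𝕃) * (RatFunc.C (c : 𝕃)⁻¹ * (f - RatFunc.C b)) + RatFunc.C b := by
    rw [← mul_assoc, ← map_mul, mul_inv_cancel₀ c.ne_zero, map_one, one_mul, sub_add_cancel]
  have hnL : NonDeg (toL P) (toL Q) := by
    intro w h0
    match w with
    | OnePoint.infty => exact hr.den_ne h0
    | OnePoint.some w =>
      have h1 : toL P = C w * toL Q := sub_eq_zero.1 h0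
      have hq : algebraMap 𝕃[X] (RatFunc 𝕃) (toL Q) ≠ 0 :=
        (map_ne_zero_iff _ (RatFunc.algebraMap_injective 𝕃)).2 hr.den_ne
      have h2 := hr.eq
      rw [h1, map_mul, mul_div_cancel_right₀ _ hq, RatFunc.algebraMap_C] at h2
      rw [h2, ← map_mul, ← map_add] at hf
      rw [hf, ratComp_C_right] at hG
      exact berkMap_C_gaussPt_ne _ hG
  have hu := hI.isUnimodular hr hnL hf
  exact ⟨_, P, Q, hI, hr, hf, hu.nonDeg_iff.1 (hu.rep.nonDeg_red_iff.2 (hu.rep.nonDeg hG))⟩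

namespace IsFrame

variable {f A g : RatFunc 𝕃} {c : 𝕃ˣ} {b : 𝕃} {α β γ δ : intRing} {P Q : intRing[X]}

theorem unimodular (hF : IsFrame f A g c b α β γ δ P Q) :
    IsUnimodular (ratComp A f) P Q δ (-β) (-γ) α :=
  hF.iwasawa.isUnimodular hF.rep (nonDeg_toL hF.nonDeg) hF.eq

theorem nonDeg_red (hF : IsFrame f A g c b α β γ δ P Q) :
    NonDeg (redNum (ratComp A f)) (redDen (ratComp A f)) :=
  hF.unimodular.nonDeg_iff.2 hF.nonDeg

theorem berkMap_gaussPt (hF : IsFrame f A g c b α β γ δ P Q) : berkMap f gaussPt = diskPt c b :=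
  hF.rep.berkMap_gaussPt hF.nonDeg hF.eq

theorem berkMap_comp (hF : IsFrame f A g c b α β γ δ P Q) :
    berkMap A (berkMap f gaussPt) = berkMap (ratComp A f) gaussPt :=
  hF.rep.berkMap_ratComp hF.nonDeg hF.eq hF.iwasawa.deg

theorem mob_phi (hF : IsFrame f A g c b α β γ δ P Q) {ζ v : OnePoint ℂ}
    (hv : IsVal (redPoly P) (redPoly Q) ζ v) :
    mob (redHom α) (redHom β) (redHom γ) (redHom δ) (phi (ratComp A f) ζ) = v := by
  rw [hF.unimodular.phi_eq hF.nonDeg hv, map_neg, map_neg, mob_mob_inv hF.iwasawa.det]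

theorem isVal (hF : IsFrame f A g c b α β γ δ P Q) (ζ : OnePoint ℂ) :
    IsVal (redPoly P) (redPoly Q) ζ
      (mob (redHom α) (redHom β) (redHom γ) (redHom δ) (phi (ratComp A f) ζ)) := by
  obtain ⟨v, hv⟩ := hF.rep.exists_isVal hF.nonDeg ζ
  rwa [hF.mob_phi hv]

theorem dirMap_eq (hF : IsFrame f A g c b α β γ δ P Q) (ζ : OnePoint ℂ) :
    dirMap f gaussPt (dirAt 1 0 ζ) =
      IsIwasawa.imageDir c b α β γ δ (phi (ratComp A f) ζ) :=
  hF.rep.dirMap_gauss hF.nonDeg hF.eq (hF.isVal ζ)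

theorem ratDeg_eq (hF : IsFrame f A g c b α β γ δ P Q) : ratDeg f = ratDeg (ratComp A f) := by
  rw [hF.rep.ratDeg_affine hF.eq, hF.rep.ratDeg_eq, hF.unimodular.ratDeg_eq]

theorem ordH_eq (hF : IsFrame f A g c b α β γ δ P Q) (ζ : OnePoint ℂ) :
    (ordH (ratComp A f) ζ : ℤ) = baseOrd ζ (redPoly P) (redPoly Q) + inftyDeg (ratDeg f) ζ := by
  rw [hF.unimodular.ordH_eq hF.nonDeg, hF.ratDeg_eq, hF.unimodular.ratDeg_eq]

-- Preimages of `w` in the direction `ζ` are counted by the order at `ζ` of the member of the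
-- reduced pencil at the residue of `w`. This is the base order, which gives the hole, unless the
-- residue is the value at `ζ`, where the local degree is added.
open Classical in
theorem solCount_eq (hF : IsFrame f A g c b α β γ δ P Q) (w : OnePoint 𝕃) (ζ : OnePoint ℂ) :
    solCount f w (dirAt 1 0 ζ) =
      if classicalPt w ∈ IsIwasawa.imageDir c b α β γ δ (phi (ratComp A f) ζ) then
        phiDeg (ratComp A f) ζ + ordH (ratComp A f) ζ else ordH (ratComp A f) ζ := by
  have h1 := hF.rep.solCount_dirAt hF.nonDeg hF.eq w ζ
  have h2 := hF.ordH_eq ζ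
  have hv := hF.isVal ζ
  have h3 := hF.unimodular.phiDeg_eq hF.nonDeg hv
  have h4 := hF.nonDeg.baseOrd_le_fiber ζ (redPt (affCoord c b w))
  rw [IsIwasawa.imageDir, classicalPt_mem_dirAt_iff]
  split_ifs with h
  · rw [h] at h1
    omega
  · have h5 : ¬ IsVal (redPoly P) (redPoly Q) ζ (redPt (affCoord c b w)) := fun h' =>
      h (h'.unique hF.nonDeg hv)
    rw [IsVal, not_lt] at h5
    omega

/-- The composites of `f` with `rescaling f` and with `A` both arise from `g` by integral matrices
of unit determinant, which do not affect local degrees of the reduction. -/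
theorem dirDeg_eq (hF : IsFrame f A g c b α β γ δ P Q)
    (hG : berkMap (ratComp A f) gaussPt = gaussPt) (ζ : OnePoint ℂ) :
    dirDeg f (dirAt 1 0 ζ) = phiDeg (ratComp A f) ζ := by
  have hB : ratDeg (rescaling f) = 1 ∧ berkMap (rescaling f) (berkMap f gaussPt) = gaussPt :=
    Classical.epsilon_spec
      (p := fun B : RatFunc 𝕃 => ratDeg B = 1 ∧ berkMap B (berkMap f gaussPt) = gaussPt)
      ⟨A, hF.iwasawa.deg, hF.berkMap_comp.trans hG⟩
  have hz : redPt (Classical.epsilon fun z : OnePoint 𝕃 => classicalPt z ∈ dirAt 1 0 ζ) = ζ :=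
    classicalPt_mem_dirAt_gauss_iff.1
      (Classical.epsilon_spec (exists_classicalPt_mem_dirAt 1 0 ζ))
  rw [dirDeg, hz]
  have hBG := hB.2
  rw [hF.rep.berkMap_ratComp hF.nonDeg hF.eq hB.1] at hBG
  obtain ⟨α', β', γ', δ', hdet, hrep⟩ := hF.rep.exists_unimodular hF.nonDeg hF.eq hB.1 hBG
  have h1 := IsUnimodular.phiDeg_eq ⟨hdet, hrep⟩ hF.nonDeg (hF.isVal ζ)
  have h2 := hF.unimodular.phiDeg_eq hF.nonDeg (hF.isVal ζ)
  omega

/-- By `IsFrame.solCount_eq` the multiplicity of the hole satisfies the condition that defines the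
surplus. The condition determines the number already at a single `w`, for which `∞` is taken. -/
theorem surplus_eq (hF : IsFrame f A g c b α β γ δ P Q)
    (hG : berkMap (ratComp A f) gaussPt = gaussPt) (ζ : OnePoint ℂ) :
    surplus f (dirAt 1 0 ζ) = ordH (ratComp A f) ζ := by
  classical
  have key : ∀ w : OnePoint 𝕃, solCount f w (dirAt 1 0 ζ) =
      if classicalPt w ∈ dirMap f gaussPt (dirAt 1 0 ζ) then
        dirDeg f (dirAt 1 0 ζ) + ordH (ratComp A f) ζ else ordH (ratComp A f) ζ := by
    intro w
    rw [hF.solCount_eq, hF.dirMap_eq, hF.dirDeg_eq hG]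
  have hs : ∀ w : OnePoint 𝕃, solCount f w (dirAt 1 0 ζ) =
      if classicalPt w ∈ dirMap f gaussPt (dirAt 1 0 ζ) then
        dirDeg f (dirAt 1 0 ζ) + surplus f (dirAt 1 0 ζ) else surplus f (dirAt 1 0 ζ) := by
    have := Classical.epsilon_spec (p := fun s : ℕ => ∀ w : OnePoint 𝕃,
      solCount f w (dirAt 1 0 ζ) = if classicalPt w ∈ dirMap f gaussPt (dirAt 1 0 ζ) then
        dirDeg f (dirAt 1 0 ζ) + s else s) ⟨_, key⟩
    intro w
    rw [surplus]
    convert this w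
  have h1 := (hs OnePoint.infty).symm.trans (key OnePoint.infty)
  split_ifs at h1 <;> omega

end IsFrame

/-! ### Solutions close to a direction at the Gauss point -/

open Classical in
/-- The number of zeros in the closed disk of `nearPt ζ τ`, or minus the number of zeros in the
open disk if `ζ = ∞`. -/
def nearCount (F : 𝕃[X]) (τ : ℝ) : OnePoint ℂ → ℤ
  | OnePoint.some ζ => ((F.roots.filter fun a => ‖a - constEmb ζ‖ ≤ Real.exp (-τ)).card : ℤ)
  | OnePoint.infty => -((F.roots.filter fun a => ‖a‖ < Real.exp τ).card : ℤ)

-- `nearCount` is the logarithmic slope of the seminorm to the left of `τ`: when `τ` decreases a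
-- little, only the factors of the counted roots change.
open Filter Topology in
theorem eventually_sn_nearPt_left (F : 𝕃[X]) (ζ : OnePoint ℂ) (τ : ℝ) :
    ∀ᶠ σ in 𝓝[<] τ, (nearPt ζ σ).sn F =
      (nearPt ζ τ).sn F * Real.exp ((τ - σ) * nearCount F τ ζ) := by
  classical
  have hlt : ∀ᶠ σ in 𝓝[<] τ, σ < τ := self_mem_nhdsWithin
  have hexp : Tendsto (fun σ : ℝ => Real.exp σ) (𝓝[<] τ) (𝓝 (Real.exp τ)) :=
    Real.continuous_exp.continuousAt.mono_left nhdsWithin_le_nhds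
  have hexp' : Tendsto (fun σ : ℝ => Real.exp (-σ)) (𝓝[<] τ) (𝓝 (Real.exp (-τ))) :=
    (Real.continuous_exp.comp continuous_neg).continuousAt.mono_left nhdsWithin_le_nhds
  match ζ with
  | OnePoint.some ζ =>
    have hall : ∀ᶠ σ in 𝓝[<] τ, ∀ a ∈ F.roots.toFinset,
        Real.exp (-τ) < ‖a - constEmb ζ‖ → Real.exp (-σ) < ‖a - constEmb ζ‖ := by
      rw [Filter.eventually_all_finset]
      intro a _
      by_cases ha : Real.exp (-τ) < ‖a - constEmb ζ‖
      · filter_upwards [hexp'.eventually (gt_mem_nhds ha)] with σ hσ _ using hσ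
      · exact Eventually.of_forall fun σ h => absurd h ha
    filter_upwards [hall, hlt] with σ hσ hσ0
    rw [AffPoint.sn_eq_prod, AffPoint.sn_eq_prod,
      multiset_prod_map_mul_ite _ _ (nearPt (OnePoint.some ζ) τ).rad
      (fun a => ‖a - constEmb ζ‖ ≤ Real.exp (-τ)) (Real.exp (τ - σ)), ← mul_assoc]
    · rw [← Real.exp_nat_mul]
      simp only [nearCount]
      push_cast
      rw [mul_comm (τ - σ)]
    · intro a ha
      rw [nearPt_some_rad, nearPt_some_rad]
      split_ifs with hr
      · rw [max_eq_left hr, max_eq_left (hr.trans (Real.exp_le_exp.2 (by linarith))),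
          ← Real.exp_add]
        ring_nf
      · rw [not_le] at hr
        rw [max_eq_right hr.le, max_eq_right (hσ a (by simpa using ha) hr).le, mul_one]
  | OnePoint.infty =>
    have hall : ∀ᶠ σ in 𝓝[<] τ, ∀ a ∈ F.roots.toFinset,
        ‖a‖ < Real.exp τ → ‖a‖ < Real.exp σ := by
      rw [Filter.eventually_all_finset]
      intro a _
      by_cases ha : ‖a‖ < Real.exp τ
      · filter_upwards [hexp.eventually (lt_mem_nhds ha)] with σ hσ _ using hσ
      · exact Eventually.of_forall fun σ h => absurd h ha
    filter_upwards [hall, hlt] with σ hσ hσ0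
    rw [AffPoint.sn_eq_prod, AffPoint.sn_eq_prod,
      multiset_prod_map_mul_ite _ _ (nearPt OnePoint.infty τ).rad
      (fun a => ‖a‖ < Real.exp τ) (Real.exp (σ - τ)), ← mul_assoc]
    · rw [← Real.exp_nat_mul]
      simp only [nearCount]
      push_cast
      ring_nf
    · intro a ha
      rw [nearPt_infty_rad, nearPt_infty_rad]
      split_ifs with hr
      · rw [max_eq_left hr.le, max_eq_left (hσ a (by simpa using ha) hr).le, ← Real.exp_add]
        ring_nf
      · rw [not_lt] at hr
        rw [max_eq_right hr, max_eq_right ((Real.exp_le_exp.2 hσ0.le).trans hr), mul_one]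

theorem exists_fiberPoly_comb {k : Type*} [Field k] (p q : k[X]) {w w' : OnePoint k} (h : w ≠ w')
    (x : OnePoint k) : ∃ l m : k,
      fiberPoly p q x = C l * fiberPoly p q w + C m * fiberPoly p q w' := by
  have inf : ∀ w' x : k, p - C x * q = C (w' - x) * q + C 1 * (p - C w' * q) := fun w' x => by
    rw [C_sub, C_1]; ring
  match w, w', x with
  | OnePoint.infty, OnePoint.infty, _ => exact absurd rfl h
  | OnePoint.infty, OnePoint.some w', OnePoint.infty => exact ⟨1, 0, by simp⟩
  | OnePoint.infty, OnePoint.some w', OnePoint.some x => exact ⟨w' - x, 1, inf w' x⟩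
  | OnePoint.some w, OnePoint.infty, OnePoint.infty => exact ⟨0, 1, by simp⟩
  | OnePoint.some w, OnePoint.infty, OnePoint.some x =>
    exact ⟨1, w - x, by rw [add_comm]; exact inf w x⟩
  | OnePoint.some w, OnePoint.some w', OnePoint.infty =>
    have hne : w' - w ≠ 0 := sub_ne_zero.2 fun e => h (by rw [e])
    refine ⟨(w' - w)⁻¹, -(w' - w)⁻¹, ?_⟩
    have : C (w' - w)⁻¹ * C (w' - w) = (1 : k[X]) := by
      rw [← C_mul, inv_mul_cancel₀ hne, C_1]
    simp only [fiberPoly, C_neg]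
    rw [C_sub] at this
    linear_combination (-q) * this
  | OnePoint.some w, OnePoint.some w', OnePoint.some x =>
    have hne : w' - w ≠ 0 := sub_ne_zero.2 fun e => h (by rw [e])
    refine ⟨(w' - x) * (w' - w)⁻¹, (x - w) * (w' - w)⁻¹, ?_⟩
    have : C (w' - w)⁻¹ * C (w' - w) = (1 : k[X]) := by
      rw [← C_mul, inv_mul_cancel₀ hne, C_1]
    simp only [fiberPoly, C_mul, C_sub]
    rw [C_sub] at this
    linear_combination (-p + C x * q) * this

theorem AffPoint.sn_add_eq_max {K : Type*} [NormedField K] [IsUltrametricDist K] (x : AffPoint K)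
    {p q : K[X]} (h : x.sn p ≠ x.sn q) : x.sn (p + q) = max (x.sn p) (x.sn q) := by
  have key : ∀ {p q : K[X]}, x.sn p < x.sn q → x.sn (p + q) = max (x.sn p) (x.sn q) := by
    intro p q hlt
    refine le_antisymm (x.sn_add_le_max p q) ?_
    rw [max_eq_right hlt.le]
    have h1 := x.sn_add_le_max (p + q) (-p)
    rw [map_neg_eq_map, add_neg_cancel_comm] at h1
    rcases le_max_iff.1 h1 with h2 | h2
    · exact h2
    · exact absurd h2 (not_le.2 hlt)
  rcases h.lt_or_gt with h | h
  · exact key h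
  · rw [add_comm, max_comm]
    exact key h

-- The two sides agree for at most one `σ`, and for none if a coefficient vanishes, so they differ
-- just to the left of `τ`.
open Filter Topology in
theorem eventually_ne_exp {n m : ℝ} (h : n < m) {l k : ℝ} (hl : l ≠ 0 ∨ k ≠ 0) (τ : ℝ) :
    ∀ᶠ σ in 𝓝[<] τ, l * Real.exp (-σ * m) ≠ k * Real.exp (-σ * n) := by
  have key : ∀ σ, l * Real.exp (-σ * m) = k * Real.exp (-σ * n) ↔
      l = k * Real.exp (σ * (m - n)) := by
    intro σ
    have e : Real.exp (-σ * n) = Real.exp (σ * (m - n)) * Real.exp (-σ * m) := by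
      rw [← Real.exp_add]
      ring_nf
    rw [e, ← mul_assoc, mul_left_inj' (Real.exp_pos _).ne']
  by_cases hk : k = 0
  · refine Eventually.of_forall fun σ hσ => ?_
    rw [key, hk, zero_mul] at hσ
    simp [hk, hσ] at hl
  by_cases hτ : ∃ σ₀ < τ, l = k * Real.exp (σ₀ * (m - n))
  · obtain ⟨σ₀, h0, h1⟩ := hτ
    filter_upwards [Ioo_mem_nhdsLT h0] with σ hσ hσ'
    rw [key, h1, mul_right_inj' hk, Real.exp_eq_exp, mul_left_inj' (sub_pos.2 h).ne'] at hσ'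
    exact hσ.1.ne hσ'
  · filter_upwards [self_mem_nhdsWithin] with σ hσ hσ'
    exact hτ ⟨σ, hσ, (key σ).1 hσ'⟩

open Filter Topology in
/-- Each linear combination of two polynomials with monomial behaviour of orders `n < m` close to
a direction has at least `n` zeros there. -/
theorem le_nearCount_of_comb {F₀ F₁ F : 𝕃[X]} {ζ : OnePoint ℂ} {ε : ℝ} {n m : ℤ} (hnm : n < m)
    (h₀ : ∀ σ, 0 < σ → σ < ε → (nearPt ζ σ).sn F₀ = Real.exp (-σ * m))
    (h₁ : ∀ σ, 0 < σ → σ < ε → (nearPt ζ σ).sn F₁ = Real.exp (-σ * n))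
    {l k : 𝕃} (hF : F = C l * F₀ + C k * F₁) (hF0 : F ≠ 0) {τ : ℝ} (hτ : 0 < τ) (hτε : τ < ε) :
    n ≤ nearCount F τ ζ := by
  have hlk : ‖l‖ ≠ 0 ∨ ‖k‖ ≠ 0 := by
    by_contra! h
    simp only [norm_eq_zero] at h
    simp [h.1, h.2] at hF
    exact hF0 hF
  have hnm' : (n : ℝ) < m := by exact_mod_cast hnm
  -- At `τ` the two terms may cancel, so only an upper bound holds there. Slightly to the left they
  -- have different sizes, and the ultrametric inequality becomes an equality.
  obtain ⟨σ, ⟨h1, h2⟩, h3, h4⟩ := ((eventually_ne_exp hnm' hlk τ).and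
    (eventually_sn_nearPt_left F ζ τ)|>.and
      ((Ioo_mem_nhdsLT hτ : Set.Ioo 0 τ ∈ 𝓝[<] τ)) ).exists
  have hs : ∀ σ, 0 < σ → σ < ε → (nearPt ζ σ).sn (C l * F₀) = ‖l‖ * Real.exp (-σ * m) ∧
      (nearPt ζ σ).sn (C k * F₁) = ‖k‖ * Real.exp (-σ * n) := by
    intro σ hσ hσε
    rw [map_mul, map_mul, AffPoint.map_C, AffPoint.map_C, h₀ σ hσ hσε, h₁ σ hσ hσε]
    exact ⟨rfl, rfl⟩
  have hσ := hs σ h3 (h4.trans hτε)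
  have e1 : (nearPt ζ σ).sn F = max (‖l‖ * Real.exp (-σ * m)) (‖k‖ * Real.exp (-σ * n)) := by
    rw [hF, AffPoint.sn_add_eq_max, hσ.1, hσ.2]
    rwa [hσ.1, hσ.2]
  have e2 : (nearPt ζ τ).sn F ≤ max (‖l‖ * Real.exp (-τ * m)) (‖k‖ * Real.exp (-τ * n)) := by
    have := (nearPt ζ τ).sn_add_le_max (C l * F₀) (C k * F₁)
    rwa [← hF, (hs τ hτ hτε).1, (hs τ hτ hτε).2] at this
  have hpos : 0 < (nearPt ζ τ).sn F :=
    (apply_nonneg _ _).lt_of_ne' (AffPoint.sn_ne_zero_of_rad_pos (nearPt_rad_pos ζ τ) hF0)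
  -- From `τ` to `σ` each term is multiplied by at least `exp ((τ - σ) * n)`, since `n < m`.
  -- Comparison with the slope `nearCount` gives the bound.
  have e3 : (nearPt ζ τ).sn F * Real.exp ((τ - σ) * n) ≤ (nearPt ζ σ).sn F := by
    rw [e1]
    refine (mul_le_mul_of_nonneg_right e2 (Real.exp_pos _).le).trans ?_
    rw [max_mul_of_nonneg _ _ (Real.exp_pos _).le, mul_assoc, mul_assoc, ← Real.exp_add,
      ← Real.exp_add]
    refine max_le_max ?_ ?_
    · refine mul_le_mul_of_nonneg_left (Real.exp_le_exp.2 ?_) (norm_nonneg _)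
      nlinarith
    · refine mul_le_mul_of_nonneg_left (Real.exp_le_exp.2 (le_of_eq ?_)) (norm_nonneg _)
      ring
  rw [h2, mul_le_mul_iff_right₀ hpos, Real.exp_le_exp, mul_le_mul_iff_right₀ (sub_pos.2 h4)] at e3
  exact_mod_cast e3

/-! ### Solutions that stay close to a hole -/

section Count

variable {h g : RatFunc 𝕃} {c : 𝕃ˣ} {b : 𝕃} {P Q : intRing[X]}

open Classical in
theorem finite_solutions (hn : NonDeg h.num h.denom) (w : OnePoint 𝕃) :
    {z | evalP1 h.num h.denom z = w}.Finite := by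
  refine (((fiberPoly h.num h.denom w).roots.toFinset.finite_toSet.image
    (OnePoint.some : 𝕃 → OnePoint 𝕃)).insert OnePoint.infty).subset fun z hz => ?_
  match z with
  | OnePoint.infty => exact Or.inl rfl
  | OnePoint.some a =>
    refine Or.inr ⟨a, ?_, rfl⟩
    simp only [Finset.mem_coe, Multiset.mem_toFinset]
    rw [mem_roots (hn w)]
    exact (eval_fiberPoly_eq_zero_iff (RatFunc.isCoprime_num_denom h) a w).1 hz

open Classical in
theorem solCount_eq_sum (hn : NonDeg h.num h.denom) (w : OnePoint 𝕃) (N : Set (Berk 𝕃)) :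
    solCount h w N = ∑ z ∈ (finite_solutions hn w).toFinset,
      if classicalPt z ∈ N then localDegP1 h.num h.denom z else 0 := by
  rw [solCount, ← Finset.sum_filter, finsum_mem_eq_sum_of_inter_support_eq]
  ext z
  simp

open Classical in
theorem solCount_univ (hn : NonDeg h.num h.denom) (w : OnePoint 𝕃) :
    solCount h w Set.univ = ratDeg h := by
  have := finsum_localDegP1 (RatFunc.isCoprime_num_denom h) hn w Set.univ
  simp only [Set.mem_univ, Multiset.filter_true, if_true] at this
  rw [solCount]
  simp only [Set.mem_univ]
  rw [this, ← (IsAlgClosed.splits (fiberPoly h.num h.denom w)).natDegree_eq_card_roots, ratDeg]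
  exact Nat.add_sub_cancel' (natDegree_fiberPoly_le _ _ w)

open Classical in
theorem sum_solCount_le {ι : Type*} (hn : NonDeg h.num h.denom) (w : OnePoint 𝕃) (T : Finset ι)
    (N : ι → Set (Berk 𝕃)) (M : Set (Berk 𝕃)) (hM : ∀ i ∈ T, N i ⊆ M)
    (hd : ∀ i ∈ T, ∀ j ∈ T, i ≠ j → Disjoint (N i) (N j)) :
    ∑ i ∈ T, solCount h w (N i) ≤ solCount h w M := by
  rw [Finset.sum_congr rfl fun i _ => solCount_eq_sum hn w (N i), Finset.sum_comm,
    solCount_eq_sum hn]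
  refine Finset.sum_le_sum fun z _ => ?_
  by_cases hz : ∃ i ∈ T, classicalPt z ∈ N i
  · obtain ⟨i, hi, hzi⟩ := hz
    rw [Finset.sum_eq_single_of_mem i hi, if_pos hzi, if_pos (hM i hi hzi)]
    intro j hj hij
    exact if_neg fun hzj => Set.disjoint_left.1 (hd j hj i hi hij) hzj hzi
  · push Not at hz
    rw [Finset.sum_eq_zero fun i hi => if_neg (hz i hi)]
    exact Nat.zero_le _

theorem classicalPt_notMem_dir_nearPt_some {ζ : ℂ} {τ : ℝ} (hτ : 0 < τ) {a : 𝕃}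
    (ha : ‖a - constEmb ζ‖ ≤ Real.exp (-τ)) :
    classicalPt (OnePoint.some a) ∉ dir (.aff (nearPt (OnePoint.some ζ) τ)) gaussPt := by
  have hle : ¬ (gaussPt : Berk 𝕃) ≤ .aff (nearPt (OnePoint.some ζ) τ) := by
    intro h
    have := gauss_le_aff_iff.1 h (constEmb ζ)
    rw [nearPt_some_rad, sub_self, norm_zero, max_eq_left (Real.exp_pos _).le] at this
    have h1 : Real.exp (-τ) < 1 := by simpa using hτ
    exact absurd ((le_max_left _ _).trans this) (not_le.2 h1)
  rw [dir_of_not_le hle]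
  refine fun h => h (aff_le_disk_of_rad_le (Real.exp_pos _) ?_)
  rw [AffPoint.classical_rad]
  exact ha

theorem dir_nearPt_infty {τ : ℝ} (hτ : 0 < τ) :
    dir (.aff (nearPt OnePoint.infty τ)) (gaussPt : Berk 𝕃) =
      {T | ∃ u, T = .aff u ∧ u.rad 0 < Real.exp τ} := by
  refine dir_disk_of_rad_lt (Real.exp_pos _) ?_
  rw [AffPoint.gauss_rad]
  simpa using hτ

/-- Two fibers span the pencil: one over a lift of the value at `ζ`, the other over a lift of a
different point. Their behaviour on a common range of `τ` controls all members at once, so `τ` does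
not depend on `w`. -/
theorem IsRep.exists_forall_le_nearCount (hr : IsRep g P Q) (hn : NonDeg (redPoly P) (redPoly Q))
    (hh : h = RatFunc.C (c : 𝕃) * g + RatFunc.C b) (ζ : OnePoint ℂ) :
    ∃ τ, 0 < τ ∧ ∀ w : OnePoint 𝕃,
      baseOrd ζ (redPoly P) (redPoly Q) ≤ nearCount (fiberPoly h.num h.denom w) τ ζ := by
  obtain ⟨v, hv⟩ := hr.exists_isVal hn ζ
  obtain ⟨u, hu⟩ := exists_ne v
  have hlift : ∀ y : OnePoint ℂ, ∃ (w : OnePoint 𝕃) (F : intRing[X]) (e : 𝕃), e ≠ 0 ∧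
      fiberPoly h.num h.denom w = C e * toL F ∧
        redPoly F = fiberPoly (redPoly P) (redPoly Q) y := by
    intro y
    obtain ⟨x, hx⟩ := redPt_surjective y
    obtain ⟨w, hw⟩ := affCoord_surjective c b x
    obtain ⟨F, e, he, h1, h2⟩ := hr.exists_fiberPoly_num_denom hh w
    exact ⟨w, F, e, he, h1, by rw [h2, hw, hx]⟩
  obtain ⟨w₀, F₀, e₀, he₀, h₀, h₀'⟩ := hlift v
  obtain ⟨w₁, F₁, e₁, he₁, h₁, h₁'⟩ := hlift u
  have hF₀ : redPoly F₀ ≠ 0 := by rw [h₀']; exact hn v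
  have hF₁ : redPoly F₁ ≠ 0 := by rw [h₁']; exact hn u
  have hord : ordAt ζ (redPoly F₁) = baseOrd ζ (redPoly P) (redPoly Q) := by
    rw [h₁']
    refine le_antisymm (not_lt.1 fun h' => hu ?_) (hn.baseOrd_le_fiber ζ u)
    exact IsVal.unique hn (ζ := ζ) h' hv
  -- If the lifts were equal, `F₀` and `F₁` would be proportional with a unit factor, and so would
  -- be the members of the reduced pencil at `v` and `u`.
  have hww : w₀ ≠ w₁ := by
    rintro rfl
    have h2 : toL F₁ = C (e₁⁻¹ * e₀) * toL F₀ := by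
      rw [C_mul, mul_assoc, ← h₀, h₁, ← mul_assoc, ← C_mul, inv_mul_cancel₀ he₁, C_1, one_mul]
    have h3 : ‖e₁⁻¹ * e₀‖ = 1 := by
      have := congrArg AffPoint.gauss.sn h2
      rw [map_mul, AffPoint.map_C, (redPoly_ne_zero_iff F₀).1 hF₀,
        (redPoly_ne_zero_iff F₁).1 hF₁, mul_one] at this
      exact this.symm
    have h4 : F₁ = C ⟨e₁⁻¹ * e₀, h3.le⟩ * F₀ := toL_injective (by rw [map_mul, toL_C]; exact h2)
    have h5 := congrArg redPoly h4
    rw [map_mul, redPoly_C, h₀', h₁', ← one_mul (fiberPoly _ _ u), ← C_1] at h5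
    exact hu (hn.fiber_injective one_ne_zero h5)
  obtain ⟨ε, hε, hε'⟩ := (mem_nhdsGT_iff_exists_Ioo_subset).1
    ((eventually_sn_nearPt hF₀ ζ).and (eventually_sn_nearPt hF₁ ζ))
  have hε : 0 < ε := hε
  refine ⟨ε / 2, by positivity, fun w => ?_⟩
  obtain ⟨l, k, hlk⟩ := exists_fiberPoly_comb h.num h.denom hww w
  rw [h₀, h₁, ← mul_assoc, ← mul_assoc, ← C_mul, ← C_mul] at hlk
  rw [IsVal, ← h₀', ← hord] at hv
  rw [← hord]
  exact le_nearCount_of_comb hv (fun σ h1 h2 => (hε' ⟨h1, h2⟩).1) (fun σ h1 h2 => (hε' ⟨h1, h2⟩).2)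
    hlk (hr.nonDeg_num_denom hn hh w) (by positivity) (by linarith)

theorem nearCount_le_solCount (hn : NonDeg h.num h.denom) (w : OnePoint 𝕃) (ζ : OnePoint ℂ) {τ : ℝ}
    (hτ : 0 < τ) : nearCount (fiberPoly h.num h.denom w) τ ζ + inftyDeg (ratDeg h) ζ ≤
      solCount h w (dirAt 1 0 ζ \ dir (.aff (nearPt ζ τ)) gaussPt) := by
  classical
  have := finsum_localDegP1 (RatFunc.isCoprime_num_denom h) hn w
    {z | classicalPt z ∈ dirAt 1 0 ζ \ dir (.aff (nearPt ζ τ)) gaussPt}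
  simp only [Set.mem_ofPred_eq] at this
  rw [solCount]
  simp only [Set.mem_ofPred_eq]
  rw [this]
  match ζ with
  | OnePoint.some ζ =>
    simp only [nearCount, inftyDeg]
    rw [add_zero, Nat.cast_le]
    refine le_add_right (Multiset.card_le_card (Multiset.monotone_filter_right _ ?_))
    intro a ha
    refine ⟨?_, classicalPt_notMem_dir_nearPt_some hτ ha⟩
    rw [classicalPt_mem_dirAt_gauss_iff, redPt_eq_some_iff]
    exact ha.trans_lt (by simpa using hτ)
  | OnePoint.infty =>
    have h1 : classicalPt (OnePoint.infty : OnePoint 𝕃) ∈ dirAt 1 0 OnePoint.infty \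
        dir (.aff (nearPt OnePoint.infty τ)) gaussPt := by
      refine ⟨by rw [classicalPt_mem_dirAt_gauss_iff, redPt_infty], ?_⟩
      rw [dir_nearPt_infty hτ]
      rintro ⟨u, hu, -⟩
      cases hu
    rw [if_pos h1]
    simp only [nearCount, inftyDeg]
    set F := fiberPoly h.num h.denom w with hF
    have h2 : F.natDegree ≤ ratDeg h := natDegree_fiberPoly_le _ _ w
    have h3 := (IsAlgClosed.splits F).natDegree_eq_card_roots
    have h4 := congrArg Multiset.card
      (Multiset.filter_add_not (fun a : 𝕃 => ‖a‖ < Real.exp τ) F.roots)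
    rw [Multiset.card_add] at h4
    have h5 : (F.roots.filter fun a : 𝕃 => ¬ ‖a‖ < Real.exp τ).card ≤
        (F.roots.filter fun a : 𝕃 => classicalPt (OnePoint.some a) ∈ dirAt 1 0 OnePoint.infty \
          dir (.aff (nearPt OnePoint.infty τ)) gaussPt).card := by
      refine Multiset.card_le_card (Multiset.monotone_filter_right _ ?_)
      intro a ha
      rw [not_lt] at ha
      constructor
      · rw [classicalPt_mem_dirAt_gauss_iff, redPt_eq_infty_iff]
        exact lt_of_lt_of_le (by simpa using hτ) ha
      · rw [dir_nearPt_infty hτ]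
        rintro ⟨u, hu, hu'⟩
        injection hu with hu
        rw [← hu, AffPoint.classical_rad] at hu'
        simp at hu'
        exact absurd ha (not_le.2 hu')
    rw [ratDeg] at h2 ⊢
    omega

end Count

/-! ### The local degree at the Gauss point -/

theorem dirAt_gauss_eq_dir {ζ : OnePoint ℂ} {T : Berk 𝕃} (h : T ∈ dirAt 1 0 ζ) :
    dirAt 1 0 ζ = dir gaussPt T := by
  rw [gaussPt_eq_diskPt]
  exact dirAt_eq_dir h

theorem disjoint_dirAt (c : 𝕃ˣ) (b : 𝕃) {y y' : OnePoint ℂ} (h : y ≠ y') :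
    Disjoint (dirAt c b y) (dirAt c b y') :=
  Set.disjoint_left.2 fun _ hT hT' => h (dirAt_injective_of_mem hT hT')

theorem dirAt_nonempty (c : 𝕃ˣ) (b : 𝕃) (y : OnePoint ℂ) : (dirAt c b y).Nonempty := by
  obtain ⟨z, hz⟩ := exists_classicalPt_mem_dirAt c b y
  exact ⟨_, hz⟩

/-- A direction at `S` that contains the Gauss point contains all directions at the Gauss point
except possibly the one towards `S`. Finite intersections and unions of open sets preserve
finiteness of the exceptions. -/
theorem finite_not_dirAt_subset {N : Set (Berk 𝕃)} (hN : IsOpen N) (hG : gaussPt ∈ N) :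
    {ζ | ¬ dirAt 1 0 ζ ⊆ N}.Finite := by
  induction hN with
  | basic U hU =>
    obtain ⟨S, S', hne, rfl⟩ := hU
    have hS : S ≠ gaussPt := fun h => notMem_dir_self S S' (h ▸ hG)
    obtain ⟨ζ₀, hζ₀⟩ := exists_mem_dirAt (c := 1) (b := 0) (T := S) (by rwa [← gaussPt_eq_diskPt])
    refine (Set.finite_singleton ζ₀).subset fun ζ hζ => ?_
    by_contra hne'
    apply hζ
    obtain ⟨T, hT⟩ := dirAt_nonempty 1 0 ζ
    have hT' : T ≠ gaussPt := by
      rw [gaussPt_eq_diskPt]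
      exact ne_of_mem_dirAt hT
    rw [dirAt_gauss_eq_dir hT, ← dir_eq_of_mem hne hG]
    refine dir_subset_dir hT' hS ?_
    rw [← dirAt_gauss_eq_dir hT]
    exact fun h => hne' (dirAt_injective_of_mem h hζ₀)
  | univ => simp
  | inter U V _ _ ihU ihV =>
    refine ((ihU hG.1).union (ihV hG.2)).subset fun ζ hζ => ?_
    by_contra h
    simp only [Set.mem_union, Set.mem_ofPred_eq, not_or, not_not] at h
    exact hζ (Set.subset_inter h.1 h.2)
  | sUnion 𝒰 _ ih =>
    obtain ⟨U, hU, hGU⟩ := hG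
    exact (ih U hU hGU).subset fun ζ hζ h => hζ (h.trans (Set.subset_sUnion_of_mem hU))

namespace IsFrame

variable {f A g : RatFunc 𝕃} {c : 𝕃ˣ} {b : 𝕃} {α β γ δ : intRing} {P Q : intRing[X]}

theorem nonDeg_num_denom (hF : IsFrame f A g c b α β γ δ P Q) : NonDeg f.num f.denom :=
  hF.rep.nonDeg_num_denom hF.nonDeg hF.eq

/-- Choose a value `y` of the reduction that is not taken at the finitely many directions not
contained in `N`, and a lift `w`. All directions over `y` lie in `N` and contribute at least their
local degrees. -/
theorem exists_phiDegree_le_solCount (hF : IsFrame f A g c b α β γ δ P Q) {N : Set (Berk 𝕃)}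
    (hN : IsOpen N) (hG : gaussPt ∈ N) :
    ∃ w, phiDegree (ratComp A f) ≤ solCount f w N := by
  classical
  have hinf : Infinite (OnePoint ℂ) := Infinite.of_injective _ OnePoint.coe_injective
  obtain ⟨y, hy⟩ := ((finite_not_dirAt_subset hN hG).image (phi (ratComp A f))).exists_notMem
  obtain ⟨w, hw⟩ := exists_classicalPt_mem_dirAt c b
    (mob (redHom α) (redHom β) (redHom γ) (redHom δ) y)
  refine ⟨w, ?_⟩
  have hfin := finite_fiber_phi hF.nonDeg_red y
  have h1 := finsum_phiDeg hF.nonDeg_red y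
  rw [← h1, finsum_mem_eq_sum_of_inter_support_eq (t := hfin.toFinset) _ (by ext; simp)]
  refine le_trans (Finset.sum_le_sum (g := fun ζ => solCount f w (dirAt 1 0 ζ)) fun ζ hζ => ?_)
    (sum_solCount_le hF.nonDeg_num_denom w hfin.toFinset (fun ζ => dirAt 1 0 ζ) N ?_ ?_)
  · have hζ' : phi (ratComp A f) ζ = y := by simpa using hζ
    rw [hF.solCount_eq, hζ', IsIwasawa.imageDir, if_pos hw]
    exact Nat.le_add_right _ _
  · intro ζ hζ
    by_contra h
    exact hy ⟨ζ, h, by simpa using hζ⟩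
  · intro ζ _ ζ' _ h
    exact disjoint_dirAt 1 0 h

/-- Cut off, in the direction of each hole, a part where every equation `f = w` has at least as many
solutions as the multiplicity of the hole. The degree of `f` is the sum of these multiplicities and
the degree of the reduction, so at most the latter remains. -/
theorem exists_solCount_le_phiDegree (hF : IsFrame f A g c b α β γ δ P Q) :
    ∃ N : Set (Berk 𝕃), IsOpen N ∧ gaussPt ∈ N ∧
      ∀ w, solCount f w N ≤ phiDegree (ratComp A f) := by
  classical
  choose τ hτ hτ' using hF.rep.exists_forall_le_nearCount hF.nonDeg hF.eq
  set T := (finite_support_ordH (ratComp A f)).toFinset with hT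
  have hne : ∀ ζ, gaussPt ≠ Berk.aff (nearPt ζ (τ ζ)) := fun ζ h => by
    have := ne_of_mem_dirAt (aff_nearPt_mem_dirAt ζ (hτ ζ))
    rw [← gaussPt_eq_diskPt] at this
    exact this h.symm
  refine ⟨⋂ ζ ∈ T, dir (.aff (nearPt ζ (τ ζ))) gaussPt,
    isOpen_biInter_finset fun ζ _ => isOpen_dir (hne ζ),
    Set.mem_iInter₂.2 fun ζ _ => mem_dir_of_ne (hne ζ), fun w => ?_⟩
  have hle : ∀ ζ, ordH (ratComp A f) ζ ≤
      solCount f w (dirAt 1 0 ζ \ dir (.aff (nearPt ζ (τ ζ))) gaussPt) := by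
    intro ζ
    have h1 := nearCount_le_solCount hF.nonDeg_num_denom w ζ (hτ ζ)
    have h2 := hτ' ζ w
    have h3 := hF.ordH_eq ζ
    omega
  have hsum := finsum_ordH hF.nonDeg_red
  rw [finsum_eq_sum _ (finite_support_ordH (ratComp A f)), ← hF.ratDeg_eq,
    ← solCount_univ hF.nonDeg_num_denom w, ← hT] at hsum
  -- The index `none` stands for the neighbourhood of the Gauss point, the other indices for the
  -- parts cut off; these sets are disjoint.
  set N : Option (OnePoint ℂ) → Set (Berk 𝕃) := fun i => i.elim
    (⋂ ζ ∈ T, dir (.aff (nearPt ζ (τ ζ))) gaussPt)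
    fun ζ => dirAt 1 0 ζ \ dir (.aff (nearPt ζ (τ ζ))) gaussPt with hN
  have hdisj : ∀ ζ ∈ T, Disjoint (N none) (N (some ζ)) := fun ζ hζ =>
    Set.disjoint_left.2 fun S hS hS' => hS'.2 (Set.mem_iInter₂.1 hS ζ hζ)
  have := sum_solCount_le hF.nonDeg_num_denom w (Finset.insertNone T) N Set.univ
    (fun _ _ => Set.subset_univ _) ?_
  · rw [Finset.sum_insertNone] at this
    have h2 : ∑ ζ ∈ T, ordH (ratComp A f) ζ ≤ ∑ ζ ∈ T, solCount f w (N (some ζ)) :=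
      Finset.sum_le_sum fun ζ _ => hle ζ
    change solCount f w (N none) ≤ _
    omega
  · rintro (_ | ζ) hi (_ | ζ') hj hij
    · exact absurd rfl hij
    · exact hdisj ζ' (by simpa using hj)
    · exact (hdisj ζ (by simpa using hi)).symm
    · exact (disjoint_dirAt 1 0 fun e => hij (by rw [e])).mono Set.sdiff_subset Set.sdiff_subset

theorem berkLocalDeg_eq (hF : IsFrame f A g c b α β γ δ P Q) :
    berkLocalDeg f gaussPt = phiDegree (ratComp A f) := by
  obtain ⟨N, hN, hG, hw⟩ := hF.exists_solCount_le_phiDegree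
  refine le_antisymm (Nat.sInf_le ⟨N, hN, hG, hw⟩) ?_
  refine le_csInf ⟨_, N, hN, hG, hw⟩ ?_
  rintro n ⟨N', hN', hG', hw'⟩
  obtain ⟨w, hw⟩ := hF.exists_phiDegree_le_solCount hN' hG'
  exact hw.trans (hw' w)

end IsFrame

/-! ### Möbius transformations with constant reduction -/

section Ratio

variable {k : Type*} [Field k]

open Classical in
/-- The point of the projective line with homogeneous coordinates `u`, `v`. -/
def ratioPt (u v : k) : OnePoint k := if v = 0 then OnePoint.infty else OnePoint.some (u / v)

theorem ratioPt_zero (u : k) : ratioPt u 0 = OnePoint.infty := if_pos rfl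

theorem ratioPt_of_ne (u : k) {v : k} (h : v ≠ 0) : ratioPt u v = OnePoint.some (u / v) := if_neg h

open Classical in
theorem mob_ratioPt (α β γ δ : k) {u v : k} (h : u ≠ 0 ∨ v ≠ 0) :
    mob α β γ δ (ratioPt u v) = ratioPt (α * u + β * v) (γ * u + δ * v) := by
  by_cases hv : v = 0
  · have hu : u ≠ 0 := by simpa [hv] using h
    subst hv
    rw [ratioPt_zero, mob.eq_def, ratioPt]
    refine if_congr (by simp [hu]) rfl ?_
    rw [mul_zero, mul_zero, add_zero, add_zero, mul_div_mul_right _ _ hu]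
  · rw [ratioPt_of_ne _ hv, mob.eq_def, ratioPt]
    have e : γ * (u / v) + δ = (γ * u + δ * v) / v := by field_simp
    have e' : α * (u / v) + β = (α * u + β * v) / v := by field_simp
    refine if_congr (by rw [e, div_eq_zero_iff, or_iff_left hv]) rfl ?_
    rw [e, e', div_div_div_cancel_right₀ hv]

open Classical in
theorem evalP1_C_C (u v : k) (ζ : OnePoint k) : evalP1 (C u) (C v) ζ = ratioPt u v := by
  match ζ with
  | OnePoint.some z => exact if_congr (by rw [eval_C]) rfl (by rw [eval_C, eval_C])
  | OnePoint.infty => exact if_congr (by simp) rfl (by simp)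

end Ratio

theorem reduction_of_eq_mul {A : RatFunc 𝕃} {u v : ℂ} {l : ℂ[X]} (hl : l ≠ 0)
    (huv : u ≠ 0 ∨ v ≠ 0) (h1 : redNum A = C u * l) (h2 : redDen A = C v * l) :
    (∀ ζ, phi A ζ = ratioPt u v) ∧ (∀ ζ, (redGcd A).rootMultiplicity ζ = l.rootMultiplicity ζ) ∧
      max (redNum A).natDegree (redDen A).natDegree = l.natDegree := by
  have hdvd : redGcd A ∣ l := by
    have ha : redGcd A ∣ C u * l := h1 ▸ EuclideanDomain.gcd_dvd_left _ _
    have hb : redGcd A ∣ C v * l := h2 ▸ EuclideanDomain.gcd_dvd_right _ _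
    rcases huv with h | h
    · exact ((isUnit_C.2 h.isUnit).dvd_mul_left).1 ha
    · exact ((isUnit_C.2 h.isUnit).dvd_mul_left).1 hb
  have hdvd' : l ∣ redGcd A :=
    EuclideanDomain.dvd_gcd (h1 ▸ dvd_mul_left _ _) (h2 ▸ dvd_mul_left _ _)
  obtain ⟨e, he⟩ := associated_of_dvd_dvd hdvd' hdvd
  obtain ⟨k, hk, hk'⟩ := isUnit_iff.1 e.isUnit
  have hk0 : k ≠ 0 := hk.ne_zero
  have hgcd : redGcd A = C k * l := by rw [← he, ← hk', mul_comm]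
  have hinv : C k * C k⁻¹ = (1 : ℂ[X]) := by rw [← C_mul, mul_inv_cancel₀ hk0, C_1]
  have hgne : redGcd A ≠ 0 := by
    rw [hgcd]
    exact mul_ne_zero (C_ne_zero.2 hk0) hl
  have hN : phiNum A = C (k⁻¹ * u) := by
    apply mul_left_cancel₀ hgne
    rw [redGcd_mul_phiNum, h1, hgcd, C_mul]
    linear_combination (-(l * C u)) * hinv
  have hD : phiDen A = C (k⁻¹ * v) := by
    apply mul_left_cancel₀ hgne
    rw [redGcd_mul_phiDen, h2, hgcd, C_mul]
    linear_combination (-(l * C v)) * hinv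
  refine ⟨fun ζ => ?_, fun ζ => ?_, ?_⟩
  · rw [phi, hN, hD, evalP1_C_C, ratioPt, ratioPt, mul_div_mul_left _ _ (inv_ne_zero hk0)]
    simp [hk0]
  · have := ordAt_C_mul (OnePoint.some ζ) hk0 l
    rw [hgcd]
    exact Int.ofNat_inj.1 this
  · rw [h1, h2]
    rcases huv with h | h
    · rw [natDegree_C_mul h]
      exact max_eq_left (natDegree_C_mul_le _ _)
    · rw [natDegree_C_mul h]
      exact max_eq_right (natDegree_C_mul_le _ _)

namespace IsIwasawa

variable {A : RatFunc 𝕃} {c : 𝕃ˣ} {b : 𝕃} {α β γ δ : intRing}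

/-- The reduction of `A`, if the reduction of `(X - b) / c` is the constant `u / v`. -/
theorem reduction (hI : IsIwasawa A c b α β γ δ) {s t q : intRing} (hs : (s : 𝕃) ≠ 0)
    (ht : (t : 𝕃) = -(b * s)) (hq : (q : 𝕃) = c * s) {u v : ℂ} {l : ℂ[X]} (hl : l ≠ 0)
    (huv : u ≠ 0 ∨ v ≠ 0) (h1 : C (redHom s) * X + C (redHom t) = C u * l)
    (h2 : C (redHom q) = C v * l) :
    mob (redHom α) (redHom β) (redHom γ) (redHom δ) (constPt A) = ratioPt u v ∧
      (∀ ζ : ℂ, ordH A (OnePoint.some ζ) = l.rootMultiplicity ζ) ∧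
      ordH A OnePoint.infty = 1 - l.natDegree := by
  have hq0 : (q : 𝕃) ≠ 0 := by rw [hq]; exact mul_ne_zero c.ne_zero hs
  have hP : toL (C s * X + C t) = C (s : 𝕃) * X + C (t : 𝕃) := by
    simp only [map_add, map_mul, toL_C, toL_X]
  have hQ : toL (C q) = C (q : 𝕃) := toL_C q
  have hr : IsRep (algebraMap 𝕃[X] (RatFunc 𝕃) (toL (C s * X + C t)) /
      algebraMap 𝕃[X] (RatFunc 𝕃) (toL (C q))) (C s * X + C t) (C q) := by
    refine ⟨?_, ?_, rfl, ?_⟩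
    · rw [hQ]
      exact (isCoprime_one_right (x := _)).of_isCoprime_of_dvd_right (isUnit_C.2 hq0.isUnit).dvd
    · rw [hQ]
      exact C_ne_zero.2 hq0
    · simp only [map_add, map_mul, redPoly_C, redPoly_X]
      rw [h1, h2]
      exact huv.imp (fun h => mul_ne_zero (C_ne_zero.2 h) hl)
        fun h => mul_ne_zero (C_ne_zero.2 h) hl
  have hn : NonDeg (toL (C s * X + C t)) (toL (C q)) := by
    intro w h0
    match w with
    | OnePoint.infty => exact hr.den_ne h0
    | OnePoint.some w =>
      have := congrArg (fun p => p.coeff 1) h0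
      simp [fiberPoly, hP, hQ, coeff_C] at this
      exact hs (by rw [this]; rfl)
  have hX : RatFunc.X = RatFunc.C (c : 𝕃) * (algebraMap 𝕃[X] (RatFunc 𝕃) (toL (C s * X + C t)) /
      algebraMap 𝕃[X] (RatFunc 𝕃) (toL (C q))) + RatFunc.C b := by
    have hs' : (RatFunc.C (s : 𝕃)) ≠ 0 := (_root_.map_ne_zero _).2 hs
    have hc' : (RatFunc.C (c : 𝕃)) ≠ 0 := (_root_.map_ne_zero _).2 c.ne_zero
    rw [hP, hQ, ht, hq]
    simp only [map_add, map_mul, RatFunc.algebraMap_C, RatFunc.algebraMap_X, map_neg]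
    field_simp
    ring
  -- With `X` in the role of `f`, the composite is `A` itself.
  have hu := hI.isUnimodular hr hn hX
  rw [ratComp_X] at hu
  obtain ⟨e, he, h3, h4⟩ := hu.rep.exists_red
  rw [redPoly_comb] at h3 h4
  simp only [map_add, map_mul, redPoly_C, redPoly_X, h1, h2, map_neg] at h3 h4
  have hinv : C e⁻¹ * C e = (1 : ℂ[X]) := by rw [← C_mul, inv_mul_cancel₀ he, C_1]
  have hne : ∀ x : ℂ, e⁻¹ * x ≠ 0 ↔ x ≠ 0 := fun x => by simp [he]
  have hdet := hI.det
  have huv' : redHom δ * u + -redHom β * v ≠ 0 ∨ -redHom γ * u + redHom α * v ≠ 0 := by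
    by_contra! h0
    have hu0 : (redHom α * redHom δ - redHom β * redHom γ) * u = 0 := by
      linear_combination redHom α * h0.1 + redHom β * h0.2
    have hv0 : (redHom α * redHom δ - redHom β * redHom γ) * v = 0 := by
      linear_combination redHom γ * h0.1 + redHom δ * h0.2
    exact huv.elim (fun h => h ((mul_eq_zero.1 hu0).resolve_left hdet))
      fun h => h ((mul_eq_zero.1 hv0).resolve_left hdet)
  obtain ⟨hphi, hroot, hdeg⟩ := reduction_of_eq_mul (A := A)
    (u := e⁻¹ * (redHom δ * u + -redHom β * v)) (v := e⁻¹ * (-redHom γ * u + redHom α * v)) hl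
    (huv'.imp (hne _).2 (hne _).2)
    (by
      simp only [C_mul, C_add, C_neg] at h3 ⊢
      linear_combination (-redNum A) * hinv - C e⁻¹ * h3)
    (by
      simp only [C_mul, C_add, C_neg] at h4 ⊢
      linear_combination (-redDen A) * hinv - C e⁻¹ * h4)
  refine ⟨?_, hroot, by simp only [ordH]; rw [hI.deg, hdeg]⟩
  have hconst : constPt A = ratioPt (e⁻¹ * (redHom δ * u + -redHom β * v))
      (e⁻¹ * (-redHom γ * u + redHom α * v)) := by
    have := Classical.epsilon_spec (p := fun a => ∀ ζ, phi A ζ = a) ⟨_, hphi⟩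
    exact (this OnePoint.infty).symm.trans (hphi _)
  rw [hconst]
  have : ratioPt (e⁻¹ * (redHom δ * u + -redHom β * v)) (e⁻¹ * (-redHom γ * u + redHom α * v)) =
      mob (redHom δ) (-redHom β) (-redHom γ) (redHom α) (ratioPt u v) := by
    rw [mob_ratioPt _ _ _ _ huv, ratioPt, ratioPt, mul_div_mul_left _ _ (inv_ne_zero he)]
    simp [he]
  rw [this, mob_mob_inv hI.det]

theorem holePt_eq {x : OnePoint ℂ} (h : ∀ ζ, ordH A ζ ≠ 0 ↔ ζ = x) : holePt A = x :=
  (h _).1 (Classical.epsilon_spec (p := fun ζ => ordH A ζ ≠ 0) ⟨x, (h x).2 rfl⟩)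

theorem holePt_eq_infty (h1 : ∀ ζ : ℂ, ordH A (OnePoint.some ζ) = rootMultiplicity ζ 1)
    (h2 : ordH A OnePoint.infty = 1 - natDegree (1 : ℂ[X])) : holePt A = OnePoint.infty := by
  refine holePt_eq fun ζ => ?_
  match ζ with
  | OnePoint.infty => rw [h2]; simp
  | OnePoint.some ζ =>
    rw [h1, ← C_1, rootMultiplicity_C]
    simp

/-- The disk of `diskPt c b` is contained in the unit disk, contains it, or is disjoint from it;
equality is excluded. In the first case the hole is the residue of `b` and `(z - b) / c` reduces to
`∞`; in the second the hole is `∞` and the constant is the residue of `-b / c`; in the third both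
are `∞`. -/
theorem hole_mem (hI : IsIwasawa A c b α β γ δ) (hne : diskPt c b ≠ gaussPt) :
    diskPt c b ∈ dirAt 1 0 (holePt A) ∧ gaussPt ∈ imageDir c b α β γ δ (constPt A) := by
  have hc := norm_unit_pos c
  have hinfty : ‖(c : 𝕃)‖ < max 1 ‖b‖ → gaussPt ∈ dirAt c b OnePoint.infty := by
    intro h
    change ¬ _
    rw [diskPt, gaussPt, aff_le_disk_iff, AffPoint.gauss_rad, not_le]
    exact h
  have hinfty' : 1 < max ‖(c : 𝕃)‖ ‖b‖ → diskPt c b ∈ dirAt 1 0 OnePoint.infty := by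
    intro h
    change ¬ _
    rw [← gaussPt_eq_diskPt, diskPt, aff_le_gauss_iff, AffPoint.disk_rad, not_le]
    simpa using h
  have large : 1 < ‖(c : 𝕃)‖ → ‖b‖ ≤ ‖(c : 𝕃)‖ →
      diskPt c b ∈ dirAt 1 0 (holePt A) ∧ gaussPt ∈ imageDir c b α β γ δ (constPt A) := by
    intro h hbc
    have hc1 : ‖(c : 𝕃)⁻¹‖ < 1 := by rw [norm_inv]; exact inv_lt_one_of_one_lt₀ h
    have hq : ‖b / c‖ ≤ 1 := by
      rw [norm_div]
      exact div_le_one_of_le₀ hbc (norm_nonneg _)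
    obtain ⟨h1, h2, h3⟩ := hI.reduction (s := ⟨(c : 𝕃)⁻¹, hc1.le⟩) (t := -⟨b / c, hq⟩) (q := 1)
      (u := -redC (b / c)) (v := 1) (l := 1) (inv_ne_zero c.ne_zero)
      (by rw [Subring.coe_neg]; exact congrArg Neg.neg (div_eq_mul_inv _ _))
      (by simp) one_ne_zero (Or.inr one_ne_zero)
      (by rw [(redHom_eq_zero_iff _).2 hc1, map_neg, redHom_apply]; simp) (by simp)
    rw [holePt_eq_infty h2 h3, imageDir, h1, ratioPt_of_ne _ one_ne_zero, div_one]
    refine ⟨hinfty' (h.trans_le (le_max_left _ _)), _, rfl, ?_⟩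
    rw [AffPoint.gauss_rad, map_neg,
      show b + (c : 𝕃) * -constEmb (redC (b / c)) = c * (b / c - constEmb (redC (b / c))) by
        rw [mul_sub, mul_div_cancel₀ _ c.ne_zero]; ring, norm_mul]
    exact max_lt h (mul_lt_of_lt_one_right hc (norm_sub_redC_lt hq))
  by_cases hb : ‖b‖ ≤ 1
  · rcases lt_trichotomy ‖(c : 𝕃)‖ 1 with h | h | h
    · have hc0 : redHom ⟨c, h.le⟩ = 0 := (redHom_eq_zero_iff _).2 h
      obtain ⟨h1, h2, h3⟩ := hI.reduction (s := 1) (t := -⟨b, hb⟩) (q := ⟨c, h.le⟩) (u := 1)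
        (v := 0) (l := X - C (redC b)) one_ne_zero (by simp) (by simp) (X_sub_C_ne_zero _)
        (Or.inl one_ne_zero) (by rw [map_neg, map_one, redHom_apply]; simp [sub_eq_add_neg]) (by rw [hc0]; simp)
      constructor
      · rw [holePt_eq (x := OnePoint.some (redC b))]
        · refine ⟨_, rfl, ?_⟩
          rw [AffPoint.disk_rad, Units.val_one, norm_one, zero_add, one_mul, norm_sub_rev]
          exact max_lt h (norm_sub_redC_lt hb)
        · intro ζ
          match ζ with
          | OnePoint.infty =>
            rw [h3]
            simp
          | OnePoint.some ζ =>
            rw [h2, rootMultiplicity_X_sub_C, OnePoint.coe_eq_coe]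
            simp
      · rw [imageDir, h1, ratioPt_zero]
        exact hinfty (h.trans_le (le_max_left _ _))
    · exact absurd (by
        rw [gaussPt, AffPoint.gauss_eq_disk, diskPt]
        congr 1
        refine AffPoint.ext_rad fun w => ?_
        rw [AffPoint.disk_rad, AffPoint.disk_rad, h, sub_zero]
        exact max_norm_eq_of_norm_sub_le (by simpa using hb)) hne
    · exact large h (hb.trans h.le)
  · rw [not_le] at hb
    rcases lt_or_ge ‖(c : 𝕃)‖ ‖b‖ with h | h
    · have hb0 : b ≠ 0 := norm_pos_iff.1 (zero_lt_one.trans hb)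
      have hb1 : ‖b⁻¹‖ < 1 := by rw [norm_inv]; exact inv_lt_one_of_one_lt₀ hb
      have hc1 : ‖(c : 𝕃) / b‖ < 1 := by rw [norm_div]; exact (div_lt_one (norm_pos_iff.2 hb0)).2 h
      obtain ⟨h1, h2, h3⟩ := hI.reduction (s := ⟨b⁻¹, hb1.le⟩) (t := -1) (q := ⟨c / b, hc1.le⟩)
        (u := -1) (v := 0) (l := 1) (inv_ne_zero hb0) (by simp [hb0]) (div_eq_mul_inv _ _)
        one_ne_zero (Or.inl (by simp)) (by rw [(redHom_eq_zero_iff _).2 hb1]; simp)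
        (by rw [(redHom_eq_zero_iff _).2 hc1]; simp)
      rw [holePt_eq_infty h2 h3, imageDir, h1, ratioPt_zero]
      exact ⟨hinfty' (hb.trans_le (le_max_right _ _)), hinfty (h.trans_le (le_max_right _ _))⟩
    · exact large (hb.trans_le h) h

end IsIwasawa

/-! ### Purely atomic measures -/

section Atomic

variable {X : Type*} [MeasurableSpace X]

/-- A measure that is the sum of its point masses. -/
def IsAtomic (ω : Measure X) : Prop := ∀ s, ω s = ∑' a, s.indicator (fun a => ω {a}) a

variable [DiscreteMeasurableSpace X]

theorem isAtomic_dirac (x : X) : IsAtomic (Measure.dirac x) := by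
  intro s
  rw [tsum_eq_single x]
  · by_cases hx : x ∈ s
    · simp [hx, Set.indicator_of_mem]
    · simp [hx]
  · intro y hy
    by_cases h : y ∈ s
    · rw [Set.indicator_of_mem h, Measure.dirac_apply, Set.indicator_of_notMem]
      exact fun h => hy (Set.mem_singleton_iff.1 h).symm
    · exact Set.indicator_of_notMem h _

theorem IsAtomic.sum {ι : Type*} {ω : ι → Measure X} (h : ∀ i, IsAtomic (ω i)) :
    IsAtomic (Measure.sum ω) := by
  intro s
  rw [Measure.sum_apply _ (.of_discrete), tsum_congr fun i => h i s, ENNReal.tsum_comm]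
  refine tsum_congr fun a => ?_
  by_cases ha : a ∈ s
  · simp only [Set.indicator_of_mem ha]
    rw [Measure.sum_apply _ (.of_discrete)]
  · simp only [Set.indicator_of_notMem ha, tsum_zero]

theorem IsAtomic.smul {ω : Measure X} (h : IsAtomic ω) (r : ℝ≥0∞) : IsAtomic (r • ω) := by
  intro s
  rw [Measure.smul_apply, h s, smul_eq_mul, ← ENNReal.tsum_mul_left]
  refine tsum_congr fun a => ?_
  by_cases ha : a ∈ s
  · simp only [Set.indicator_of_mem ha, Measure.smul_apply, smul_eq_mul]
  · simp only [Set.indicator_of_notMem ha, mul_zero]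

theorem IsAtomic.add {ω ω' : Measure X} (h : IsAtomic ω) (h' : IsAtomic ω') :
    IsAtomic (ω + ω') := by
  intro s
  rw [Measure.add_apply, h s, h' s, ← ENNReal.tsum_add]
  refine tsum_congr fun a => ?_
  by_cases ha : a ∈ s
  · simp only [Set.indicator_of_mem ha, Measure.add_apply]
  · simp only [Set.indicator_of_notMem ha, add_zero]

theorem IsAtomic.ext {ω ω' : Measure X} (h : IsAtomic ω) (h' : IsAtomic ω')
    (hs : ∀ a, ω {a} = ω' {a}) : ω = ω' := by
  ext s _
  rw [h s, h' s]
  simp only [hs]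

theorem IsAtomic.tsum_indicator {ω : Measure X} (h : IsAtomic ω) (s : Set X) (r : ℝ≥0∞) :
    ∑' a, s.indicator (fun _ => r) a * ω {a} = r * ω s := by
  rw [h s, ← ENNReal.tsum_mul_left]
  refine tsum_congr fun a => ?_
  by_cases ha : a ∈ s
  · simp only [Set.indicator_of_mem ha]
  · simp only [Set.indicator_of_notMem ha, zero_mul, mul_zero]

theorem IsAtomic.map {Y : Type*} [MeasurableSpace Y] [DiscreteMeasurableSpace Y] {ω : Measure X}
    (h : IsAtomic ω) (π : X → Y) : IsAtomic (ω.map π) := by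
  intro s
  have hm : ∀ t : Set Y, ω.map π t = ω (π ⁻¹' t) := fun t =>
    Measure.map_apply (Measurable.of_discrete) (.of_discrete)
  classical
  rw [hm, h]
  have : ∀ b, s.indicator (fun b => ω.map π {b}) b =
      ∑' a, (π ⁻¹' s).indicator (fun a => if π a = b then ω {a} else 0) a := by
    intro b
    by_cases hb : b ∈ s
    · rw [Set.indicator_of_mem hb, hm, h]
      refine tsum_congr fun a => ?_
      by_cases hab : π a = b
      · have h1 : a ∈ π ⁻¹' {b} := hab
        have h2 : a ∈ π ⁻¹' s := by rw [Set.mem_preimage, hab]; exact hb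
        rw [Set.indicator_of_mem h1, Set.indicator_of_mem h2, if_pos hab]
      · have h1 : a ∉ π ⁻¹' {b} := hab
        rw [Set.indicator_of_notMem h1]
        simp only [Set.indicator_apply, hab, if_false, ite_self]
    · rw [Set.indicator_of_notMem hb]
      symm
      refine ENNReal.tsum_eq_zero.2 fun a => ?_
      by_cases hab : π a = b
      · exact Set.indicator_of_notMem (fun h => hb (by rwa [Set.mem_preimage, hab] at h)) _
      · simp only [Set.indicator_apply, hab, if_false, ite_self]
  rw [tsum_congr this, ENNReal.tsum_comm]
  refine tsum_congr fun a => ?_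
  by_cases ha : a ∈ π ⁻¹' s
  · simp only [Set.indicator_of_mem ha]
    rw [tsum_eq_single (π a) fun b hb => if_neg hb.symm, if_pos rfl]
  · simp only [Set.indicator_of_notMem ha, tsum_zero]

/-- Countable additivity over distinct points gives an inequality only, because the space may be
uncountable. -/
theorem tsum_indicator_singleton_le (ω : Measure X) (s : Set X) :
    ∑' a, s.indicator (fun a => ω {a}) a ≤ ω s := by
  have h := tsum_meas_le_meas_iUnion_of_disjoint ω (As := fun a => s ∩ {a})
    (fun _ => .of_discrete) fun a b hab => Set.disjoint_left.2 fun x hx hx' =>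
      hab (((Set.mem_singleton_iff.1 hx.2).symm).trans (Set.mem_singleton_iff.1 hx'.2))
  refine (le_of_eq (tsum_congr fun a => ?_)).trans (h.trans (measure_mono ?_))
  · by_cases ha : a ∈ s
    · rw [Set.indicator_of_mem ha, Set.inter_eq_right.2 (Set.singleton_subset_iff.2 ha)]
    · rw [Set.indicator_of_notMem ha, Set.inter_singleton_eq_empty.2 ha, measure_empty]
  · exact Set.iUnion_subset fun a => Set.inter_subset_left

/-- A measure with the same point masses and the same finite total mass as an atomic measure is
equal to it. -/
theorem IsAtomic.eq_of_univ {ω ω' : Measure X} (h : IsAtomic ω)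
    (hs : ∀ a, ω {a} = ω' {a}) (hu : ω Set.univ = ω' Set.univ) (hfin : ω Set.univ ≠ ⊤) :
    ω = ω' := by
  -- Among the measures with given point masses the atomic one is the smallest. Applied to a set and
  -- to its complement, with equal finite total masses, this forces equality.
  have hle : ∀ s, ω s ≤ ω' s := by
    intro s
    rw [h s]
    simp only [hs]
    exact tsum_indicator_singleton_le ω' s
  ext s _
  refine le_antisymm (hle s) ?_
  have h1 := measure_add_measure_compl (μ := ω) (s := s) .of_discrete
  have h2 := measure_add_measure_compl (μ := ω') (s := s) .of_discrete
  have hfin' : ω sᶜ ≠ ⊤ := ne_top_of_le_ne_top hfin (measure_mono (Set.subset_univ _))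
  refine (ENNReal.add_le_add_iff_right hfin').1 ?_
  rw [h1, hu, ← h2]
  exact add_le_add le_rfl (hle sᶜ)

end Atomic

/-! ### Atoms of measures on the sphere -/

section Atoms

variable (μ : Measure (OnePoint ℂ)) [IsProbabilityMeasure μ]

theorem countable_atoms : {x | μ {x} ≠ 0}.Countable := by
  have h := tsum_meas_le_meas_iUnion_of_disjoint μ (As := fun x : OnePoint ℂ => {x})
    (fun _ => measurableSet_singleton _) fun a b hab => Set.disjoint_singleton.2 hab
  exact Summable.countable_support_ennreal (f := fun x => μ {x})
    (ne_top_of_le_ne_top (measure_ne_top _ _) h)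

theorem measurableSet_diffuse : MeasurableSet {x | μ {x} = 0} := by
  have := (countable_atoms μ).measurableSet.compl
  convert this using 1
  ext x
  simp

theorem tsum_add_diffuseMass : ∑' x, μ {x} + diffuseMass μ = 1 := by
  have hm := (countable_atoms μ).measurableSet
  have h1 : μ {x | μ {x} ≠ 0} = ∑' x, μ {x} := by
    rw [← tsum_subtype_eq_of_support_subset (s := {x | μ {x} ≠ 0}) fun x hx => hx,
      ← measure_biUnion (countable_atoms μ) (fun a _ b _ hab => Set.disjoint_singleton.2 hab)
        fun _ _ => measurableSet_singleton _, Set.biUnion_of_singleton]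
  rw [← h1, diffuseMass, show {x | μ {x} = 0} = {x | μ {x} ≠ 0}ᶜ by ext; simp,
    measure_add_measure_compl hm, measure_univ]

open Classical in
/-- The mass of the atomless part and the masses of the atoms other than `h`. -/
def weightOff (h : OnePoint ℂ) : Option (OnePoint ℂ) → ℝ≥0∞
  | none => diffuseMass μ
  | some x => if x = h then 0 else μ {x}

/-- The mass of the atomless part and the masses of the atoms. -/
def weight : Option (OnePoint ℂ) → ℝ≥0∞
  | none => diffuseMass μ
  | some x => μ {x}

theorem tsum_option {ι : Type*} (g : Option ι → ℝ≥0∞) : ∑' i, g i = g none + ∑' i, g (some i) := by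
  rw [← (Equiv.optionEquivSumPUnit.{0} ι).symm.tsum_eq, Summable.tsum_sum ENNReal.summable
    ENNReal.summable, add_comm]
  simp

theorem tsum_weight : ∑' i, weight μ i = 1 := by
  rw [tsum_option, add_comm]
  exact tsum_add_diffuseMass μ

theorem tsum_weightOff_add (h : OnePoint ℂ) : ∑' i, weightOff μ h i + μ {h} = 1 := by
  classical
  rw [← tsum_add_diffuseMass μ, tsum_option, add_assoc, add_comm]
  congr 1
  rw [← tsum_ite_eq h (fun x => μ {x})]
  rw [← ENNReal.tsum_add]
  refine tsum_congr fun x => ?_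
  by_cases hx : x = h
  · simp [weightOff, hx]
  · simp [weightOff, hx]

end Atoms

/-! ### Pullbacks under reductions -/

section Pullback

variable {h : RatFunc 𝕃}

theorem redPullback_singleton (h : RatFunc 𝕃) (μ : Measure (OnePoint ℂ)) (ζ : OnePoint ℂ) :
    redPullback h μ {ζ} = phiDeg h ζ * μ {phi h ζ} + ordH h ζ := by
  have h1 : ∀ w, ((∑ᶠ z ∈ {z : OnePoint ℂ | phi h z = w ∧ z ∈ ({ζ} : Set (OnePoint ℂ))},
      phiDeg h z : ℕ) : ℝ≥0∞) = ({phi h ζ} : Set (OnePoint ℂ)).indicator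
        (fun _ => (phiDeg h ζ : ℝ≥0∞)) w := by
    intro w
    by_cases hw : w = phi h ζ
    · rw [Set.indicator_of_mem (Set.mem_singleton_iff.2 hw),
        show {z : OnePoint ℂ | phi h z = w ∧ z ∈ ({ζ} : Set (OnePoint ℂ))} = {ζ} by
          ext z
          simp only [Set.mem_ofPred_eq, Set.mem_singleton_iff]
          exact ⟨fun h => h.2, fun e => ⟨by rw [e, hw], e⟩⟩, finsum_mem_singleton]
    · rw [Set.indicator_of_notMem (by simpa using hw),
        show {z : OnePoint ℂ | phi h z = w ∧ z ∈ ({ζ} : Set (OnePoint ℂ))} = ∅ by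
          ext z
          simp only [Set.mem_ofPred_eq, Set.mem_singleton_iff, Set.mem_empty_iff_false, iff_false]
          rintro ⟨h1, rfl⟩
          exact hw h1.symm, finsum_mem_empty, Nat.cast_zero]
  rw [redPullback, lintegral_congr h1, lintegral_indicator_const (measurableSet_singleton _),
    finsum_mem_singleton]

theorem phiDeg_le_phiDegree (hn : NonDeg (redNum h) (redDen h)) (ζ : OnePoint ℂ) :
    phiDeg h ζ ≤ phiDegree h := by
  classical
  rw [← finsum_phiDeg hn (phi h ζ), finsum_mem_eq_sum_of_inter_support_eq
    (t := (finite_fiber_phi hn (phi h ζ)).toFinset) _ (by ext; simp)]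
  exact Finset.single_le_sum (f := phiDeg h) (fun _ _ => Nat.zero_le _) (by simp)

/-- The atomless parts of two measures that are related by the pullback under a reduction. -/
theorem phiDegree_mul_diffuseMass (hn : NonDeg (redNum h) (redDen h)) {d : ℕ} (hd : d ≠ 0)
    {μC μE : Measure (OnePoint ℂ)} [IsProbabilityMeasure μC] [IsProbabilityMeasure μE]
    (hμ : ∀ E, MeasurableSet E → redPullback h μE E = d * μC E) :
    phiDegree h * diffuseMass μE = d * diffuseMass μC := by
  -- Evaluate the pullback at a single point: the local degree there is positive, and so is `d`.
  have hatom : ∀ z, μC {z} = 0 ↔ μE {phi h z} = 0 ∧ ordH h z = 0 := by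
    intro z
    have h1 := hμ {z} (measurableSet_singleton z)
    rw [redPullback_singleton] at h1
    have h2 : μC {z} = 0 ↔ (d : ℝ≥0∞) * μC {z} = 0 := by simp [hd]
    rw [h2, ← h1, add_eq_zero, mul_eq_zero]
    simp [(phiDeg_pos hn z).ne']
  have hE := hμ {x | μC {x} = 0} (measurableSet_diffuse μC)
  rw [← diffuseMass] at hE
  have hord : ∑ᶠ z ∈ {x | μC {x} = 0}, ordH h z = 0 :=
    finsum_mem_eq_zero_of_forall_eq_zero fun z hz => ((hatom z).1 hz).2
  rw [← hE, redPullback, hord,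
    Nat.cast_zero, add_zero, diffuseMass,
    ← lintegral_indicator_const (measurableSet_diffuse μE)]
  refine lintegral_congr_ae ?_
  -- The values taken at holes that are not atoms of `μE` form a finite null set. Off this set, the
  -- fiber over a non-atom of `μE` contains no atom of `μC`, while the fiber over an atom always
  -- consists of atoms.
  set B := {w | w ∈ phi h '' Function.support (ordH h) ∧ μE {w} = 0} with hB
  have hBfin : B.Finite := ((finite_support_ordH h).image _).subset fun w hw => hw.1
  have hB0 : μE B = 0 := by
    rw [← Set.biUnion_of_singleton B, measure_biUnion_null_iff hBfin.countable]
    exact fun w hw => hw.2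
  filter_upwards [compl_mem_ae_iff.2 hB0] with w hw
  by_cases hw0 : μE {w} = 0
  · have hw1 : w ∈ {x | μE {x} = 0} := hw0
    have hset : {z | phi h z = w ∧ z ∈ Set.univ} =
        {z | phi h z = w ∧ z ∈ {x | μC {x} = 0}} := by
      ext z
      refine ⟨fun h => ⟨h.1, (hatom z).2 ⟨h.1 ▸ hw0, ?_⟩⟩, fun h => ⟨h.1, trivial⟩⟩
      by_contra hz
      exact hw ⟨⟨z, hz, h.1⟩, hw0⟩
    rw [Set.indicator_of_mem hw1, ← finsum_phiDeg hn w, hset]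
    rfl
  · have hw1 : w ∉ {x | μE {x} = 0} := hw0
    rw [Set.indicator_of_notMem hw1, eq_comm, Nat.cast_eq_zero]
    refine finsum_mem_eq_zero_of_forall_eq_zero fun z hz => ?_
    exact absurd (hz.1 ▸ ((hatom z).1 hz.2).1) hw0

end Pullback

/-! ### The partitions `S(Γ)` -/

section Partition

variable {K : Type*} [NormedField K] {Γ Γ' : Set (Berk K)}

instance Pieces.discrete (Γ : Set (Berk K)) : DiscreteMeasurableSpace (Pieces Γ) :=
  ⟨fun _ => trivial⟩

theorem mem_pieceSet (Γ : Set (Berk K)) (x : Berk K) : x ∈ pieceSet Γ x := by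
  rw [pieceSet]
  split_ifs with h
  · exact Set.mem_singleton x
  · exact mem_connectedComponentIn h

theorem pieceSet_of_mem {x : Berk K} (h : x ∈ Γ) : pieceSet Γ x = {x} := if_pos h

theorem pieceSet_eq_of_mem {x y : Berk K} (h : y ∈ pieceSet Γ x) : pieceSet Γ y = pieceSet Γ x := by
  by_cases hx : x ∈ Γ
  · rw [pieceSet_of_mem hx, Set.mem_singleton_iff] at h
    rw [h]
  · have e : pieceSet Γ x = connectedComponentIn Γᶜ x := if_neg hx
    rw [e] at h ⊢
    have hy : y ∉ Γ := connectedComponentIn_subset _ _ h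
    rw [pieceSet, if_neg hy]
    exact (connectedComponentIn_eq h).symm

theorem pieceSet_subset_pieceSet (hΓ : Γ ⊆ Γ') (x : Berk K) : pieceSet Γ' x ⊆ pieceSet Γ x := by
  by_cases hx' : x ∈ Γ'
  · rw [pieceSet_of_mem hx', Set.singleton_subset_iff]
    exact mem_pieceSet Γ x
  · have hx : x ∉ Γ := fun h => hx' (hΓ h)
    rw [pieceSet, pieceSet, if_neg hx, if_neg hx']
    exact connectedComponentIn_mono x (Set.compl_subset_compl.2 hΓ)

/-- The element of `S(Γ)` that contains `x`. -/
def pieceOf (Γ : Set (Berk K)) (x : Berk K) : Pieces Γ := ⟨pieceSet Γ x, x, rfl⟩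

theorem pieceOf_set (Γ : Set (Berk K)) (x : Berk K) : (pieceOf Γ x).set = pieceSet Γ x := rfl

theorem Pieces.exists_eq (V : Pieces Γ) : ∃ x, V = pieceOf Γ x := by
  obtain ⟨x, hx⟩ := V.2
  exact ⟨x, Subtype.ext hx⟩

theorem Pieces.ext_set {V W : Pieces Γ} (h : V.set = W.set) : V = W := Subtype.ext h

theorem Pieces.eq_of_subset {V W : Pieces Γ} (h : V.set ⊆ W.set) : V = W := by
  obtain ⟨x, rfl⟩ := V.exists_eq
  obtain ⟨y, rfl⟩ := W.exists_eq
  exact Pieces.ext_set (pieceSet_eq_of_mem (h (mem_pieceSet Γ x)))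

theorem measure_singleton_eq_mass (ω : Measure (Pieces Γ)) (V : Pieces Γ) :
    ω {V} = mass ω V.set := by
  rw [mass]
  congr 1
  ext W
  exact ⟨fun h => by rw [Set.mem_singleton_iff.1 h]; exact Set.Subset.refl _,
    fun h => Pieces.eq_of_subset h⟩

theorem projPieces_eq_iff (hΓ : Γ ⊆ Γ') (V : Pieces Γ') (U : Pieces Γ) :
    projPieces Γ' Γ V = U ↔ V.set ⊆ U.set := by
  have h1 : V.set ⊆ (projPieces Γ' Γ V).set := by
    have := pieceSet_subset_pieceSet hΓ V.2.choose
    rwa [← V.2.choose_spec] at this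
  refine ⟨fun h => h ▸ h1, fun h => ?_⟩
  obtain ⟨y, rfl⟩ := U.exists_eq
  have hx : V.2.choose ∈ V.set := by
    have := mem_pieceSet Γ' V.2.choose
    rwa [← V.2.choose_spec] at this
  exact Pieces.ext_set (pieceSet_eq_of_mem (h hx))

theorem map_projPieces_singleton (hΓ : Γ ⊆ Γ') (ω : Measure (Pieces Γ')) (U : Pieces Γ) :
    ω.map (projPieces Γ' Γ) {U} = mass ω U.set := by
  rw [Measure.map_apply .of_discrete .of_discrete, mass]
  congr 1
  ext V
  exact projPieces_eq_iff hΓ V U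

/-- `U` is a union of elements of `S(Γ)`. -/
def IsSaturated (Γ U : Set (Berk K)) : Prop := ∀ x ∈ U, pieceSet Γ x ⊆ U

theorem IsSaturated.subset_iff {U : Set (Berk K)} (hU : IsSaturated Γ U) {x : Berk K} :
    (pieceOf Γ x).set ⊆ U ↔ x ∈ U := ⟨fun h => h (mem_pieceSet Γ x), hU x⟩

theorem isSaturated_singleton {x : Berk K} (h : x ∈ Γ) : IsSaturated Γ {x} := by
  intro y hy
  rw [Set.mem_singleton_iff.1 hy, pieceSet_of_mem h]

theorem IsSaturated.inter {U U' : Set (Berk K)} (hU : IsSaturated Γ U) (hU' : IsSaturated Γ U') :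
    IsSaturated Γ (U ∩ U') :=
  fun x hx => Set.subset_inter (hU x hx.1) (hU' x hx.2)

/-- The measure with mass `r i` at the element of `S(Γ)` that contains `x i`. -/
def atomsAt (Γ : Set (Berk K)) {ι : Type*} (r : ι → ℝ≥0∞) (x : ι → Berk K) : Measure (Pieces Γ) :=
  Measure.sum fun i => r i • Measure.dirac (pieceOf Γ (x i))

theorem isAtomic_atomsAt {ι : Type*} (r : ι → ℝ≥0∞) (x : ι → Berk K) :
    IsAtomic (atomsAt Γ r x) :=
  IsAtomic.sum fun _ => (isAtomic_dirac _).smul _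

theorem mass_dirac {U : Set (Berk K)} (hU : IsSaturated Γ U) (x : Berk K) :
    mass (Measure.dirac (pieceOf Γ x)) U = U.indicator 1 x := by
  rw [mass, Measure.dirac_apply]
  by_cases hx : x ∈ U
  · rw [Set.indicator_of_mem hx, Set.indicator_of_mem (hU.subset_iff.2 hx)]
    rfl
  · rw [Set.indicator_of_notMem hx, Set.indicator_of_notMem fun h => hx (hU.subset_iff.1 h)]

theorem mass_atomsAt {ι : Type*} {U : Set (Berk K)} (hU : IsSaturated Γ U) (r : ι → ℝ≥0∞)
    (x : ι → Berk K) : mass (atomsAt Γ r x) U = ∑' i, r i * U.indicator 1 (x i) := by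
  rw [mass, atomsAt, Measure.sum_apply _ .of_discrete]
  refine tsum_congr fun i => ?_
  rw [Measure.smul_apply, smul_eq_mul, ← mass_dirac hU]
  rfl

theorem atomsAt_univ {ι : Type*} (r : ι → ℝ≥0∞) (x : ι → Berk K) :
    atomsAt Γ r x Set.univ = ∑' i, r i := by
  rw [atomsAt, Measure.sum_apply _ .univ]
  simp

end Partition

/-! ### Measures on the partition by one or two points -/

/-- An enumeration of the directions at `S`. -/
structure IsDirFamily (S : Berk 𝕃) (E : OnePoint ℂ → Set (Berk 𝕃)) : Prop where
  eq_dir : ∀ {y T}, T ∈ E y → E y = dir S T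
  inj : ∀ {y y' T}, T ∈ E y → T ∈ E y' → y = y'
  cover : ∀ {T}, T ≠ S → ∃ y, T ∈ E y
  notMem : ∀ y, S ∉ E y
  nonempty : ∀ y, (E y).Nonempty

theorem isDirFamily_dirAt (c : 𝕃ˣ) (b : 𝕃) : IsDirFamily (diskPt c b) (dirAt c b) where
  eq_dir := dirAt_eq_dir
  inj := dirAt_injective_of_mem
  cover := exists_mem_dirAt
  notMem := notMem_dirAt c b
  nonempty := dirAt_nonempty c b

theorem IsDirFamily.comp {S : Berk 𝕃} {E : OnePoint ℂ → Set (Berk 𝕃)} (hE : IsDirFamily S E)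
    {κ : OnePoint ℂ → OnePoint ℂ} (hκ : Function.Bijective κ) :
    IsDirFamily S fun y => E (κ y) where
  eq_dir := hE.eq_dir
  inj h h' := hκ.1 (hE.inj h h')
  cover h := by
    obtain ⟨y, hy⟩ := hE.cover h
    obtain ⟨x, rfl⟩ := hκ.2 y
    exact ⟨x, hy⟩
  notMem y := hE.notMem _
  nonempty y := hE.nonempty _

theorem IsDirFamily.ne {S T : Berk 𝕃} {E : OnePoint ℂ → Set (Berk 𝕃)} (hE : IsDirFamily S E)
    {y : OnePoint ℂ} (h : T ∈ E y) : T ≠ S := fun e => hE.notMem y (e ▸ h)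

section OnePointPartition

variable {G : Berk 𝕃} {E : OnePoint ℂ → Set (Berk 𝕃)}

theorem IsDirFamily.pieceSet_eq (hE : IsDirFamily G E) {x : Berk 𝕃} {y : OnePoint ℂ}
    (hx : x ∈ E y) : pieceSet {G} x = E y := by
  rw [← Set.pair_eq_singleton, pieceSet_pair (hE.ne hx) (hE.ne hx), Set.inter_self,
    ← hE.eq_dir hx]

theorem IsDirFamily.isSaturated (hE : IsDirFamily G E) (y : OnePoint ℂ) :
    IsSaturated {G} (E y) := fun x hx => by
  rw [hE.pieceSet_eq hx]

theorem IsDirFamily.set_eq (hE : IsDirFamily G E) (U : Pieces {G}) :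
    U.set = {G} ∨ ∃ y, U.set = E y := by
  obtain ⟨x, rfl⟩ := U.exists_eq
  by_cases hx : x = G
  · left
    rw [pieceOf_set, hx, pieceSet_of_mem (Set.mem_singleton G)]
  · obtain ⟨y, hy⟩ := hE.cover hx
    exact Or.inr ⟨y, hE.pieceSet_eq hy⟩

/-- A point of each direction, together with `G`. -/
def repPt (G : Berk 𝕃) (E : OnePoint ℂ → Set (Berk 𝕃)) : Option (OnePoint ℂ) → Berk 𝕃
  | none => G
  | some y => open Classical in if h : (E y).Nonempty then h.choose else G

theorem IsDirFamily.repPt_mem (hE : IsDirFamily G E) (y : OnePoint ℂ) :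
    repPt G E (some y) ∈ E y := by
  simp only [repPt]
  rw [dif_pos (hE.nonempty y)]
  exact (hE.nonempty y).choose_spec

theorem IsDirFamily.tsum_singleton (hE : IsDirFamily G E) (r : Option (OnePoint ℂ) → ℝ≥0∞) :
    ∑' i, r i * ({G} : Set (Berk 𝕃)).indicator 1 (repPt G E i) = r none := by
  rw [tsum_eq_single none]
  · simp [repPt]
  · rintro (_ | y) hi
    · exact absurd rfl hi
    · rw [Set.indicator_of_notMem, mul_zero]
      exact hE.ne (hE.repPt_mem y)

theorem IsDirFamily.tsum_dir (hE : IsDirFamily G E) (r : Option (OnePoint ℂ) → ℝ≥0∞)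
    (y : OnePoint ℂ) : ∑' i, r i * (E y).indicator 1 (repPt G E i) = r (some y) := by
  rw [tsum_eq_single (some y)]
  · rw [Set.indicator_of_mem (hE.repPt_mem y), Pi.one_apply, mul_one]
  · rintro (_ | x) hi
    · rw [Set.indicator_of_notMem, mul_zero]
      exact hE.notMem y
    · rw [Set.indicator_of_notMem, mul_zero]
      exact fun h => hi (by rw [hE.inj h (hE.repPt_mem x)])

variable (μ : Measure (OnePoint ℂ)) [IsProbabilityMeasure μ]

/-- The measure on the partition by one point with given masses of the directions. -/
theorem IsDirFamily.exists_measure (hE : IsDirFamily G E) {Γ : Set (Berk 𝕃)} (hΓ : Γ = {G}) :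
    ∃ ω₀ : Measure (Pieces Γ), IsAtomic ω₀ ∧ ω₀ Set.univ = 1 ∧ mass ω₀ {G} = diffuseMass μ ∧
      (∀ y, mass ω₀ (E y) = μ {y}) ∧
      ∀ ω : Measure (Pieces Γ), ω Set.univ = 1 → mass ω {G} = diffuseMass μ →
        (∀ y, mass ω (E y) = μ {y}) → ω = ω₀ := by
  subst hΓ
  set ω₀ := atomsAt {G} (weight μ) (repPt G E) with hω₀
  have h0 : IsAtomic ω₀ := isAtomic_atomsAt _ _
  have h1 : ω₀ Set.univ = 1 := by rw [hω₀, atomsAt_univ, tsum_weight]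
  have h2 : mass ω₀ {G} = diffuseMass μ := by
    rw [hω₀, mass_atomsAt (isSaturated_singleton (Set.mem_singleton G)), hE.tsum_singleton]
    rfl
  have h3 : ∀ y, mass ω₀ (E y) = μ {y} := fun y => by
    rw [hω₀, mass_atomsAt (hE.isSaturated y), hE.tsum_dir]
    rfl
  refine ⟨ω₀, h0, h1, h2, h3, fun ω g1 g2 g3 => (h0.eq_of_univ (fun V => ?_) ?_ ?_).symm⟩
  · rw [measure_singleton_eq_mass, measure_singleton_eq_mass]
    rcases hE.set_eq V with h | ⟨y, h⟩
    · rw [h, h2, g2]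
    · rw [h, h3, g3]
  · rw [h1, g1]
  · rw [h1]
    exact ENNReal.one_ne_top

end OnePointPartition

/-- The directions at two points `G ≠ S`, where `h` and `a` are the directions that face each
other. -/
structure IsTwoPoint (G S : Berk 𝕃) (D E : OnePoint ℂ → Set (Berk 𝕃)) (h a : OnePoint ℂ) :
    Prop where
  dirG : IsDirFamily G D
  dirS : IsDirFamily S E
  ne : S ≠ G
  memG : S ∈ D h
  memS : G ∈ E a
  mid : (D h ∩ E a).Nonempty

namespace IsTwoPoint

variable {G S : Berk 𝕃} {D E : OnePoint ℂ → Set (Berk 𝕃)} {h a : OnePoint ℂ}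

theorem symm (hT : IsTwoPoint G S D E h a) : IsTwoPoint S G E D a h :=
  ⟨hT.dirS, hT.dirG, hT.ne.symm, hT.memS, hT.memG, by rw [Set.inter_comm]; exact hT.mid⟩

theorem subset (hT : IsTwoPoint G S D E h a) {ζ : OnePoint ℂ} (hζ : ζ ≠ h) : D ζ ⊆ E a := by
  obtain ⟨T, hT'⟩ := hT.dirG.nonempty ζ
  rw [hT.dirG.eq_dir hT', hT.dirS.eq_dir hT.memS]
  refine dir_subset_dir (hT.dirG.ne hT') hT.ne ?_
  rw [← hT.dirG.eq_dir hT']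
  exact fun hS => hζ (hT.dirG.inj hS hT.memG)

theorem isSaturated (hT : IsTwoPoint G S D E h a) (ζ : OnePoint ℂ) :
    IsSaturated {G, S} (D ζ) := by
  intro x hx
  by_cases hxS : x = S
  · rw [pieceSet_of_mem (by rw [hxS]; exact Set.mem_insert_of_mem _ rfl),
      Set.singleton_subset_iff]
    exact hx
  · rw [pieceSet_pair (hT.dirG.ne hx) hxS, ← hT.dirG.eq_dir hx]
    exact Set.inter_subset_left

theorem isSaturated' (hT : IsTwoPoint G S D E h a) (y : OnePoint ℂ) :
    IsSaturated {G, S} (E y) := by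
  rw [Set.pair_comm]
  exact hT.symm.isSaturated y

theorem pieceSet_eq (hT : IsTwoPoint G S D E h a) {x : Berk 𝕃} {ζ : OnePoint ℂ} (hx : x ∈ D ζ)
    (hζ : ζ ≠ h) : pieceSet {G, S} x = D ζ := by
  have hxE := hT.subset hζ hx
  rw [pieceSet_pair (hT.dirG.ne hx) (hT.dirS.ne hxE), ← hT.dirG.eq_dir hx, ← hT.dirS.eq_dir hxE]
  exact Set.inter_eq_left.2 (hT.subset hζ)

/-- A point other than `G` and `S` lies in one direction at each of them. Unless both of these face
each other, one is contained in the other, and the smaller one is the piece. -/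
theorem set_eq (hT : IsTwoPoint G S D E h a) (V : Pieces {G, S}) :
    V.set = {G} ∨ V.set = {S} ∨ (∃ ζ, ζ ≠ h ∧ V.set = D ζ) ∨ (∃ y, y ≠ a ∧ V.set = E y) ∨
      V.set = D h ∩ E a := by
  obtain ⟨x, rfl⟩ := V.exists_eq
  rw [pieceOf_set]
  by_cases hxG : x = G
  · left
    rw [pieceSet_of_mem (Or.inl hxG), hxG]
  by_cases hxS : x = S
  · right; left
    rw [pieceSet_of_mem (Or.inr hxS), hxS]
  obtain ⟨ζ, hζ⟩ := hT.dirG.cover hxG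
  obtain ⟨y, hy⟩ := hT.dirS.cover hxS
  by_cases hζh : ζ = h
  · by_cases hya : y = a
    · right; right; right; right
      rw [pieceSet_pair hxG hxS, ← hT.dirG.eq_dir hζ, ← hT.dirS.eq_dir hy, hζh, hya]
    · right; right; right; left
      refine ⟨y, hya, ?_⟩
      rw [Set.pair_comm]
      exact hT.symm.pieceSet_eq hy hya
  · right; right; left
    exact ⟨ζ, hζh, hT.pieceSet_eq hζ hζh⟩

variable (μ : Measure (OnePoint ℂ))

theorem tsum_weightOff_of_subset (hT : IsTwoPoint G S D E h a) {U : Set (Berk 𝕃)}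
    (hU : U ⊆ D h) : ∑' i, weightOff μ h i * U.indicator 1 (repPt G D i) = 0 := by
  refine ENNReal.tsum_eq_zero.2 ?_
  rintro (_ | ζ)
  · have hG : repPt G D none ∉ U := fun hG => hT.dirG.notMem h (hU hG)
    rw [Set.indicator_of_notMem hG, mul_zero]
  · by_cases hζ : ζ = h
    · simp [weightOff, hζ]
    · rw [Set.indicator_of_notMem, mul_zero]
      exact fun hx => hζ (hT.dirG.inj (hT.dirG.repPt_mem ζ) (hU hx))

/-- Seen from `S`, the mass placed at `G` and in the directions at `G` other than `h` lies entirely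
in the direction `a`. -/
theorem tsum_weightOff_of_superset (hT : IsTwoPoint G S D E h a) :
    ∑' i, weightOff μ h i * (E a).indicator 1 (repPt G D i) = ∑' i, weightOff μ h i := by
  refine tsum_congr ?_
  rintro (_ | ζ)
  · have : repPt G D none ∈ E a := hT.memS
    rw [Set.indicator_of_mem this, Pi.one_apply, mul_one]
  · by_cases hζ : ζ = h
    · simp [weightOff, hζ]
    · rw [Set.indicator_of_mem (hT.subset hζ (hT.dirG.repPt_mem ζ)), Pi.one_apply, mul_one]

/-- The masses of the elements of the partition by two points that are attached to two measures
on the sphere. -/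
structure HasMasses (G S : Berk 𝕃) (D E : OnePoint ℂ → Set (Berk 𝕃)) (h a : OnePoint ℂ)
    (μC μE : Measure (OnePoint ℂ)) (ω : Measure (Pieces {G, S})) : Prop where
  prob : ω Set.univ = 1
  massG : mass ω {G} = diffuseMass μC
  massS : mass ω {S} = diffuseMass μE
  massC : ∀ ζ, ζ ≠ h → mass ω (D ζ) = μC {ζ}
  massE : ∀ y, y ≠ a → mass ω (E y) = μE {y}
  massMid : mass ω (D h ∩ E a) = μC {h} + μE {a} - 1

/-- Here `p` and `q` are the masses placed outside the facing directions, whose masses are `x` and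
`y`. The bound `1 ≤ x + y` makes the truncated subtraction exact; the identities give the total mass
and the masses of the facing directions. -/
theorem ennreal_balance {p q x y : ℝ≥0∞} (hp : p + x = 1) (hq : q + y = 1) (hxy : 1 ≤ x + y) :
    p + q + (x + y - 1) = 1 ∧ q + (x + y - 1) = x ∧ p + (x + y - 1) = y := by
  obtain ⟨m, hm⟩ := exists_add_of_le hxy
  have h1 : x + y - 1 = m := by rw [hm]; exact ENNReal.add_sub_cancel_left ENNReal.one_ne_top
  rw [h1]
  have hpt : p ≠ ⊤ := ne_top_of_le_ne_top ENNReal.one_ne_top (hp ▸ le_self_add)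
  have hqt : q ≠ ⊤ := ne_top_of_le_ne_top ENNReal.one_ne_top (hq ▸ le_self_add)
  have hxt : x ≠ ⊤ := ne_top_of_le_ne_top ENNReal.one_ne_top (hp ▸ le_add_self)
  have hyt : y ≠ ⊤ := ne_top_of_le_ne_top ENNReal.one_ne_top (hq ▸ le_add_self)
  have hmt : m ≠ ⊤ := ne_top_of_le_ne_top (ENNReal.add_ne_top.2 ⟨hxt, hyt⟩) (hm ▸ le_add_self)
  lift p to ℝ≥0 using hpt
  lift q to ℝ≥0 using hqt
  lift x to ℝ≥0 using hxt
  lift y to ℝ≥0 using hyt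
  lift m to ℝ≥0 using hmt
  norm_cast at hp hq hm ⊢
  rw [← NNReal.coe_inj] at hp hq hm
  push_cast at hp hq hm
  refine ⟨?_, ?_, ?_⟩ <;> rw [← NNReal.coe_inj] <;> push_cast <;> linarith

/-- Place the masses of `μC` off `h` around `G`, those of `μE` off `a` around `S`, and the remainder
in the annulus. The facing directions then automatically receive the masses of `h` and `a`.
Uniqueness follows from the list of pieces, since the constructed measure is atomic. -/
theorem exists_measure (hT : IsTwoPoint G S D E h a) {μC μE : Measure (OnePoint ℂ)}
    [IsProbabilityMeasure μC] [IsProbabilityMeasure μE] (hadm : 1 ≤ μC {h} + μE {a}) :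
    ∃ ω₀ : Measure (Pieces {G, S}), IsAtomic ω₀ ∧ HasMasses G S D E h a μC μE ω₀ ∧
      (∀ ζ, mass ω₀ (D ζ) = μC {ζ}) ∧ (∀ y, mass ω₀ (E y) = μE {y}) ∧
      ∀ ω, HasMasses G S D E h a μC μE ω → ω = ω₀ := by
  obtain ⟨x, hxD, hxE⟩ := hT.mid
  obtain ⟨hbal, hbalC, hbalE⟩ := ennreal_balance (tsum_weightOff_add μC h)
    (tsum_weightOff_add μE a) hadm
  set ω₀ : Measure (Pieces {G, S}) := atomsAt {G, S} (weightOff μC h) (repPt G D) +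
    atomsAt {G, S} (weightOff μE a) (repPt S E) +
    (μC {h} + μE {a} - 1) • Measure.dirac (pieceOf {G, S} x) with hω₀
  have h0 : IsAtomic ω₀ :=
    ((isAtomic_atomsAt _ _).add (isAtomic_atomsAt _ _)).add ((isAtomic_dirac _).smul _)
  have hmass : ∀ U, IsSaturated {G, S} U → mass ω₀ U =
      ∑' i, weightOff μC h i * U.indicator 1 (repPt G D i) +
      ∑' i, weightOff μE a i * U.indicator 1 (repPt S E i) +
      (μC {h} + μE {a} - 1) * U.indicator 1 x := by
    intro U hU
    rw [← mass_atomsAt hU, ← mass_atomsAt hU, ← mass_dirac hU]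
    rfl
  have hG : mass ω₀ {G} = diffuseMass μC := by
    rw [hmass _ (isSaturated_singleton (Or.inl rfl)), hT.dirG.tsum_singleton,
      hT.symm.tsum_weightOff_of_subset μE (Set.singleton_subset_iff.2 hT.memS),
      Set.indicator_of_notMem (by simpa using hT.dirG.ne hxD), mul_zero, add_zero, add_zero]
    rfl
  have hS : mass ω₀ {S} = diffuseMass μE := by
    rw [hmass _ (isSaturated_singleton (Or.inr rfl)), hT.dirS.tsum_singleton,
      hT.tsum_weightOff_of_subset μC (Set.singleton_subset_iff.2 hT.memG),
      Set.indicator_of_notMem (by simpa using hT.dirS.ne hxE), mul_zero, add_zero, zero_add]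
    rfl
  have hD : ∀ ζ, mass ω₀ (D ζ) = μC {ζ} := by
    intro ζ
    rw [hmass _ (hT.isSaturated ζ), hT.dirG.tsum_dir]
    by_cases hζ : ζ = h
    -- The facing direction contains everything placed around `S` as well as the annulus.
    · subst hζ
      rw [hT.symm.tsum_weightOff_of_superset μE, Set.indicator_of_mem hxD, Pi.one_apply, mul_one,
        weightOff, if_pos rfl, zero_add, hbalC]
    · rw [hT.symm.tsum_weightOff_of_subset μE (hT.subset hζ),
        Set.indicator_of_notMem fun hx => hζ (hT.dirG.inj hx hxD), mul_zero, add_zero, add_zero,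
        weightOff, if_neg hζ]
  have hE : ∀ y, mass ω₀ (E y) = μE {y} := by
    intro y
    rw [hmass _ (hT.isSaturated' y), hT.dirS.tsum_dir]
    by_cases hy : y = a
    · subst hy
      rw [hT.tsum_weightOff_of_superset μC, Set.indicator_of_mem hxE, Pi.one_apply, mul_one,
        weightOff, if_pos rfl, add_zero, hbalE]
    · rw [hT.tsum_weightOff_of_subset μC (hT.symm.subset hy),
        Set.indicator_of_notMem fun hx => hy (hT.dirS.inj hx hxE), mul_zero, add_zero, zero_add,
        weightOff, if_neg hy]
  have hmid : mass ω₀ (D h ∩ E a) = μC {h} + μE {a} - 1 := by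
    rw [hmass _ ((hT.isSaturated h).inter (hT.isSaturated' a)),
      hT.tsum_weightOff_of_subset μC Set.inter_subset_left,
      hT.symm.tsum_weightOff_of_subset μE Set.inter_subset_right,
      Set.indicator_of_mem (show x ∈ D h ∩ E a from ⟨hxD, hxE⟩), Pi.one_apply, mul_one, zero_add,
      zero_add]
  have hprob : ω₀ Set.univ = 1 := by
    rw [hω₀, Measure.add_apply, Measure.add_apply, atomsAt_univ, atomsAt_univ, Measure.smul_apply,
      measure_univ, smul_eq_mul, mul_one, hbal]
  have hspec : HasMasses G S D E h a μC μE ω₀ :=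
    ⟨hprob, hG, hS, fun ζ _ => hD ζ, fun y _ => hE y, hmid⟩
  refine ⟨ω₀, h0, hspec, hD, hE, fun ω hω => (h0.eq_of_univ (fun V => ?_) ?_ ?_).symm⟩
  · rw [measure_singleton_eq_mass, measure_singleton_eq_mass]
    rcases hT.set_eq V with h | h | ⟨ζ, hζ, h⟩ | ⟨y, hy, h⟩ | h <;> rw [h]
    · rw [hG, hω.massG]
    · rw [hS, hω.massS]
    · rw [hD, hω.massC ζ hζ]
    · rw [hE, hω.massE y hy]
    · rw [hmid, hω.massMid]
  · rw [hprob, hω.prob]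
  · rw [hprob]
    exact ENNReal.one_ne_top

end IsTwoPoint

/-! ### The quantized pullback -/

theorem nearPt_injective (ζ : OnePoint ℂ) : Function.Injective (nearPt ζ) := by
  intro τ τ' h
  match ζ with
  | OnePoint.some ζ =>
    have := congrArg (fun x : AffPoint 𝕃 => x.rad (constEmb ζ)) h
    simp only [nearPt_some_rad, sub_self, norm_zero, max_eq_left (Real.exp_pos _).le] at this
    simpa using this
  | OnePoint.infty =>
    have := congrArg (fun x : AffPoint 𝕃 => x.rad 0) h
    simp only [nearPt_infty_rad, norm_zero, max_eq_left (Real.exp_pos _).le] at this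
    simpa using this

/-- Near the Gauss point the interval to `S` runs along `nearPt ζ`. Since `S` can be at most one of
its points, one of two parameters gives a point strictly between. -/
theorem exists_mem_dir_inter_dir {S : Berk 𝕃} (hS : S ≠ gaussPt) :
    (dir gaussPt S ∩ dir S gaussPt).Nonempty := by
  obtain ⟨ζ, hζ⟩ := exists_mem_dirAt (c := 1) (b := 0) (T := S) (by rwa [← gaussPt_eq_diskPt])
  obtain ⟨ε, hε, h⟩ := mem_nhdsGT_iff_exists_Ioo_subset.1 (eventually_nearPt_mem_interval hζ)
  have hε : 0 < ε := hε
  obtain ⟨τ, h0, h1, hne⟩ : ∃ τ, 0 < τ ∧ τ < ε ∧ Berk.aff (nearPt ζ τ) ≠ S := by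
    by_cases h2 : Berk.aff (nearPt ζ (ε / 2)) = S
    · refine ⟨ε / 3, by positivity, by linarith, fun h3 => ?_⟩
      have h4 := h3.trans h2.symm
      injection h4 with h4
      have := nearPt_injective ζ h4
      linarith
    · exact ⟨ε / 2, by positivity, by linarith, h2⟩
  have hmem : Berk.aff (nearPt ζ τ) ∈ interval gaussPt S := h ⟨h0, h1⟩
  have hneG : Berk.aff (nearPt ζ τ) ≠ gaussPt := by
    rw [gaussPt_eq_diskPt]
    exact ne_of_mem_dirAt (aff_nearPt_mem_dirAt ζ h0)
  refine ⟨_, mem_dir_of_mem_interval hneG hmem, mem_dir_of_mem_interval hne ?_⟩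
  rw [interval_comm]
  exact hmem

theorem isDirFamily_gauss : IsDirFamily gaussPt (dirAt 1 0) := by
  rw [gaussPt_eq_diskPt]
  exact isDirFamily_dirAt 1 0

theorem gamma_eq_gammaG_iff (f : RatFunc 𝕃) : gamma f = gammaG ↔ berkMap f gaussPt = gaussPt := by
  rw [gamma, gammaG]
  constructor
  · intro h
    exact Set.mem_singleton_iff.1 (h ▸ Set.mem_insert_of_mem _ rfl)
  · intro h
    rw [h, Set.pair_eq_singleton]

theorem gammaG_subset_gamma (f : RatFunc 𝕃) : gammaG ⊆ gamma f :=
  Set.singleton_subset_iff.2 (Set.mem_insert _ _)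

namespace IsFrame

variable {f A g : RatFunc 𝕃} {c : 𝕃ˣ} {b : 𝕃} {α β γ δ : intRing} {P Q : intRing[X]}

theorem isDirFamily (hF : IsFrame f A g c b α β γ δ P Q) :
    IsDirFamily (berkMap f gaussPt) (IsIwasawa.imageDir c b α β γ δ) := by
  rw [hF.berkMap_gaussPt]
  exact (isDirFamily_dirAt c b).comp ⟨mob_injective hF.iwasawa.det, mob_surjective hF.iwasawa.det⟩

theorem isTwoPoint (hF : IsFrame f A g c b α β γ δ P Q) (hne : berkMap f gaussPt ≠ gaussPt) :
    IsTwoPoint gaussPt (berkMap f gaussPt) (dirAt 1 0) (IsIwasawa.imageDir c b α β γ δ)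
      (holePt A) (constPt A) := by
  obtain ⟨h1, h2⟩ := hF.iwasawa.hole_mem (by rwa [← hF.berkMap_gaussPt])
  rw [← hF.berkMap_gaussPt] at h1
  refine ⟨isDirFamily_gauss, hF.isDirFamily, hne, h1, h2, ?_⟩
  rw [dirAt_gauss_eq_dir h1, hF.isDirFamily.eq_dir h2]
  exact exists_mem_dir_inter_dir hne

/-- Both sides are atomic, so single pieces suffice. At the Gauss point the identity is that of the
atomless masses; at a direction it is the hypothesis on pullbacks, evaluated at one point. -/
theorem quantPullback_eq (hF : IsFrame f A g c b α β γ δ P Q)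
    (hG : berkMap (ratComp A f) gaussPt = gaussPt) {d : ℕ} (hd : d ≠ 0)
    {μC μE : Measure (OnePoint ℂ)} [IsProbabilityMeasure μC] [IsProbabilityMeasure μE]
    (hμ : ∀ E, MeasurableSet E → redPullback (ratComp A f) μE E = d * μC E)
    {ω : Measure (Pieces (gamma f))} (hω : IsAtomic ω) (hprob : ω Set.univ = 1)
    (hωG : mass ω {gaussPt} = diffuseMass μC)
    (hωS : mass ω {berkMap f gaussPt} = diffuseMass μE)
    (hωC : ∀ ζ, mass ω (dirAt 1 0 ζ) = μC {ζ})
    (hωE : ∀ y, mass ω (IsIwasawa.imageDir c b α β γ δ y) = μE {y}) :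
    quantPullback f ω = (d : ℝ≥0∞) • quantProj f ω := by
  classical
  refine IsAtomic.ext (IsAtomic.sum fun U => (isAtomic_dirac U).smul _) ((hω.map _).smul _)
    fun U => ?_
  rw [Measure.smul_apply, smul_eq_mul, quantProj,
    map_projPieces_singleton (gammaG_subset_gamma f), quantPullback,
    Measure.sum_apply _ .of_discrete, tsum_eq_single U]
  swap
  · intro W hW
    rw [Measure.smul_apply, Measure.dirac_apply, Set.indicator_of_notMem, smul_zero]
    exact fun h => hW h
  rw [Measure.smul_apply, Measure.dirac_apply_of_mem (Set.mem_singleton U), smul_eq_mul, mul_one]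
  have hset : U.set = {gaussPt} ∨ ∃ ζ, U.set = dirAt 1 0 ζ := isDirFamily_gauss.set_eq U
  rcases hset with hU | ⟨ζ, hU⟩
  -- Only the piece `{f(𝒮_G)}` contributes, with the degree of the reduction as its factor.
  · have hq : ∀ V : Pieces (gamma f), (quantDeg f V U : ℝ≥0∞) =
        {V : Pieces (gamma f) | V.set ⊆ {berkMap f gaussPt}}.indicator
          (fun _ => (phiDegree (ratComp A f) : ℝ≥0∞)) V := by
      intro V
      rw [quantDeg, if_pos hU, hF.berkLocalDeg_eq]
      have hne : V.set.Nonempty := by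
        obtain ⟨x, rfl⟩ := V.exists_eq
        exact ⟨x, mem_pieceSet _ x⟩
      by_cases hV : V.set ⊆ {berkMap f gaussPt}
      · rw [if_pos (hne.subset_singleton_iff.1 hV), Set.indicator_of_mem hV]
      · rw [if_neg fun h => hV h.subset, Set.indicator_of_notMem hV, Nat.cast_zero]
    rw [tsum_congr fun V => by rw [hq V], hω.tsum_indicator, hU, hωG,
      ← phiDegree_mul_diffuseMass hF.nonDeg_red hd hμ, ← hωS]
    rfl
  · have hUG : U.set ≠ {gaussPt} := fun h =>
      isDirFamily_gauss.notMem ζ (by rw [← hU, h]; exact Set.mem_singleton _)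
    -- The surplus counts for every piece, so it is multiplied by the total mass one; the
    -- directional degree only sees the image direction.
    have hq : ∀ V : Pieces (gamma f), (quantDeg f V U : ℝ≥0∞) * ω {V} =
        {V : Pieces (gamma f) |
          V.set ⊆ IsIwasawa.imageDir c b α β γ δ (phi (ratComp A f) ζ)}.indicator
            (fun _ => (phiDeg (ratComp A f) ζ : ℝ≥0∞)) V * ω {V} +
          Set.univ.indicator (fun _ => (ordH (ratComp A f) ζ : ℝ≥0∞)) V * ω {V} := by
      intro V
      rw [← add_mul, quantDeg, if_neg hUG, hU, hF.dirMap_eq, hF.dirDeg_eq hG, hF.surplus_eq hG,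
        Set.indicator_of_mem (Set.mem_univ V)]
      congr 1
      by_cases hV : V.set ⊆ IsIwasawa.imageDir c b α β γ δ (phi (ratComp A f) ζ)
      · rw [if_pos hV, Set.indicator_of_mem hV, Nat.cast_add]
      · rw [if_neg hV, Set.indicator_of_notMem hV, zero_add]
    rw [tsum_congr hq, ENNReal.tsum_add, hω.tsum_indicator, hω.tsum_indicator, hprob, mul_one, hU,
      hωC, ← hμ _ (measurableSet_singleton ζ), redPullback_singleton, ← hωE]
    rfl

end IsFrame

/-- If `A` fixes the Gauss point, then its reduction has degree one. -/
theorem phiDegree_eq_one {A : RatFunc 𝕃} (hA : ratDeg A = 1)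
    (hn : NonDeg (redNum A) (redDen A)) :
    phiDegree A = 1 ∧ ∀ ζ, phiDeg A ζ = 1 ∧ ordH A ζ = 0 := by
  have h1 := finsum_ordH hn
  have h2 : ∀ ζ, 0 < phiDeg A ζ ∧ phiDeg A ζ ≤ phiDegree A := fun ζ =>
    ⟨phiDeg_pos hn ζ, phiDeg_le_phiDegree hn ζ⟩
  have h3 := h2 OnePoint.infty
  rw [hA] at h1
  have h4 : ∑ᶠ ζ, ordH A ζ = 0 := by omega
  refine ⟨by omega, fun ζ => ⟨by have := h2 ζ; omega, ?_⟩⟩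
  have := single_le_finsum ζ (finite_support_ordH A) fun _ => Nat.zero_le _
  omega

/-! ### The measure `ω_μ` -/

theorem dirMap_X_gauss (ζ : OnePoint ℂ) :
    dirMap RatFunc.X gaussPt (dirAt 1 0 ζ) = dirAt 1 0 ζ := by
  refine isRep_X.dirMap_gauss (c := 1) (b := 0) ?_ (by simp) ?_
  · rw [redPoly_X, map_one]
    exact nonDeg_X_one
  · rw [redPoly_X, map_one]
    exact isVal_X_one ζ

namespace IsFrame

variable {f A g : RatFunc 𝕃} {c : 𝕃ˣ} {b : 𝕃} {α β γ δ : intRing} {P Q : intRing[X]}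
  {μC μE : Measure (OnePoint ℂ)} [IsProbabilityMeasure μC] [IsProbabilityMeasure μE]

/-- If `f` fixes the Gauss point, then so does `A`, and `μ_C` is the pullback of `μ_E` under the
reduction of `A`, a Möbius transformation. -/
theorem masses_of_fixed (hF : IsFrame f A g c b α β γ δ P Q) (hS : berkMap f gaussPt = gaussPt)
    (hG : berkMap (ratComp A f) gaussPt = gaussPt)
    (hpull : ∀ E, MeasurableSet E → redPullback A μE E = μC E) :
    diffuseMass μE = diffuseMass μC ∧
      ∀ ζ, ∃ y, dirAt 1 0 ζ = IsIwasawa.imageDir c b α β γ δ y ∧ μE {y} = μC {ζ} := by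
  have hAG : berkMap A gaussPt = gaussPt := by
    have := hF.berkMap_comp
    rwa [hS, hG] at this
  -- With the identity in the role of `f`, the results on frames apply to `A` itself.
  obtain ⟨g', P', Q', hF'⟩ := hF.iwasawa.exists_isFrame (f := RatFunc.X) (by rwa [ratComp_X])
  have hn := hF'.nonDeg_red
  rw [ratComp_X] at hn
  obtain ⟨hdeg, hlocal⟩ := phiDegree_eq_one hF.iwasawa.deg hn
  constructor
  · have := phiDegree_mul_diffuseMass hn one_ne_zero (μC := μC) (μE := μE)
      fun E hE => by rw [hpull E hE, Nat.cast_one, one_mul]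
    simpa [hdeg] using this
  · intro ζ
    refine ⟨phi A ζ, ?_, ?_⟩
    · have h1 := hF'.dirMap_eq ζ
      rwa [ratComp_X, dirMap_X_gauss] at h1
    · have := hpull {ζ} (measurableSet_singleton ζ)
      rw [redPullback_singleton, (hlocal ζ).1, (hlocal ζ).2] at this
      simpa using this

theorem mass_imageDir (hF : IsFrame f A g c b α β γ δ P Q) {ω : Measure (Pieces (gamma f))}
    {p : OnePoint ℂ → Prop}
    (h : ∀ y : OnePoint 𝕃, p (redPt y) → mass ω (invDir A y) = μE {redPt y}) (y : OnePoint ℂ)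
    (hy : p y) : mass ω (IsIwasawa.imageDir c b α β γ δ y) = μE {y} := by
  obtain ⟨z, rfl⟩ := redPt_surjective y
  rw [← hF.iwasawa.invDir_eq]
  exact h z hy

theorem exists_omega_of_eq (hF : IsFrame f A g c b α β γ δ P Q)
    (hS : berkMap f gaussPt = gaussPt) :
    ∃ ω₀, IsAtomic ω₀ ∧ IsOmega f A μC μE ω₀ ∧ ∀ ω, IsOmega f A μC μE ω → ω = ω₀ := by
  have hΓ : gamma f = gammaG := (gamma_eq_gammaG_iff f).2 hS
  have hE : IsDirFamily gaussPt (IsIwasawa.imageDir c b α β γ δ) := hS ▸ hF.isDirFamily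
  obtain ⟨ω₀, hat, hprob, hG, hdirs, huniq⟩ := hE.exists_measure μE hΓ
  refine ⟨ω₀, hat, ⟨hprob, fun _ => ⟨hG, fun y => ?_⟩, fun h => absurd hΓ h⟩, fun ω hω => ?_⟩
  · rw [hF.iwasawa.invDir_eq, hdirs]
  · have h := hω.of_eq hΓ
    exact huniq ω hω.prob h.1 fun y =>
      hF.mass_imageDir (p := fun _ => True) (fun y _ => h.2 y) y trivial

/-- The masses of the two facing directions, which `IsOmega` does not prescribe, are recorded too:
the pullback identity needs all directions. -/
theorem exists_omega_of_ne (hF : IsFrame f A g c b α β γ δ P Q)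
    (hS : berkMap f gaussPt ≠ gaussPt) (hadm : 1 ≤ μC {holePt A} + μE {constPt A}) :
    ∃ ω₀, IsAtomic ω₀ ∧ IsOmega f A μC μE ω₀ ∧ (∀ ζ, mass ω₀ (dirAt 1 0 ζ) = μC {ζ}) ∧
      (∀ y, mass ω₀ (IsIwasawa.imageDir c b α β γ δ y) = μE {y}) ∧
      ∀ ω, IsOmega f A μC μE ω → ω = ω₀ := by
  have hΓ : gamma f ≠ gammaG := fun h => hS ((gamma_eq_gammaG_iff f).1 h)
  have hT := hF.isTwoPoint hS
  have hmid : dirAt 1 0 (holePt A) ∩ IsIwasawa.imageDir c b α β γ δ (constPt A) =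
      dir gaussPt (berkMap f gaussPt) ∩ dir (berkMap f gaussPt) gaussPt := by
    rw [hT.dirG.eq_dir hT.memG, hT.dirS.eq_dir hT.memS]
  obtain ⟨ω₀, hat, hm, hC, hE, huniq⟩ := hT.exists_measure hadm
  refine ⟨ω₀, hat, ⟨hm.prob, fun h => absurd h hΓ, fun _ => ⟨hm.massG, fun x _ => ?_, hm.massS,
    fun y _ => ?_, ?_⟩⟩, hC, hE, fun ω hω => huniq ω ?_⟩
  · rw [dir_gauss_classicalPt]
    exact hC _
  · rw [hF.iwasawa.invDir_eq]
    exact hE _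
  · rw [← hmid]
    exact hm.massMid
  · obtain ⟨h1, h2, h3, h4, h5⟩ := hω.of_ne hΓ
    refine ⟨hω.prob, h1, h3, fun ζ hζ => ?_,
      fun y hy => hF.mass_imageDir (p := fun y => y ≠ constPt A) h4 y hy, ?_⟩
    · obtain ⟨x, rfl⟩ := redPt_surjective ζ
      rw [← dir_gauss_classicalPt]
      exact h2 x hζ
    · rw [hmid]
      exact h5

end IsFrame

end

end DegBerk

open DegBerk MeasureTheory
open scoped ENNReal

theorem mainTheorem3 (d : ℕ) (hd : 1 < d) (f A : RatFunc 𝕃)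
    (hf : IsMeromorphicFamily d f) (hA : IsMeromorphicFamily 1 A)
    (hfG : berkMap f ⁻¹' {gaussPt} ≠ {gaussPt})
    (hAf : berkMap (ratComp A f) gaussPt = gaussPt)
    (μC μE : Measure (OnePoint ℂ)) [IsProbabilityMeasure μC] [IsProbabilityMeasure μE]
    (hadm : Admissible f A μC μE) :
    (∃! ω : Measure (Pieces (gamma f)), IsOmega f A μC μE ω) ∧
    ((∀ E : Set (OnePoint ℂ), MeasurableSet E →
        redPullback (ratComp A f) μE E = (d : ℝ≥0∞) * μC E) →
      ∀ ω : Measure (Pieces (gamma f)), IsOmega f A μC μE ω →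
        quantPullback f ω = (d : ℝ≥0∞) • quantProj f ω) := by
  have hd0 : d ≠ 0 := by omega
  obtain ⟨c, b, α, β, γ, δ, hI⟩ := exists_isIwasawa (hA.ratDeg_eq_one hAf)
  obtain ⟨g, P, Q, hF⟩ := hI.exists_isFrame hAf
  by_cases hS : berkMap f gaussPt = gaussPt
  -- If `f` fixes the Gauss point, `ω` is prescribed through `μE` alone; admissibility rewrites its
  -- masses in terms of `μC`, so that both descriptions are available as in the other case.
  · obtain ⟨hdiff, hC⟩ := hF.masses_of_fixed hS hAf (hadm.1 ((gamma_eq_gammaG_iff f).2 hS))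
    obtain ⟨ω₀, hat, hmass, huniq⟩ := hF.exists_omega_of_eq (μC := μC) (μE := μE) hS
    refine ⟨⟨ω₀, hmass, fun ω hω => huniq ω hω⟩, fun hμ ω hω => ?_⟩
    have hω' := hω.of_eq ((gamma_eq_gammaG_iff f).2 hS)
    have hωE : ∀ y, mass ω (IsIwasawa.imageDir c b α β γ δ y) = μE {y} := fun y =>
      hF.mass_imageDir (p := fun _ => True) (fun y _ => hω'.2 y) y trivial
    refine hF.quantPullback_eq hAf hd0 hμ (huniq ω hω ▸ hat) hω.prob (hω'.1.trans hdiff)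
      (by rw [hS]; exact hω'.1) (fun ζ => ?_) hωE
    obtain ⟨y, hy, hy'⟩ := hC ζ
    rw [hy, hωE, hy']
  · obtain ⟨ω₀, hat, hmass, hC, hE, huniq⟩ := hF.exists_omega_of_ne hS
      (hadm.2 fun h => hS ((gamma_eq_gammaG_iff f).1 h))
    refine ⟨⟨ω₀, hmass, fun ω hω => huniq ω hω⟩, fun hμ ω hω => ?_⟩
    obtain rfl := huniq ω hω
    have hω' := hω.of_ne fun h => hS ((gamma_eq_gammaG_iff f).1 h)
    exact hF.quantPullback_eq hAf hd0 hμ hat hω.prob hω'.1 hω'.2.2.1 hC hE
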